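/- Let $n\ge 2$, let $B$ and $H$ be the subgroups of $\mathrm{PGL}(n,\mathbb C)$ of (classes of) upper triangular and diagonal matrices, and let $q_1$ be the counter-diagonal matrix with all counter-diagonal entries $1$. Let $M$ be a compact oriented $3$-manifold and let $\mathcal T$ be a concrete triangulation of $M$: finitely many standard ordered $3$-simplices whose faces are glued in pairs, giving $M$ with each boundary component collapsed to a point; $\epsilon_\Delta=\pm1$ tells whether the vertex ordering of $\Delta$ induces the orientation of $M$. *Shapes.* Put $\Delta^3_m(\mathbb Z)=\{t\in\mathbb Z_{\ge0}^4:\sum t_i=m\}$. A shape assignment on a simplex assigns $z_s^e\in\mathbb C\setminus\{0,1\}$ to each $s\in\Delta^3_{n-2}(\mathbb Z)$ and each of the six non-vertex points $e\in\Delta^3_2(\mathbb Z)$, with $z_s^{0011}=z_s^{1100}=\frac1{1-z_s^{0101}}$, $z_s^{0110}=z_s^{1001}=\frac1{1-z_s^{0011}}$, $z_s^{0101}=z_s^{1010}=\frac1{1-z_s^{0110}}$. A shape assignment on $\mathcal T$ is a shape assignment $z_\Delta$ on each simplex $\Delta$ such that $\prod_{(t,\Delta)\in p}\prod_{s+e=t}(z^e_{s,\Delta})^{\epsilon_\Delta}=1$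 for each non-vertex integral point $p$ of $\mathcal T$, i.e. each class under the face gluings of pairs $(t,\Delta)$ with $t\in\Delta_n^3(\mathbb Z)$ not a vertex. This equation is called an interior, face or edge equation if $p$ lies in the interior of a simplex, face or edge. *Decorations.* A decoration of a simplex is a $4$-tuple $(g_0B,g_1B,g_2B,g_3B)$ of cosets in $\mathrm{PGL}(n,\mathbb C)/B$ up to left multiplication. It is generic if $c_t=\det(\{g_0\}_{t_0}\cup\dots\cup\{g_3\}_{t_3})\ne0$ for all $t\in\Delta^3_n(\mathbb Z)$, where $\{g\}_i$ denotes the first $i$ columns of (a lift to $\mathrm{GL}(n,\mathbb C)$ of) $g$. A decoration of $(M,\mathcal T)$ is a decoration of each simplex such that the decorations of identified faces differ by left multiplication by a unique element of $\mathrm{PGL}(n,\mathbb C)$, and such that the product of these elements around each edge of $\mathcal T$ is $1$; it is generic if it is generic on each simplex. The map $\mathcal Z$ sends a generic decoration to $$z_s^{1100}=z_s^{0011}=\frac{c_{s+1001}c_{s+0110}}{c_{s+1010}c_{s+0101}},\quad z_s^{0110}=z_s^{1001}=\frac{c_{s+0101}c_{s+1010}}{c_{s+1100}c_{s+0011}},\quad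 z_s^{1010}=z_s^{0101}=-\frac{c_{s+1100}c_{s+0011}}{c_{s+1001}c_{s+0110}}$$ on each simplex. *Cocycles.* The vertices of a doubly truncated simplex are the ordered triples $v_0v_1v_2$ of distinct vertices of the simplex. It has long edges $v_0v_1v_2\to v_1v_0v_2$, middle edges $v_0v_1v_2\to v_0v_2v_1$ and short edges $v_0v_1v_2\to v_0v_1v_3$, where $v_3$ is the remaining vertex. $\mathcal T$ decomposes $M$ into doubly truncated simplices and, around the edges of $\mathcal T$, prisms. A $\mathrm{PGL}(n,\mathbb C)$-cocycle labels the oriented edges so that reversing an edge inverts its label and the product around each $2$-face is $1$. A $(\mathrm{PGL}(n,\mathbb C),B,H)$-cocycle on a doubly truncated simplex is a $\mathrm{PGL}(n,\mathbb C)$-cocycle whose middle edges are labeled in $B$ and whose short edges are labeled in $H$. For a generic decoration of a simplex, $\mathcal L_{\alpha\beta\gamma}$ is the coboundary $\langle v,w\rangle\mapsto(\tau^{v})^{-1}\tau^{w}$ of the unique $0$-cochain $\tau$ with $(g_{v_0}B,g_{v_1}B,g_{v_2}B)=\tau^{v_0v_1v_2}(B,q_1B,n_-B)$ for all $v_0v_1v_2$,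 with (a varying) $n_-$ lower triangular with $1$'s on the diagonal and in the first column. A natural $(\mathrm{PGL}(n,\mathbb C),B,H)$-cocycle on a doubly truncated simplex is a $(\mathrm{PGL}(n,\mathbb C),B,H)$-cocycle that arises in this way, and one on $M$ is a cocycle on $M$ whose restriction to each doubly truncated simplex is natural. **Theorem.** 1. On a single simplex, $\mathcal Z$ is a well-defined bijection from generic decorations to the shape assignments satisfying the interior equations, and $\mathcal L_{\alpha\beta\gamma}$ is a well-defined bijection from generic decorations to natural $(\mathrm{PGL}(n,\mathbb C),B,H)$-cocycles. 2. Choose a generic decoration $D_\Delta$ for each simplex $\Delta$ of $\mathcal T$, with shapes $\mathcal Z(D_\Delta)$ and natural cocycles $\mathcal L_{\alpha\beta\gamma}(D_\Delta)$. The labels of the long and middle edges on all identified faces agree if and only if the shapes satisfy the face equations. The product of the short edges around each polygonal end of each prism is $1$ if and only if the shapes satisfy the edge equations. Hence the cocycles form a cocycle on $M$ if and only if the face and edge equations hold. 3. Applied on each simplex, $\mathcal Z$ and $\mathcal L_{\alpha\beta\gamma}$ are well-defined bijections $$\{\text{shape assignments on }\mathcal T\}\xleftarrow{\ \mathcal Z\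 }\{\text{generic }\mathrm{PGL}(n,\mathbb C)/B\text{-decorations of }(M,\mathcal T)\}\xrightarrow{\ \mathcal L_{\alpha\beta\gamma}\ }\{\text{natural }(\mathrm{PGL}(n,\mathbb C),B,H)\text{-cocycles on }M\}.$$ -/

import Mathlib

open scoped MatrixGroups

namespace GluingEq

open Matrix Equiv

/-! ### Triangulations

A concrete triangulation of a compact oriented 3-manifold `M` (with every boundary component
collapsed to a point) by finitely many standard ordered simplices, given by its face pairings. -/

/-- A concrete triangulation with set of simplices `T`. Face `i` of a simplex is the face opposite
to vertex `i`. Face `i` of `Δ` is glued to face `perm Δ i i` of `adj Δ i`; the vertex `v ≠ i` of `Δ`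
goes to the vertex `perm Δ i v`. All faces are glued in pairs of distinct faces. The sign
`orient Δ` tells whether the orientation of `Δ` given by the vertex ordering agrees with the
orientation of the manifold. -/
structure Triangulation (T : Type*) where
  adj : T → Fin 4 → T
  perm : T → Fin 4 → Perm (Fin 4)
  adj_adj : ∀ Δ i, adj (adj Δ i) (perm Δ i i) = Δ
  perm_adj : ∀ Δ i, perm (adj Δ i) (perm Δ i i) = (perm Δ i)⁻¹
  face_ne : ∀ Δ i, (adj Δ i, perm Δ i i) ≠ (Δ, i)
  orient : T → ℤˣ
  sign_perm : ∀ Δ i, Perm.sign (perm Δ i) = -(orient Δ * orient (adj Δ i))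

/-- The integral points of the simplex `x₀ + x₁ + x₂ + x₃ = n`, `xᵢ ≥ 0`. -/
def Pt (n : ℕ) : Type := {t : Fin 4 → ℕ // ∑ i, t i = n}

instance (n : ℕ) : Fintype (Pt n) :=
  Fintype.subtype (Finset.piAntidiag Finset.univ n) (by simp [Finset.mem_piAntidiag])

/-- The non-vertex integral points of the simplex of size `2`: they index the six edges. -/
def Edge : Type := {e : Pt 2 // ∀ i, e.1 i ≤ 1}

noncomputable instance : Fintype Edge :=
  @Subtype.fintype (Pt 2) _ (Classical.decPred _) _

def e1100 : Edge := ⟨⟨![1, 1, 0, 0], by decide⟩, by decide⟩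
def e0011 : Edge := ⟨⟨![0, 0, 1, 1], by decide⟩, by decide⟩
def e0110 : Edge := ⟨⟨![0, 1, 1, 0], by decide⟩, by decide⟩
def e1001 : Edge := ⟨⟨![1, 0, 0, 1], by decide⟩, by decide⟩
def e1010 : Edge := ⟨⟨![1, 0, 1, 0], by decide⟩, by decide⟩
def e0101 : Edge := ⟨⟨![0, 1, 0, 1], by decide⟩, by decide⟩

/-- The number of vanishing coordinates of an integral point: `0` for interior points, `1` for
points inside a face, `2` for points inside an edge, `3` for vertices. -/
def Pt.zeros {n : ℕ} (t : Pt n) : ℕ := (Finset.univ.filter fun i => t.1 i = 0).card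

/-! ### Shape assignments and gluing equations -/

/-- A shape assignment on one simplex: only the shape parameter relations are imposed. -/
@[ext]
structure SimplexShape (n : ℕ) where
  toFun : Pt (n - 2) → Edge → ℂ
  ne_zero : ∀ s e, toFun s e ≠ 0
  ne_one : ∀ s e, toFun s e ≠ 1
  rel_0011 : ∀ s, toFun s e0011 = 1 / (1 - toFun s e0101) ∧ toFun s e1100 = toFun s e0011
  rel_0110 : ∀ s, toFun s e0110 = 1 / (1 - toFun s e0011) ∧ toFun s e1001 = toFun s e0110
  rel_0101 : ∀ s, toFun s e0101 = 1 / (1 - toFun s e0110) ∧ toFun s e1010 = toFun s e0101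

open scoped Classical in
/-- The product of the shape parameters `z_s^e` over all `s + e = t`. -/
noncomputable def SimplexShape.prodAt {n : ℕ} (z : SimplexShape n) (t : Pt n) : ℂ :=
  ∏ p : Pt (n - 2) × Edge with p.1.1 + p.2.1.1 = t.1, z.toFun p.1 p.2

/-- The interior equations of one simplex. -/
def SimplexShape.InteriorEqs {n : ℕ} (z : SimplexShape n) : Prop :=
  ∀ t : Pt n, t.zeros = 0 → z.prodAt t = 1

namespace Triangulation

variable {T : Type*} (𝒯 : Triangulation T)

/-- `(t, Δ)` and `(t', Δ')` are identified by one face pairing. -/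
def FaceRel {n : ℕ} (x y : T × Pt n) : Prop :=
  ∃ i, x.2.1 i = 0 ∧ y.1 = 𝒯.adj x.1 i ∧ ∀ v, y.2.1 (𝒯.perm x.1 i v) = x.2.1 v

/-- `(t, Δ)` and `(t', Δ')` represent the same integral point of the triangulation. -/
def SamePoint {n : ℕ} : T × Pt n → T × Pt n → Prop := Relation.EqvGen 𝒯.FaceRel

open scoped Classical in
/-- The generalized gluing equation of the integral point represented by `p`. -/
def GluingEqAt [Fintype T] {n : ℕ} (z : T → SimplexShape n) (p : T × Pt n) : Prop :=
  ∏ x : T × Pt n with 𝒯.SamePoint p x,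
    ((z x.1).prodAt x.2) ^ ((𝒯.orient x.1 : ℤˣ) : ℤ) = 1

/-- The gluing equations of all integral points inside a face. -/
def FaceEqs [Fintype T] {n : ℕ} (z : T → SimplexShape n) : Prop :=
  ∀ p : T × Pt n, p.2.zeros = 1 → 𝒯.GluingEqAt z p

/-- The gluing equations of all integral points inside an edge. -/
def EdgeEqs [Fintype T] {n : ℕ} (z : T → SimplexShape n) : Prop :=
  ∀ p : T × Pt n, p.2.zeros = 2 → 𝒯.GluingEqAt z p

/-- The shape assignments on the triangulation: all gluing equations of non-vertex integral
points hold. -/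
def ShapeAssignment [Fintype T] (n : ℕ) : Type _ :=
  {z : T → SimplexShape n // ∀ p : T × Pt n, p.2.zeros ≠ 3 → 𝒯.GluingEqAt z p}

/-- The vertex `v₀v₁v₂` of a doubly truncated simplex is the permutation `w` with `w k = v_k` (so
`w 3` is the remaining vertex). In the simplex `x.1`, walk along the short edge from `v₀v₁v₂` to
`v₀v₁v₃`, and then cross the face `v₀v₁v₃` into the neighbouring simplex. Iterating this goes once
around the edge `v₀v₁` of the triangulation, near its end `v₀`. -/
def edgeStep (x : T × Perm (Fin 4)) : T × Perm (Fin 4) :=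
  (𝒯.adj x.1 (x.2 2), 𝒯.perm x.1 (x.2 2) * x.2 * swap 2 3)

end Triangulation

/-! ### Decorations -/

/-- The `G/H`-decorations of an ordered simplex: four cosets up to the action of `G`. -/
abbrev SimplexDecoration (G : Type*) [Group G] (H : Subgroup G) : Type _ :=
  MulAction.orbitRel.Quotient G (Fin 4 → G ⧸ H)

/-- The decoration represented by a tuple of cosets. -/
def SimplexDecoration.of {G : Type*} [Group G] {H : Subgroup G} (F : Fin 4 → G ⧸ H) :
    SimplexDecoration G H :=
  Quotient.mk (MulAction.orbitRel G (Fin 4 → G ⧸ H)) F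

namespace Triangulation

variable {T : Type*} (𝒯 : Triangulation T) {G : Type*} [Group G] {H : Subgroup G}

/-- Left multiplication by `h` takes the cosets on face `i` of `Δ` to the cosets on the face glued
to it. -/
def Glues (F : T → Fin 4 → G ⧸ H) (Δ : T) (i : Fin 4) (h : G) : Prop :=
  ∀ v, v ≠ i → h • F Δ v = F (𝒯.adj Δ i) (𝒯.perm Δ i v)

/-- A `G/H`-decoration of the triangulated manifold: a decoration of each simplex, such that
identified faces differ by a unique element of `G`, and such that these elements compose to the
identity around each edge (so that they define a representation of the fundamental group). Neither
condition depends on the representing tuples `F`. -/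
@[ext]
structure Decoration (𝒯 : Triangulation T) (G : Type*) [Group G] (H : Subgroup G) where
  toFun : T → SimplexDecoration G H
  face : ∀ F : T → Fin 4 → G ⧸ H, (∀ Δ, SimplexDecoration.of (F Δ) = toFun Δ) →
    ∀ Δ i, ∃! h : G, 𝒯.Glues F Δ i h
  edge : ∀ F : T → Fin 4 → G ⧸ H, (∀ Δ, SimplexDecoration.of (F Δ) = toFun Δ) →
    ∀ h : T → Fin 4 → G, (∀ Δ i, 𝒯.Glues F Δ i (h Δ i)) →
    ∀ (x : T × Perm (Fin 4)) (k : ℕ), 𝒯.edgeStep^[k] x = x →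
      ((List.range k).map fun j =>
        (h (𝒯.edgeStep^[j] x).1 ((𝒯.edgeStep^[j] x).2 2))⁻¹).prod = 1

end Triangulation

/-! ### Cocycles on doubly truncated simplices -/

/-- A labeling of the oriented edges of a doubly truncated simplex, each indexed by its initial
vertex `w = v₀v₁v₂`: the long edge ends at `v₁v₀v₂`, the middle edge at `v₀v₂v₁`, and the short edge
at `v₀v₁v₃`. -/
@[ext]
structure Labeling (G : Type*) where
  long : Perm (Fin 4) → G
  middle : Perm (Fin 4) → G
  short : Perm (Fin 4) → G

namespace Labeling

variable {G : Type*} [Group G]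

/-- `G`-cocycles on a doubly truncated simplex. -/
structure IsCocycle (c : Labeling G) : Prop where
  long_rev : ∀ w, c.long (w * swap 0 1) = (c.long w)⁻¹
  middle_rev : ∀ w, c.middle (w * swap 1 2) = (c.middle w)⁻¹
  short_rev : ∀ w, c.short (w * swap 2 3) = (c.short w)⁻¹
  /-- the hexagon in face `v₀v₁v₂` -/
  face_hexagon : ∀ w, c.long w * c.middle (w * swap 0 1) *
    c.long (w * swap 0 1 * swap 1 2) * c.middle (w * swap 0 1 * swap 1 2 * swap 0 1) *
    c.long (w * swap 0 1 * swap 1 2 * swap 0 1 * swap 1 2) *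
    c.middle (w * swap 0 1 * swap 1 2 * swap 0 1 * swap 1 2 * swap 0 1) = 1
  /-- the hexagon near the vertex `v₀` -/
  vertex_hexagon : ∀ w, c.middle w * c.short (w * swap 1 2) *
    c.middle (w * swap 1 2 * swap 2 3) * c.short (w * swap 1 2 * swap 2 3 * swap 1 2) *
    c.middle (w * swap 1 2 * swap 2 3 * swap 1 2 * swap 2 3) *
    c.short (w * swap 1 2 * swap 2 3 * swap 1 2 * swap 2 3 * swap 1 2) = 1
  /-- the rectangle near the edge `v₀v₁` -/
  rectangle : ∀ w, c.long w * c.short (w * swap 0 1) * c.long (w * swap 0 1 * swap 2 3) *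
    c.short (w * swap 0 1 * swap 2 3 * swap 0 1) = 1

/-- `(G, H, K)`-cocycles on a doubly truncated simplex. -/
structure IsGHKCocycle (c : Labeling G) (H K : Subgroup G) : Prop extends c.IsCocycle where
  middle_mem : ∀ w, c.middle w ∈ H
  short_mem : ∀ w, c.short w ∈ K

/-- The coboundary of a `0`-cochain. -/
def coboundary (τ : Perm (Fin 4) → G) : Labeling G where
  long w := (τ w)⁻¹ * τ (w * swap 0 1)
  middle w := (τ w)⁻¹ * τ (w * swap 1 2)
  short w := (τ w)⁻¹ * τ (w * swap 2 3)

end Labeling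

namespace Triangulation

variable {T : Type*} (𝒯 : Triangulation T) {G : Type*} [Group G]

/-- The labels of the long and middle edges in glued faces agree. (The face containing the vertex
`w` and the long and middle edges starting there is the face opposite to `w 3`.) -/
def FacesMatch (c : T → Labeling G) : Prop :=
  ∀ Δ (w : Perm (Fin 4)),
    (c (𝒯.adj Δ (w 3))).long (𝒯.perm Δ (w 3) * w) = (c Δ).long w ∧
    (c (𝒯.adj Δ (w 3))).middle (𝒯.perm Δ (w 3) * w) = (c Δ).middle w

/-- The cocycle condition on the polygonal ends of the prisms around the edges: the product of the
short edges around the polygon is `1`. (The rectangular sides of a prism are faces of the doubly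
truncated simplices.) -/
def PrismsClose (c : T → Labeling G) : Prop :=
  ∀ (x : T × Perm (Fin 4)) (k : ℕ), 𝒯.edgeStep^[k] x = x →
    ((List.range k).map fun j =>
      (c (𝒯.edgeStep^[j] x).1).short (𝒯.edgeStep^[j] x).2).prod = 1

/-- `G`-cocycles on the manifold, decomposed into doubly truncated simplices and prisms. -/
structure IsCocycle (c : T → Labeling G) : Prop where
  simplex : ∀ Δ, (c Δ).IsCocycle
  faces : 𝒯.FacesMatch c
  prisms : 𝒯.PrismsClose c

end Triangulation

/-! ### Subgroups of `PGL(n, ℂ)` -/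

/-- The upper triangular subgroup of `GL(n, ℂ)`. -/
def upperGL (n : ℕ) : Subgroup (GL (Fin n) ℂ) where
  carrier := {g | g.1.BlockTriangular id}
  mul_mem' := fun ha hb => by
    simpa using Matrix.BlockTriangular.mul ha hb
  one_mem' := Matrix.blockTriangular_one
  inv_mem' := fun {g} hg => by
    have : Invertible g.1 := g.invertible
    simpa using Matrix.blockTriangular_inv_of_blockTriangular (M := g.1) hg

/-- The diagonal subgroup of `GL(n, ℂ)`. -/
def diagGL (n : ℕ) : Subgroup (GL (Fin n) ℂ) where
  carrier := {g | g.1.BlockTriangular id ∧ g.1.BlockTriangular OrderDual.toDual}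
  mul_mem' := fun ha hb =>
    ⟨by simpa using Matrix.BlockTriangular.mul ha.1 hb.1,
      by simpa using Matrix.BlockTriangular.mul ha.2 hb.2⟩
  one_mem' := ⟨Matrix.blockTriangular_one, Matrix.blockTriangular_one⟩
  inv_mem' := fun {g} hg => by
    have : Invertible g.1 := g.invertible
    exact ⟨by simpa using Matrix.blockTriangular_inv_of_blockTriangular (M := g.1) hg.1,
      by simpa using Matrix.blockTriangular_inv_of_blockTriangular (M := g.1) hg.2⟩

theorem mem_diagGL {n : ℕ} (g : GL (Fin n) ℂ) : g ∈ diagGL n ↔ ∀ i j, i ≠ j → g.1 i j = 0 := by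
  constructor
  · rintro ⟨h₁, h₂⟩ i j hij
    rcases lt_or_gt_of_ne hij with h | h
    · exact h₂ (by simpa using h)
    · exact h₁ h
  · intro h
    refine ⟨fun i j hij => h i j ?_, fun i j hij => h i j ?_⟩
    · rintro rfl; exact lt_irrefl _ hij
    · rintro rfl; exact lt_irrefl _ hij

/-- The subgroup `B` of `PGL(n, ℂ)`. -/
def B (n : ℕ) : Subgroup PGL(n, ℂ) := (upperGL n).map ProjGenLinGroup.mk

/-- The subgroup `H` of `PGL(n, ℂ)`. -/
def H (n : ℕ) : Subgroup PGL(n, ℂ) := (diagGL n).map ProjGenLinGroup.mk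

/-- The counter diagonal matrix `q₁` whose non-zero entries are all `1`. -/
def q₁ (n : ℕ) : GL (Fin n) ℂ where
  val := Matrix.of fun i j => if j = Fin.rev i then 1 else 0
  inv := Matrix.of fun i j => if j = Fin.rev i then 1 else 0
  val_inv := by
    ext i j
    have h : ∀ k : Fin n, j = k.rev ↔ k = j.rev := fun k => by
      rw [eq_comm, Fin.rev_eq_iff]
    simp [Matrix.mul_apply, Matrix.one_apply, h, eq_comm]
  inv_val := by
    ext i j
    have h : ∀ k : Fin n, j = k.rev ↔ k = j.rev := fun k => by
      rw [eq_comm, Fin.rev_eq_iff]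
    simp [Matrix.mul_apply, Matrix.one_apply, h, eq_comm]

/-- `m` is lower triangular with `1`'s on the diagonal and in the first column. -/
def IsNormalizedLower {n : ℕ} (m : GL (Fin n) ℂ) : Prop :=
  (∀ i j, i < j → m.1 i j = 0) ∧ (∀ i, m.1 i i = 1) ∧ ∀ i j, j.val = 0 → m.1 i j = 1

/-- The coset in `PGL(n, ℂ)/B` of (the class of) a matrix. -/
def flag {n : ℕ} (g : GL (Fin n) ℂ) : PGL(n, ℂ) ⧸ B n := (ProjGenLinGroup.mk g : PGL(n, ℂ))

/-- `PGL(n, ℂ)/B`-decorations of a simplex. -/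
abbrev Deco (n : ℕ) : Type := SimplexDecoration PGL(n, ℂ) (B n)

/-- The decoration represented by four matrices. -/
def decoOf {n : ℕ} (g : Fin 4 → GL (Fin n) ℂ) : Deco n := SimplexDecoration.of fun i => flag (g i)

/-! ### The map from generic decorations to shapes -/

/-- The matrix whose columns are the first `t₀` columns of `g₀`, followed by the first `t₁` columns
of `g₁`, the first `t₂` columns of `g₂`, and the first `t₃` columns of `g₃`
(for `t₀ + t₁ + t₂ + t₃ = n`). -/
def colUnion {n : ℕ} (g : Fin 4 → GL (Fin n) ℂ) (t : Fin 4 → ℕ) : Matrix (Fin n) (Fin n) ℂ :=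
  Matrix.of fun r k =>
    if (k : ℕ) < t 0 then (g 0).1 r k
    else if (k : ℕ) < t 0 + t 1 then (g 1).1 r ⟨k - t 0, by omega⟩
    else if (k : ℕ) < t 0 + t 1 + t 2 then (g 2).1 r ⟨k - (t 0 + t 1), by omega⟩
    else (g 3).1 r ⟨k - (t 0 + t 1 + t 2), by omega⟩

/-- The Ptolemy coordinate `c_t = det({g₀}_{t₀} ∪ {g₁}_{t₁} ∪ {g₂}_{t₂} ∪ {g₃}_{t₃})`. -/
noncomputable def ptolemy {n : ℕ} (g : Fin 4 → GL (Fin n) ℂ) (t : Fin 4 → ℕ) : ℂ :=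
  (colUnion g t).det

/-- A decoration is generic if all Ptolemy coordinates of representing matrices are non-zero. -/
def IsGeneric {n : ℕ} (D : Deco n) : Prop :=
  ∀ g : Fin 4 → GL (Fin n) ℂ, decoOf g = D → ∀ t : Pt n, ptolemy g t.1 ≠ 0

/-- `z` is the image of `c` under the monomial map from Ptolemy coordinates to shapes. -/
def IsMonomialShape {n : ℕ} (c : (Fin 4 → ℕ) → ℂ) (z : SimplexShape n) : Prop :=
  ∀ s : Pt (n - 2),
    (z.toFun s e1100 =
        (c (s.1 + ![1, 0, 0, 1]) * c (s.1 + ![0, 1, 1, 0])) /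
          (c (s.1 + ![1, 0, 1, 0]) * c (s.1 + ![0, 1, 0, 1])) ∧
      z.toFun s e0011 = z.toFun s e1100) ∧
    (z.toFun s e0110 =
        (c (s.1 + ![0, 1, 0, 1]) * c (s.1 + ![1, 0, 1, 0])) /
          (c (s.1 + ![1, 1, 0, 0]) * c (s.1 + ![0, 0, 1, 1])) ∧
      z.toFun s e1001 = z.toFun s e0110) ∧
    (z.toFun s e1010 =
        -((c (s.1 + ![1, 1, 0, 0]) * c (s.1 + ![0, 0, 1, 1])) /
          (c (s.1 + ![1, 0, 0, 1]) * c (s.1 + ![0, 1, 1, 0]))) ∧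
      z.toFun s e0101 = z.toFun s e1010)

/-- `z = 𝒵(D)`: the shapes are computed from the Ptolemy coordinates of any four matrices
representing `D`. -/
def IsShapeOf {n : ℕ} (D : Deco n) (z : SimplexShape n) : Prop :=
  ∀ g : Fin 4 → GL (Fin n) ℂ, decoOf g = D → IsMonomialShape (ptolemy g) z

/-! ### Natural cocycles -/

/-- The `0`-cochain `τ` satisfies `(g_{v₀}B, g_{v₁}B, g_{v₂}B) = τ^{v₀v₁v₂} (B, q₁B, mB)` with `m`
lower unitriangular and normalized, at each vertex `v₀v₁v₂`. -/
def IsNaturalCochain {n : ℕ} (F : Fin 4 → PGL(n, ℂ) ⧸ B n) (τ : Perm (Fin 4) → PGL(n, ℂ)) : Prop :=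
  ∀ w, ∃ m : GL (Fin n) ℂ, IsNormalizedLower m ∧
    F (w 0) = τ w • flag 1 ∧ F (w 1) = τ w • flag (q₁ n) ∧ F (w 2) = τ w • flag m

/-- `c = ℒ_{αβγ}(D)`: `c` is the coboundary of the unique natural `0`-cochain (of any tuple of
cosets representing `D`). -/
def IsNaturalCocycleOf {n : ℕ} (D : Deco n) (c : Labeling PGL(n, ℂ)) : Prop :=
  ∀ F, SimplexDecoration.of F = D →
    (∃! τ, IsNaturalCochain F τ) ∧ ∀ τ, IsNaturalCochain F τ → c = Labeling.coboundary τ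

/-- Natural `(PGL(n, ℂ), B, H)`-cocycles on a doubly truncated simplex: the
`(PGL(n, ℂ), B, H)`-cocycles which are the natural cocycle of a generic decoration. -/
def IsNatural {n : ℕ} (c : Labeling PGL(n, ℂ)) : Prop :=
  c.IsGHKCocycle (B n) (H n) ∧ ∃ D : Deco n, IsGeneric D ∧ IsNaturalCocycleOf D c

/-! ### The sets in the bottom row of the diagram -/

/-- Generic decorations of a simplex. -/
def GenericDeco (n : ℕ) : Type := {D : Deco n // IsGeneric D}

/-- Shape assignments of a simplex satisfying the interior equations. -/
def InteriorShape (n : ℕ) : Type := {z : SimplexShape n // z.InteriorEqs}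

/-- Natural cocycles on a doubly truncated simplex. -/
def NaturalCocycle (n : ℕ) : Type := {c : Labeling PGL(n, ℂ) // IsNatural c}

namespace Triangulation

variable {T : Type*} (𝒯 : Triangulation T)

/-- Generic `PGL(n, ℂ)/B`-decorations of the triangulated manifold. -/
def GenericDecoration (n : ℕ) : Type _ :=
  {D : 𝒯.Decoration PGL(n, ℂ) (B n) // ∀ Δ, IsGeneric (D.toFun Δ)}

/-- Natural `(PGL(n, ℂ), B, H)`-cocycles on the manifold: cocycles whose restriction to each doubly
truncated simplex is natural. -/
def NaturalCocycles (n : ℕ) : Type _ :=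
  {c : T → Labeling PGL(n, ℂ) // 𝒯.IsCocycle c ∧ ∀ Δ, IsNatural (c Δ)}

end Triangulation

end GluingEq

/-!
# Shapes, decorations and natural cocycles

A coset `gB` is a flag, and the Ptolemy coordinates of four flags are the values of the determinant,
as a linear form on the exterior algebra, at products of the blades `v₀ ∧ ⋯ ∧ v_{k-1}` of the flags
(`ptolemy_eq_mixedVol`). The Plücker relation for this form gives the relation
`c_{s+1100} c_{s+0011} + c_{s+1001} c_{s+0110} = c_{s+1010} c_{s+0101}` (`ptolemy_relation`), which is
the shape parameter relation. Changing the representatives of the flags multiplies `c_t` by a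
product of functions of the single coordinates `tᵢ`, which cancels in the shapes, and reordering the
vertices of the simplex by `w` raises the product of shapes around an integral point to the power
`sign w` (`around_comp`). In a product around an interior point all Ptolemy coordinates cancel. Around
a point inside a face there remains a triple ratio of the three flags of the face, and around a point
inside an edge a single shape.

*One simplex.* A generic triple of flags has a unique normal form `τ (B, q₁B, mB)`
(`exists_isNormalization`, `IsNormalization.unique`), and `m` is determined by the triple ratios
(`IsNormalization.eq_of_tripleRatio_eq`). If two triples share their first two flags, then the
elements `τ` differ by a diagonal matrix, the label of a short edge, and the ratios of its
consecutive entries are the shapes along the edge (`shapeA_edge_eq`). So the shapes determine the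
decoration (`decoOf_eq_of_isMonomialShape`). Conversely, triples of flags with arbitrary triple ratios
exist (`exists_blade_tripleRatio`); two of them, put together according to the shapes along their
common edge, form a decoration with the given products of shapes on two faces and on their common
edge. The interior equations then identify all shapes, by induction on `t₂ + t₃`
(`SimplexShape.InteriorEqs.exists_isMonomialShape`). A natural cocycle is the coboundary of a cochain
which is determined by it up to left multiplication, and the flags can be read off the cochain, so
natural cocycles determine decorations (`IsNaturalCocycleOf.injective`).

*The triangulation.* An integral point inside a face lies in two simplices, and its gluing equation
says that the two triple ratios agree. So the face equations say that the two triples of flags have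
the same normal form, that is, differ by left multiplication (`faceEqs_iff`), that is, the cochains do
(`glues_iff`), that is, the labels on the faces agree (`facesMatch_coboundary_iff`).
The points identified with a point inside an edge are met by walking once around the edge, each
exactly once: by orientability the walk cannot return to the same point with the two faces at the
edge exchanged, and it cannot return with the edge reversed because no face is glued to itself
(`Triangulation.vertexPt_edge_injOn`). So the edge equations say that the consecutive entries of the
product of the diagonal short labels around a prism agree, i.e. that the product is trivial in
`PGL(n, ℂ)` (`edgeEqs_iff`). When the faces match, this product is conjugate to the product of the
gluing elements around the edge (`prod_short_eq`), so that cocycles on the manifold are the same as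
decorations (`exists_decoration_iff`).
-/

namespace GluingEq

open Matrix Equiv

/-! ### Ptolemy coordinates in the exterior algebra -/

section Blades

variable {n : ℕ}

open ExteriorAlgebra (ι)

/-- The wedge product `v₀ ∧ ⋯ ∧ v_{k-1}` of the first `k` vectors of a sequence. -/
noncomputable def blade (v : ℕ → Fin n → ℂ) (k : ℕ) : ExteriorAlgebra ℂ (Fin n → ℂ) :=
  ((List.range k).map fun j => ι ℂ (v j)).prod

/-- The determinant as a linear form on the exterior algebra, zero in degrees other than `n`. -/
noncomputable def volForm (n : ℕ) : ExteriorAlgebra ℂ (Fin n → ℂ) →ₗ[ℂ] ℂ :=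
  ExteriorAlgebra.liftAlternating (Pi.single n Matrix.detRowAlternating)

/-- The Ptolemy coordinate `det({v₀}_{t₀} ∪ {v₁}_{t₁} ∪ {v₂}_{t₂} ∪ {v₃}_{t₃})` of four sequences of
vectors. -/
noncomputable def mixedVol (v : Fin 4 → ℕ → Fin n → ℂ) (t : Fin 4 → ℕ) : ℂ :=
  volForm n (blade (v 0) (t 0) * blade (v 1) (t 1) * blade (v 2) (t 2) * blade (v 3) (t 3))

/-- The columns of a matrix, as a sequence padded by zero. -/
def cols (A : Matrix (Fin n) (Fin n) ℂ) (k : ℕ) : Fin n → ℂ :=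
  fun r => if h : k < n then A r ⟨k, h⟩ else 0

@[simp] lemma cols_val (A : Matrix (Fin n) (Fin n) ℂ) (k r : Fin n) : cols A k r = A r k := by
  simp [cols]

@[simp] lemma blade_zero (v : ℕ → Fin n → ℂ) : blade v 0 = 1 := by simp [blade]

lemma blade_succ (v : ℕ → Fin n → ℂ) (k : ℕ) : blade v (k + 1) = blade v k * ι ℂ (v k) := by
  simp [blade, List.range_succ]

lemma blade_congr {v w : ℕ → Fin n → ℂ} {k : ℕ} (h : ∀ j < k, v j = w j) :
    blade v k = blade w k := by
  unfold blade
  congr 1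
  exact List.map_congr_left fun j hj => by rw [h j (List.mem_range.1 hj)]

lemma volForm_ofFn (w : Fin n → Fin n → ℂ) :
    volForm n (List.ofFn fun i => ι ℂ (w i)).prod = (Matrix.of w).det := by
  rw [← ExteriorAlgebra.ιMulti_apply, volForm, ExteriorAlgebra.liftAlternating_apply_ιMulti,
    Pi.single_eq_same]
  rfl

lemma volForm_blade_cols (A : Matrix (Fin n) (Fin n) ℂ) : volForm n (blade (cols A) n) = A.det := by
  have : blade (cols A) n = (List.ofFn fun i : Fin n => ι ℂ (cols A i)).prod := by
    unfold blade
    congr 1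
    apply List.ext_getElem <;> simp
  rw [this, volForm_ofFn, ← det_transpose]
  congr 1
  ext i j
  simp

lemma ptolemy_eq_mixedVol (g : Fin 4 → GL (Fin n) ℂ) (t : Fin 4 → ℕ) (ht : ∑ i, t i = n) :
    ptolemy g t = mixedVol (fun i => cols (g i).1) t := by
  have h : blade (cols (g 0).1) (t 0) * blade (cols (g 1).1) (t 1) * blade (cols (g 2).1) (t 2) *
      blade (cols (g 3).1) (t 3) =
      (List.ofFn fun k : Fin n => ι ℂ (fun r => colUnion g t r k)).prod := by
    unfold blade
    rw [← List.prod_append, ← List.prod_append, ← List.prod_append]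
    congr 1
    rw [Fin.sum_univ_four] at ht
    apply List.ext_getElem
    · simpa [add_assoc] using ht
    · intro k h₁ h₂
      simp only [List.length_append, List.length_map, List.length_range] at h₁
      simp only [List.getElem_append, List.getElem_ofFn, List.length_append, List.length_map,
        List.length_range, List.getElem_map, List.getElem_range]
      have key : ∀ m : ℕ, ∀ hm : m < n, ∀ A : Matrix (Fin n) (Fin n) ℂ,
          cols A m = fun r => A r ⟨m, hm⟩ := fun m hm A => by ext r; simp [cols, hm]
      split_ifs with h1 h2 h3
      · rw [key _ (by omega)]; congr 1; ext r; simp [colUnion, h3]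
      · rw [key _ (by omega)]; congr 1; ext r; simp [colUnion, h2, h3]
      · rw [key _ (by omega)]; congr 1; ext r
        simp [colUnion, show ¬ k < t 0 by omega, h1, h2]
      · rw [key _ (by omega)]; congr 1; ext r
        simp [colUnion, show ¬ k < t 0 by omega, show ¬ k < t 0 + t 1 by omega, h1]
  rw [mixedVol, h]
  exact (det_transpose _).symm.trans (volForm_ofFn fun k r => colUnion g t r k).symm

lemma ι_mul_blade (x : Fin n → ℂ) (v : ℕ → Fin n → ℂ) (k : ℕ) :
    ι ℂ x * blade v k = (-1 : ℂ) ^ k • (blade v k * ι ℂ x) := by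
  induction k with
  | zero => simp
  | succ k ih =>
    have h : ι ℂ x * ι ℂ (v k) = -(ι ℂ (v k) * ι ℂ x) :=
      eq_neg_of_add_eq_zero_left (ExteriorAlgebra.ι_add_mul_swap x (v k))
    rw [blade_succ, ← mul_assoc, ih, smul_mul_assoc, mul_assoc, h, pow_succ]
    simp [mul_assoc]

lemma ι_mul_blade_mul (x : Fin n → ℂ) (v : ℕ → Fin n → ℂ) (k : ℕ)
    (y : ExteriorAlgebra ℂ (Fin n → ℂ)) :
    ι ℂ x * (blade v k * y) = (-1 : ℂ) ^ k • (blade v k * (ι ℂ x * y)) := by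
  rw [← mul_assoc, ι_mul_blade, smul_mul_assoc, mul_assoc]

lemma blade_mul_blade (u v : ℕ → Fin n → ℂ) (k l : ℕ) :
    blade u k * blade v l = (-1 : ℂ) ^ (k * l) • (blade v l * blade u k) := by
  induction k with
  | zero => simp
  | succ k ih =>
    rw [blade_succ, mul_assoc, ι_mul_blade, mul_smul_comm, ← mul_assoc, ih, smul_mul_assoc,
      smul_smul, mul_assoc, ← pow_add]
    congr 2
    ring

lemma blade_mul_ι_of_lt (v : ℕ → Fin n → ℂ) {j k : ℕ} (h : j < k) :
    blade v k * ι ℂ (v j) = 0 := by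
  induction k with
  | zero => omega
  | succ k ih =>
    rw [blade_succ, mul_assoc]
    rcases Nat.lt_succ_iff_lt_or_eq.1 h with h' | rfl
    · rw [eq_neg_of_add_eq_zero_left (ExteriorAlgebra.ι_add_mul_swap (v k) (v j)), mul_neg,
        ← mul_assoc, ih h', zero_mul, neg_zero]
    · rw [ExteriorAlgebra.ι_sq_zero, mul_zero]

lemma span_eq_top_of_volForm_ne_zero (l : List (Fin n → ℂ)) (hl : l.length = n)
    (h : volForm n (l.map (ι ℂ)).prod ≠ 0) : Submodule.span ℂ {x | x ∈ l} = ⊤ := by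
  have e : l.map (ι ℂ) = List.ofFn fun i : Fin n => ι ℂ (l.get (i.cast hl.symm)) := by
    apply List.ext_getElem <;> simp [hl]
  rw [e, volForm_ofFn] at h
  have hli := Matrix.linearIndependent_rows_of_det_ne_zero h
  have := hli.span_eq_top_of_card_eq_finrank' (by simp)
  rw [eq_top_iff, ← this]
  apply Submodule.span_mono
  rintro _ ⟨i, rfl⟩
  exact List.get_mem _ _

lemma blade_eq_map (v : ℕ → Fin n → ℂ) (k : ℕ) :
    blade v k = (((List.range k).map v).map (ι ℂ)).prod := by
  simp [blade, Function.comp_def]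

/-- If two partial flags of complementary dimensions are transversal, then they span. -/
lemma mem_span_sup_span (u v : ℕ → Fin n → ℂ) {a b : ℕ} (hab : a + b = n)
    (h : volForm n (blade u a * blade v b) ≠ 0) (x : Fin n → ℂ) :
    x ∈ Submodule.span ℂ (u '' Set.Iio a) ⊔ Submodule.span ℂ (v '' Set.Iio b) := by
  have := span_eq_top_of_volForm_ne_zero ((List.range a).map u ++ (List.range b).map v)
    (by simpa using hab) (by rwa [List.map_append, List.prod_append, ← blade_eq_map,
      ← blade_eq_map])
  rw [← Submodule.span_union]
  have hx : x ∈ (⊤ : Submodule ℂ (Fin n → ℂ)) := trivial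
  rw [← this] at hx
  refine Submodule.span_mono ?_ hx
  intro y hy
  simpa [Set.mem_union, eq_comm] using hy

section Plucker

variable (l : List (Fin n → ℂ))

/-- The form `(x, y) ↦ vol(S ∧ x ∧ y)` has rank at most two, hence is proportional to a `2 × 2`
determinant. -/
lemma volForm_mul_volForm (hl : l.length + 2 = n) (p q x y : Fin n → ℂ)
    (h : volForm n ((l.map (ι ℂ)).prod * ι ℂ p * ι ℂ q) ≠ 0) :
    volForm n ((l.map (ι ℂ)).prod * ι ℂ p * ι ℂ q) *
        volForm n ((l.map (ι ℂ)).prod * ι ℂ x * ι ℂ y) =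
      volForm n ((l.map (ι ℂ)).prod * ι ℂ x * ι ℂ q) *
        volForm n ((l.map (ι ℂ)).prod * ι ℂ p * ι ℂ y) -
      volForm n ((l.map (ι ℂ)).prod * ι ℂ y * ι ℂ q) *
        volForm n ((l.map (ι ℂ)).prod * ι ℂ p * ι ℂ x) := by
  have hsw : ∀ a b, volForm n ((l.map (ι ℂ)).prod * ι ℂ a * ι ℂ b) =
      -volForm n ((l.map (ι ℂ)).prod * ι ℂ b * ι ℂ a) := fun a b => by
    rw [mul_assoc, eq_neg_of_add_eq_zero_left (ExteriorAlgebra.ι_add_mul_swap a b), mul_neg,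
      map_neg, mul_assoc]
  have hself : ∀ a, volForm n ((l.map (ι ℂ)).prod * ι ℂ a * ι ℂ a) = 0 := fun a => by
    rw [mul_assoc, ExteriorAlgebra.ι_sq_zero, mul_zero, map_zero]
  have hmem : ∀ a ∈ l, (l.map (ι ℂ)).prod * ι ℂ a = 0 := by
    clear h hsw hself hl
    intro a ha
    induction l with
    | nil => simp at ha
    | cons b l ih =>
      rw [List.map_cons, List.prod_cons, mul_assoc]
      rcases List.mem_cons.1 ha with rfl | ha
      · have : ∀ m : List (Fin n → ℂ), ι ℂ a * ((m.map (ι ℂ)).prod * ι ℂ a) = 0 := by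
          intro m
          induction m with
          | nil => simp
          | cons c m ihm =>
            rw [List.map_cons, List.prod_cons, mul_assoc, ← mul_assoc (ι ℂ a),
              eq_neg_of_add_eq_zero_left (ExteriorAlgebra.ι_add_mul_swap a c), neg_mul,
              mul_assoc, ihm, mul_zero, neg_zero]
        exact this l
      · rw [ih ha, mul_zero]
  have hspan := span_eq_top_of_volForm_ne_zero (l ++ [p, q]) (by simpa using hl)
    (by simpa [mul_assoc] using h)
  have hx : x ∈ Submodule.span ℂ {x | x ∈ l ++ [p, q]} := hspan ▸ trivial
  induction hx using Submodule.span_induction with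
  | mem x hx =>
    simp only [List.mem_append, List.mem_cons, List.not_mem_nil, or_false, Set.mem_ofPred_eq] at hx
    rcases hx with hx | rfl | rfl
    · rw [hsw p x, hmem x hx]; simp
    · rw [hself]; ring
    · rw [hself, hsw x y]; ring
  | zero => simp
  | add a b _ _ ha hb =>
    simp only [map_add, mul_add, add_mul] at ha hb ⊢
    linear_combination ha + hb
  | smul r a _ ha =>
    simp only [map_smul, mul_smul_comm, smul_mul_assoc, smul_eq_mul] at ha ⊢
    linear_combination r * ha

/-- The three-term Plücker relation. -/
lemma plucker (hl : l.length + 2 = n) (a b c d : Fin n → ℂ) :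
    volForm n ((l.map (ι ℂ)).prod * ι ℂ a * ι ℂ b) *
        volForm n ((l.map (ι ℂ)).prod * ι ℂ c * ι ℂ d) +
      volForm n ((l.map (ι ℂ)).prod * ι ℂ a * ι ℂ d) *
        volForm n ((l.map (ι ℂ)).prod * ι ℂ b * ι ℂ c) =
      volForm n ((l.map (ι ℂ)).prod * ι ℂ a * ι ℂ c) *
        volForm n ((l.map (ι ℂ)).prod * ι ℂ b * ι ℂ d) := by
  by_cases h : ∀ p q, volForm n ((l.map (ι ℂ)).prod * ι ℂ p * ι ℂ q) = 0
  · simp [h]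
  push Not at h
  obtain ⟨p, q, h⟩ := h
  have key := fun x y => volForm_mul_volForm l hl p q x y h
  apply mul_left_cancel₀ (mul_ne_zero h h)
  set φ := fun x y => volForm n ((l.map (ι ℂ)).prod * ι ℂ x * ι ℂ y)
  have h1 := key a b
  have h2 := key c d
  have h3 := key a d
  have h4 := key b c
  have h5 := key a c
  have h6 := key b d
  change φ p q * φ p q * (φ a b * φ c d + φ a d * φ b c) = φ p q * φ p q * (φ a c * φ b d)
  change φ p q * φ a b = φ a q * φ p b - φ b q * φ p a at h1
  change φ p q * φ c d = φ c q * φ p d - φ d q * φ p c at h2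
  change φ p q * φ a d = φ a q * φ p d - φ d q * φ p a at h3
  change φ p q * φ b c = φ b q * φ p c - φ c q * φ p b at h4
  change φ p q * φ a c = φ a q * φ p c - φ c q * φ p a at h5
  change φ p q * φ b d = φ b q * φ p d - φ d q * φ p b at h6
  have e1 : φ p q * φ p q * (φ a b * φ c d + φ a d * φ b c) =
      (φ p q * φ a b) * (φ p q * φ c d) + (φ p q * φ a d) * (φ p q * φ b c) := by ring
  have e2 : φ p q * φ p q * (φ a c * φ b d) = (φ p q * φ a c) * (φ p q * φ b d) := by ring
  rw [e1, e2, h1, h2, h3, h4, h5, h6]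
  ring

end Plucker

lemma neg_one_pow_mul_self (k : ℕ) : (-1 : ℂ) ^ k * (-1) ^ k = 1 := by
  rw [← mul_pow]; simp

/-- The Ptolemy relations. -/
lemma mixedVol_ptolemy (v : Fin 4 → ℕ → Fin n → ℂ) (s : Fin 4 → ℕ) (hs : ∑ i, s i + 2 = n) :
    mixedVol v (s + ![1, 1, 0, 0]) * mixedVol v (s + ![0, 0, 1, 1]) +
      mixedVol v (s + ![1, 0, 0, 1]) * mixedVol v (s + ![0, 1, 1, 0]) =
    mixedVol v (s + ![1, 0, 1, 0]) * mixedVol v (s + ![0, 1, 0, 1]) := by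
  set l : List (Fin n → ℂ) := (List.range (s 0)).map (v 0) ++ (List.range (s 1)).map (v 1) ++
    (List.range (s 2)).map (v 2) ++ (List.range (s 3)).map (v 3) with hl
  have hS : (l.map (ι ℂ)).prod =
      blade (v 0) (s 0) * blade (v 1) (s 1) * blade (v 2) (s 2) * blade (v 3) (s 3) := by
    simp only [hl, List.map_append, List.prod_append, blade_eq_map]
  have hlen : l.length + 2 = n := by
    rw [Fin.sum_univ_four] at hs
    simpa [hl, add_assoc] using hs
  have key := plucker l hlen (v 0 (s 0)) (v 1 (s 1)) (v 2 (s 2)) (v 3 (s 3))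
  rw [hS] at key
  simp only [mul_assoc] at key
  simp only [mixedVol, Pi.add_apply, cons_val, add_zero, blade_succ, mul_assoc, ι_mul_blade_mul,
    ι_mul_blade, mul_smul_comm, smul_mul_assoc, map_smul, smul_eq_mul]
  have h1 := neg_one_pow_mul_self (s 1)
  have h2 := neg_one_pow_mul_self (s 2)
  have h3 := neg_one_pow_mul_self (s 3)
  generalize (-1 : ℂ) ^ s 1 = x at *
  generalize (-1 : ℂ) ^ s 2 = y at *
  generalize (-1 : ℂ) ^ s 3 = z at *
  linear_combination (x * y * z * y * z * z) * key

lemma ptolemy_relation (g : Fin 4 → GL (Fin n) ℂ) (s : Fin 4 → ℕ) (hs : ∑ i, s i + 2 = n) :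
    ptolemy g (s + ![1, 1, 0, 0]) * ptolemy g (s + ![0, 0, 1, 1]) +
      ptolemy g (s + ![1, 0, 0, 1]) * ptolemy g (s + ![0, 1, 1, 0]) =
    ptolemy g (s + ![1, 0, 1, 0]) * ptolemy g (s + ![0, 1, 0, 1]) := by
  rw [Fin.sum_univ_four] at hs
  have key := mixedVol_ptolemy (fun i => cols (g i).1) s (by rw [Fin.sum_univ_four]; exact hs)
  iterate 6 rw [ptolemy_eq_mixedVol g _ (by simp [Fin.sum_univ_four]; omega)]
  exact key

/-- Exchanging two neighbouring flags changes the Ptolemy coordinates by signs. -/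
lemma ptolemy_comp_swap (g : Fin 4 → GL (Fin n) ℂ) (i : Fin 3) (t : Fin 4 → ℕ)
    (ht : ∑ i, t i = n) :
    ptolemy (g ∘ swap i.castSucc i.succ) (t ∘ swap i.castSucc i.succ) =
      (-1) ^ (t i.castSucc * t i.succ) * ptolemy g t := by
  rw [ptolemy_eq_mixedVol g t ht, ptolemy_eq_mixedVol _ _
    (by rw [← ht]; exact Equiv.sum_comp (swap i.castSucc i.succ) t)]
  unfold mixedVol
  simp only [Function.comp]
  fin_cases i
  · change volForm n (blade (cols (g (swap 0 1 0)).1) (t (swap 0 1 0)) *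
      blade (cols (g (swap 0 1 1)).1) (t (swap 0 1 1)) *
      blade (cols (g (swap 0 1 2)).1) (t (swap 0 1 2)) *
      blade (cols (g (swap 0 1 3)).1) (t (swap 0 1 3))) = (-1) ^ (t 0 * t 1) * _
    rw [show (swap 0 1 : Perm (Fin 4)) 0 = 1 by decide, show (swap 0 1 : Perm (Fin 4)) 1 = 0 by decide,
      show (swap 0 1 : Perm (Fin 4)) 2 = 2 by decide, show (swap 0 1 : Perm (Fin 4)) 3 = 3 by decide,
      blade_mul_blade (cols (g 1).1) (cols (g 0).1)]
    simp only [smul_mul_assoc, map_smul, smul_eq_mul, mul_comm]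
  · change volForm n (blade (cols (g (swap 1 2 0)).1) (t (swap 1 2 0)) *
      blade (cols (g (swap 1 2 1)).1) (t (swap 1 2 1)) *
      blade (cols (g (swap 1 2 2)).1) (t (swap 1 2 2)) *
      blade (cols (g (swap 1 2 3)).1) (t (swap 1 2 3))) = (-1) ^ (t 1 * t 2) * _
    rw [show (swap 1 2 : Perm (Fin 4)) 0 = 0 by decide, show (swap 1 2 : Perm (Fin 4)) 1 = 2 by decide,
      show (swap 1 2 : Perm (Fin 4)) 2 = 1 by decide, show (swap 1 2 : Perm (Fin 4)) 3 = 3 by decide,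
      mul_assoc (blade (cols (g 0).1) (t 0)), blade_mul_blade (cols (g 2).1) (cols (g 1).1)]
    simp only [smul_mul_assoc, mul_smul_comm, map_smul, smul_eq_mul, mul_comm (t 2), mul_assoc]
  · change volForm n (blade (cols (g (swap 2 3 0)).1) (t (swap 2 3 0)) *
      blade (cols (g (swap 2 3 1)).1) (t (swap 2 3 1)) *
      blade (cols (g (swap 2 3 2)).1) (t (swap 2 3 2)) *
      blade (cols (g (swap 2 3 3)).1) (t (swap 2 3 3))) = (-1) ^ (t 2 * t 3) * _
    rw [show (swap 2 3 : Perm (Fin 4)) 0 = 0 by decide, show (swap 2 3 : Perm (Fin 4)) 1 = 1 by decide,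
      show (swap 2 3 : Perm (Fin 4)) 2 = 3 by decide, show (swap 2 3 : Perm (Fin 4)) 3 = 2 by decide,
      mul_assoc (blade (cols (g 0).1) (t 0) * _), blade_mul_blade (cols (g 3).1) (cols (g 2).1)]
    simp only [mul_smul_comm, map_smul, smul_eq_mul, mul_comm (t 3), mul_assoc]

/-- Left multiplication scales all Ptolemy coordinates by the same factor. -/
lemma ptolemy_mul_left (A : GL (Fin n) ℂ) (g : Fin 4 → GL (Fin n) ℂ) (t : Fin 4 → ℕ) :
    ptolemy (fun i => A * g i) t = A.1.det * ptolemy g t := by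
  rw [ptolemy, ptolemy, ← det_mul]
  congr 1
  ext r k
  simp only [colUnion, of_apply, Matrix.mul_apply, Units.val_mul]
  split_ifs <;> rfl

/-- Right multiplication by an upper triangular matrix scales the initial blades. -/
lemma exists_blade_cols_mul_upper (A : Matrix (Fin n) (Fin n) ℂ) {b : GL (Fin n) ℂ}
    (hb : b ∈ upperGL n) : ∃ r : ℕ → ℂ, (∀ k, r k ≠ 0) ∧
      ∀ k ≤ n, blade (cols (A * b.1)) k = r k • blade (cols A) k := by
  have hb' : b.1.BlockTriangular id := hb
  have hdiag : ∀ j, b.1 j j ≠ 0 := fun j hj => by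
    have hdet : b.1.det ≠ 0 := (b.1.isUnit_iff_isUnit_det.1 b.isUnit).ne_zero
    exact hdet (by rw [det_of_isUpperTriangular hb']; exact Finset.prod_eq_zero (Finset.mem_univ j) hj)
  refine ⟨fun k => ∏ j ∈ Finset.range k, if h : j < n then b.1 ⟨j, h⟩ ⟨j, h⟩ else 1,
    fun k => Finset.prod_ne_zero_iff.2 fun j _ => ?_, fun k => ?_⟩
  · split_ifs with h
    exacts [hdiag _, one_ne_zero]
  induction k with
  | zero => simp
  | succ k ih =>
    intro hk
    have hc : cols (A * b.1) k = ∑ j : Fin n, b.1 j ⟨k, hk⟩ • cols A j := by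
      ext r
      simp [cols, show k < n from hk, Matrix.mul_apply, mul_comm]
    have h0 : ∀ j : Fin n, j ≠ ⟨k, hk⟩ →
        blade (cols A) k * ι ℂ (b.1 j ⟨k, hk⟩ • cols A j) = 0 := fun j hj => by
      rcases lt_or_gt_of_ne hj with h | h
      · rw [map_smul, mul_smul_comm, blade_mul_ι_of_lt _ (show (j : ℕ) < k from h), smul_zero]
      · rw [hb' h, zero_smul, map_zero, mul_zero]
    rw [blade_succ, ih (by omega), hc, map_sum, Finset.mul_sum,
      Finset.sum_eq_single ⟨k, hk⟩ (fun j _ hj => by rw [smul_mul_assoc, h0 j hj, smul_zero])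
        (by simp), blade_succ]
    change (∏ j ∈ Finset.range k, if h : j < n then b.1 ⟨j, h⟩ ⟨j, h⟩ else 1) • _ * _ =
      (∏ j ∈ Finset.range (k + 1), if h : j < n then b.1 ⟨j, h⟩ ⟨j, h⟩ else 1) • _
    rw [Finset.prod_range_succ, dif_pos (show k < n from hk)]
    simp [smul_smul, mul_comm]

end Blades

/-! ### Flags and their normal forms -/

section Flags

variable {n : ℕ}

open ExteriorAlgebra (ι)

lemma mem_upperGL {g : GL (Fin n) ℂ} : g ∈ upperGL n ↔ ∀ i j, j < i → g.1 i j = 0 :=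
  ⟨fun h _ _ hij => h hij, fun h _ _ hij => h _ _ hij⟩

lemma scalar_mem_upperGL (u : ℂˣ) : (GeneralLinearGroup.scalar (Fin n) u) ∈ upperGL n := by
  rw [mem_upperGL]
  intro i j hij
  simp [GeneralLinearGroup.coe_scalar, Matrix.scalar_apply, hij.ne']

lemma mk_mem_B {g : GL (Fin n) ℂ} : (ProjGenLinGroup.mk g : PGL(n, ℂ)) ∈ B n ↔ g ∈ upperGL n := by
  constructor
  · rintro ⟨b, hb, h⟩
    obtain ⟨u, rfl⟩ := ProjGenLinGroup.mk_eq_mk_iff.1 h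
    exact mul_mem hb (scalar_mem_upperGL u)
  · exact fun h => ⟨g, h, rfl⟩

lemma flag_eq_iff {g g' : GL (Fin n) ℂ} : flag g = flag g' ↔ g⁻¹ * g' ∈ upperGL n := by
  rw [← mk_mem_B, map_mul, map_inv]
  exact QuotientGroup.eq

@[simp] lemma mk_smul_flag (A g : GL (Fin n) ℂ) :
    (ProjGenLinGroup.mk A : PGL(n, ℂ)) • flag g = flag (A * g) := by
  unfold flag
  rw [map_mul]
  rfl

lemma flag_mul_of_mem (g : GL (Fin n) ℂ) {b : GL (Fin n) ℂ} (hb : b ∈ upperGL n) :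
    flag (g * b) = flag g := by
  rw [eq_comm, flag_eq_iff]
  simpa using hb

lemma exists_flag_eq (x : PGL(n, ℂ) ⧸ B n) : ∃ g, flag g = x := by
  obtain ⟨p, rfl⟩ := QuotientGroup.mk_surjective x
  obtain ⟨g, rfl⟩ := ProjGenLinGroup.mk_surjective p
  exact ⟨g, rfl⟩

lemma simplexDecoration_of_eq_iff {G : Type*} [Group G] {K : Subgroup G} {F F' : Fin 4 → G ⧸ K} :
    SimplexDecoration.of F = SimplexDecoration.of F' ↔ ∃ p : G, ∀ i, F' i = p • F i := by
  rw [SimplexDecoration.of, SimplexDecoration.of, eq_comm, Quotient.eq, MulAction.orbitRel_apply]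
  constructor
  · rintro ⟨p, h⟩
    exact ⟨p, fun i => (congrFun h i).symm⟩
  · rintro ⟨p, h⟩
    exact ⟨p, (funext h).symm⟩

lemma decoOf_eq_iff {g g' : Fin 4 → GL (Fin n) ℂ} :
    decoOf g = decoOf g' ↔ ∃ A : GL (Fin n) ℂ, ∀ i, flag (g' i) = flag (A * g i) := by
  rw [decoOf, decoOf, simplexDecoration_of_eq_iff]
  constructor
  · rintro ⟨p, h⟩
    obtain ⟨A, rfl⟩ := ProjGenLinGroup.mk_surjective p
    exact ⟨A, fun i => by rw [h, mk_smul_flag]⟩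
  · rintro ⟨A, h⟩
    exact ⟨ProjGenLinGroup.mk A, fun i => by rw [h, mk_smul_flag]⟩

lemma exists_forall_flag_eq (F : Fin 4 → PGL(n, ℂ) ⧸ B n) :
    ∃ g : Fin 4 → GL (Fin n) ℂ, (fun i => flag (g i)) = F := by
  choose g hg using fun i => exists_flag_eq (F i)
  exact ⟨g, funext hg⟩

lemma exists_decoOf_eq (D : Deco n) : ∃ g, decoOf g = D := by
  induction D using Quotient.inductionOn with
  | h F =>
    obtain ⟨g, rfl⟩ := exists_forall_flag_eq F
    exact ⟨g, rfl⟩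

/-- The Ptolemy coordinates of two representatives of a decoration differ by a factor of the form
`K * f₀(t₀) f₁(t₁) f₂(t₂) f₃(t₃)`, which cancels in all shapes and triple ratios. -/
lemma exists_ptolemy_eq_mul {g g' : Fin 4 → GL (Fin n) ℂ} {A : GL (Fin n) ℂ}
    (h : ∀ i, flag (g' i) = flag (A * g i)) :
    ∃ (K : ℂ) (f : Fin 4 → ℕ → ℂ), K ≠ 0 ∧ (∀ i k, f i k ≠ 0) ∧ ∀ t : Fin 4 → ℕ, ∑ i, t i = n →
      ptolemy g' t = K * (f 0 (t 0) * f 1 (t 1) * f 2 (t 2) * f 3 (t 3)) * ptolemy g t := by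
  have hb : ∀ i, (A * g i)⁻¹ * g' i ∈ upperGL n := fun i => flag_eq_iff.1 (h i).symm
  choose f hf0 hf using fun i => exists_blade_cols_mul_upper (A * g i).1 (hb i)
  refine ⟨A.1.det, f, (A.1.isUnit_iff_isUnit_det.1 A.isUnit).ne_zero, hf0, fun t ht => ?_⟩
  rw [mul_assoc, mul_left_comm, ← ptolemy_mul_left, ptolemy_eq_mixedVol _ t ht,
    ptolemy_eq_mixedVol _ t ht, mixedVol, mixedVol]
  rw [Fin.sum_univ_four] at ht
  have hf' : ∀ i, ∀ k ≤ n, blade (cols (g' i).1) k = f i k • blade (cols (A * g i).1) k :=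
    fun i k hk => by
      rw [← hf i k hk]
      congr 2
      rw [← Units.val_mul, mul_inv_cancel_left]
  rw [hf' 0 _ (by omega), hf' 1 _ (by omega), hf' 2 _ (by omega), hf' 3 _ (by omega)]
  simp only [smul_mul_assoc, mul_smul_comm, map_smul, smul_eq_mul]
  ring

lemma isGeneric_decoOf {g : Fin 4 → GL (Fin n) ℂ} :
    IsGeneric (decoOf g) ↔ ∀ t : Pt n, ptolemy g t.1 ≠ 0 := by
  refine ⟨fun h => h g rfl, fun h g' hg' t => ?_⟩
  obtain ⟨A, hA⟩ := decoOf_eq_iff.1 hg'.symm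
  obtain ⟨K, f, hK, hf, e⟩ := exists_ptolemy_eq_mul hA
  rw [e t.1 t.2]
  exact mul_ne_zero (mul_ne_zero hK (by simp [hf])) (h t)

/-- The last flag does not enter the Ptolemy coordinates of the opposite face. -/
lemma ptolemy_congr_of_eq_zero {g g' : Fin 4 → GL (Fin n) ℂ} (h : ∀ i, i ≠ 3 → g i = g' i)
    {t : Fin 4 → ℕ} (ht : ∑ i, t i = n) (h3 : t 3 = 0) : ptolemy g t = ptolemy g' t := by
  rw [ptolemy_eq_mixedVol _ t ht, ptolemy_eq_mixedVol _ t ht, mixedVol, mixedVol, h3,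
    h 0 (by decide), h 1 (by decide), h 2 (by decide)]
  simp

lemma inv_mulVec_cols (g : GL (Fin n) ℂ) (j : ℕ) :
    g⁻¹.1 *ᵥ cols g.1 j = cols 1 j := by
  have : g⁻¹.1 * g.1 = 1 := by rw [← Units.val_mul]; simp
  ext r
  by_cases h : j < n
  · have e := congrFun (congrFun this r) ⟨j, h⟩
    rw [Matrix.mul_apply] at e
    simpa [cols, h, mulVec, dotProduct] using e
  · simp [cols, h, mulVec, dotProduct]

lemma cols_one_apply (j : ℕ) (r : Fin n) : cols (1 : Matrix (Fin n) (Fin n) ℂ) j r =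
    if (r : ℕ) = j then 1 else 0 := by
  unfold cols
  split_ifs with h h' h'
  · simp [Matrix.one_apply, Fin.ext_iff, h']
  · simp [Fin.ext_iff, h']
  · omega
  · rfl

/-- If the flags of `g` and of the sequence `u` are in general position, then the flag of `g` is
represented by a matrix whose `k`-th column lies in the span of the first `n - k` vectors of `u`. -/
lemma exists_flag_eq_mem_span (g : GL (Fin n) ℂ) (u : ℕ → Fin n → ℂ)
    (h : ∀ k < n, volForm n (blade u (n - k) * blade (cols g.1) k) ≠ 0) :
    ∃ b ∈ upperGL n, ∀ k : Fin n,
      cols (g * b).1 k ∈ Submodule.span ℂ (u '' Set.Iio (n - k)) := by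
  have hx : ∀ k : Fin n, ∃ p ∈ Submodule.span ℂ (u '' Set.Iio (n - k)),
      ∃ q ∈ Submodule.span ℂ (cols g.1 '' Set.Iio (k : ℕ)), p + q = cols g.1 k := fun k =>
    Submodule.mem_sup.1 (mem_span_sup_span u (cols g.1) (by omega) (h k k.2) _)
  choose p hp q hq hpq using hx
  have hq' : ∀ k r : Fin n, k ≤ r → (g⁻¹.1 *ᵥ q k) r = 0 := by
    intro k r hkr
    have hqk := hq k
    generalize q k = y at hqk
    induction hqk using Submodule.span_induction with
    | mem x hx =>
      obtain ⟨j, hj, rfl⟩ := hx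
      have hj' : j < k := hj
      rw [inv_mulVec_cols, cols_one_apply, if_neg (by have := Fin.le_def.1 hkr; omega)]
    | zero => simp
    | add x y _ _ hx hy => rw [mulVec_add, Pi.add_apply, hx, hy, add_zero]
    | smul c x _ hx => rw [mulVec_smul, Pi.smul_apply, hx, smul_zero]
  set X : Matrix (Fin n) (Fin n) ℂ := Matrix.of fun r k => p k r
  have hcol : ∀ k r : Fin n, (g⁻¹.1 * X) r k = (g⁻¹.1 *ᵥ p k) r := fun k r => by
    simp [X, Matrix.mul_apply, mulVec, dotProduct]
  have hp' : ∀ k r : Fin n, (g⁻¹.1 *ᵥ p k) r = (if r = k then 1 else 0) - (g⁻¹.1 *ᵥ q k) r := by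
    intro k r
    rw [show p k = cols g.1 k - q k from eq_sub_of_add_eq (hpq k), mulVec_sub, Pi.sub_apply,
      inv_mulVec_cols, cols_one_apply]
    simp [Fin.ext_iff]
  have htri : (g⁻¹.1 * X).BlockTriangular id := fun i j hij => by
    have hij' : j < i := hij
    rw [hcol, hp', hq' _ _ hij'.le, if_neg hij'.ne', sub_zero]
  have hdet : (g⁻¹.1 * X).det = 1 := by
    rw [det_of_isUpperTriangular htri]
    exact Finset.prod_eq_one fun k _ => by rw [hcol, hp', hq' _ _ le_rfl]; simp
  refine ⟨GeneralLinearGroup.mkOfDetNeZero (g⁻¹.1 * X) (by rw [hdet]; exact one_ne_zero), htri,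
    fun k => ?_⟩
  have e : (g * GeneralLinearGroup.mkOfDetNeZero (g⁻¹.1 * X)
      (by rw [hdet]; exact one_ne_zero)).1 = X := by
    change g.1 * (g⁻¹.1 * X) = X
    rw [← Matrix.mul_assoc, ← Units.val_mul]
    simp
  rw [e]
  convert hp k using 1
  ext r
  simp [X]

/-- The invertible diagonal matrix with given entries. -/
def diagUnits (d : Fin n → ℂˣ) : GL (Fin n) ℂ where
  val := diagonal fun i => (d i : ℂ)
  inv := diagonal fun i => ((d i)⁻¹ : ℂˣ)
  val_inv := by simp [diagonal_mul_diagonal]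
  inv_val := by simp [diagonal_mul_diagonal]

@[simp] lemma diagUnits_val (d : Fin n → ℂˣ) :
    (diagUnits d).1 = diagonal fun i => (d i : ℂ) := rfl

lemma diagUnits_mul (d e : Fin n → ℂˣ) : diagUnits (d * e) = diagUnits d * diagUnits e := by
  ext i j
  by_cases h : i = j
  · subst h; simp
  · simp [h]

lemma diagUnits_one : diagUnits (1 : Fin n → ℂˣ) = 1 := by
  ext i j
  simp

lemma diagUnits_mem_upperGL (d : Fin n → ℂˣ) : diagUnits d ∈ upperGL n := by
  rw [mem_upperGL]
  intro i j hij
  simp [hij.ne']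

lemma diagUnits_mem_diagGL (d : Fin n → ℂˣ) : diagUnits d ∈ diagGL n := by
  rw [mem_diagGL]
  intro i j hij
  simp [hij]

lemma exists_diagUnits_eq {g : GL (Fin n) ℂ} (hg : g ∈ diagGL n) : ∃ d, g = diagUnits d := by
  have h := (mem_diagGL g).1 hg
  have hd : ∀ i, g.1 i i ≠ 0 := fun i hi => by
    have hdet : g.1.det ≠ 0 := (g.1.isUnit_iff_isUnit_det.1 g.isUnit).ne_zero
    refine hdet ?_
    rw [det_of_isUpperTriangular hg.1]
    exact Finset.prod_eq_zero (Finset.mem_univ i) hi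
  refine ⟨fun i => Units.mk0 _ (hd i), ?_⟩
  ext i j
  by_cases hij : i = j
  · subst hij; simp
  · simp [hij, h i j hij]

lemma q₁_val_apply (i j : Fin n) : (q₁ n).1 i j = if j = i.rev then 1 else 0 := rfl

lemma q₁_mul_q₁ : q₁ n * q₁ n = 1 := by
  rw [show q₁ n * q₁ n = q₁ n * (q₁ n)⁻¹ from rfl, mul_inv_cancel]

lemma mul_q₁_val_apply (A : GL (Fin n) ℂ) (i j : Fin n) : (A * q₁ n).1 i j = A.1 i j.rev := by
  simp only [Units.val_mul, Matrix.mul_apply, q₁_val_apply]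
  rw [Finset.sum_eq_single j.rev]
  · simp
  · intro k _ hk
    rw [if_neg, mul_zero]
    rintro rfl
    simp at hk
  · simp

lemma q₁_mul_val_apply (A : GL (Fin n) ℂ) (i j : Fin n) : (q₁ n * A).1 i j = A.1 i.rev j := by
  simp only [Units.val_mul, Matrix.mul_apply, q₁_val_apply]
  rw [Finset.sum_eq_single i.rev]
  · simp
  · intro k _ hk
    rw [if_neg hk, zero_mul]
  · simp

lemma q₁_mul_diagUnits (d : Fin n → ℂˣ) :
    q₁ n * diagUnits (fun i => d i.rev) = diagUnits d * q₁ n := by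
  ext i j
  rw [q₁_mul_val_apply, mul_q₁_val_apply]
  by_cases hij : i.rev = j
  · subst hij; simp
  · have : i ≠ j.rev := fun h => hij (by rw [h, Fin.rev_rev])
    simp [hij, this]

lemma cols_mul_q₁ (A : GL (Fin n) ℂ) (j : Fin n) : cols (A * q₁ n).1 j = cols A.1 j.rev := by
  ext r
  rw [cols_val, cols_val, mul_q₁_val_apply]

lemma cols_one (j : Fin n) : cols (1 : Matrix (Fin n) (Fin n) ℂ) j = Pi.single j 1 := by
  ext r
  simp [Matrix.one_apply, Pi.single_apply]

lemma cols_q₁ (j : Fin n) : cols (q₁ n).1 j = Pi.single j.rev 1 := by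
  rw [← one_mul (q₁ n), cols_mul_q₁, Units.val_one, cols_one]

/-- The form `x ↦ vol(e₀ ∧ ⋯ ∧ e_{a-1} ∧ e_{n-1} ∧ ⋯ ∧ e_{n-b} ∧ W ∧ x)` only depends on the
coordinates `a, …, n-b-1` of `x`. -/
lemma volForm_std_eq_zero (a b : ℕ) (v : ℕ → Fin n → ℂ) (k : ℕ) (x : Fin n → ℂ)
    (hx : ∀ r : Fin n, a ≤ r → (r : ℕ) + b < n → x r = 0) :
    volForm n (blade (cols 1) a * blade (cols (q₁ n).1) b * blade v k * ι ℂ x) = 0 := by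
  rw [show x = ∑ r, x r • Pi.single r (1 : ℂ) by
    ext i; simp [Finset.sum_apply, Pi.single_apply], map_sum, Finset.mul_sum, map_sum]
  refine Finset.sum_eq_zero fun r _ => ?_
  by_cases h1 : (r : ℕ) < a
  · have := blade_mul_ι_of_lt (cols (1 : Matrix (Fin n) (Fin n) ℂ)) h1
    rw [cols_one] at this
    have e : ∀ (y : Fin n → ℂ) (W : ExteriorAlgebra ℂ (Fin n → ℂ)) (u : ℕ → Fin n → ℂ) (m : ℕ),
        W * blade u m * ι ℂ y = (-1 : ℂ) ^ m • (W * ι ℂ y * blade u m) := fun y W u m => by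
      rw [mul_assoc W (ι ℂ y), ι_mul_blade, mul_smul_comm, smul_smul, neg_one_pow_mul_self,
        one_smul, mul_assoc]
    rw [map_smul, mul_smul_comm, e, e, this]
    simp
  by_cases h2 : (r : ℕ) + b < n
  · rw [hx r (by omega) h2]; simp
  · have := blade_mul_ι_of_lt (cols (q₁ n).1) (j := r.rev) (k := b) (by simp [Fin.val_rev]; omega)
    rw [cols_q₁, Fin.rev_rev] at this
    have e : ∀ (y : Fin n → ℂ) (W : ExteriorAlgebra ℂ (Fin n → ℂ)) (u : ℕ → Fin n → ℂ) (m : ℕ),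
        W * blade u m * ι ℂ y = (-1 : ℂ) ^ m • (W * ι ℂ y * blade u m) := fun y W u m => by
      rw [mul_assoc W (ι ℂ y), ι_mul_blade, mul_smul_comm, smul_smul, neg_one_pow_mul_self,
        one_smul, mul_assoc]
    rw [map_smul, mul_smul_comm, e, mul_assoc (blade (cols 1) a), this]
    simp

lemma volForm_std_eq_mul (a : Fin n) (b : ℕ) (hab : a + b + 1 = n) (x : Fin n → ℂ) :
    volForm n (blade (cols 1) a * blade (cols (q₁ n).1) b * ι ℂ x) =
      x a * volForm n (blade (cols 1) a * blade (cols (q₁ n).1) b * ι ℂ (Pi.single a 1)) := by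
  have := volForm_std_eq_zero a b 0 0 (x - x a • Pi.single a 1) fun r h1 h2 => by
    rw [show r = a from Fin.ext (by omega)]; simp
  rw [blade_zero, mul_one, map_sub, mul_sub, map_sub, sub_eq_zero] at this
  rw [this]
  simp

/-- The triple of flags `f₀, f₁, f₂` is represented by `τ (1, q₁, m)` with `m` normalized. -/
def IsNormalization (f₀ f₁ f₂ : PGL(n, ℂ) ⧸ B n) (τ : PGL(n, ℂ)) (m : GL (Fin n) ℂ) : Prop :=
  IsNormalizedLower m ∧ f₀ = τ • flag 1 ∧ f₁ = τ • flag (q₁ n) ∧ f₂ = τ • flag m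

lemma IsNormalization.smul {f₀ f₁ f₂ : PGL(n, ℂ) ⧸ B n} {τ : PGL(n, ℂ)} {m : GL (Fin n) ℂ}
    (h : IsNormalization f₀ f₁ f₂ τ m) (p : PGL(n, ℂ)) :
    IsNormalization (p • f₀) (p • f₁) (p • f₂) (p * τ) m :=
  ⟨h.1, by rw [h.2.1, mul_smul], by rw [h.2.2.1, mul_smul], by rw [h.2.2.2, mul_smul]⟩

lemma mem_upperGL_of_flag_eq {A : GL (Fin n) ℂ} (h : flag 1 = flag A) : A ∈ upperGL n := by
  simpa using flag_eq_iff.1 h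

/-- The stabilizer of the pair of opposite flags `B`, `q₁B` consists of the diagonal matrices. -/
lemma mem_diagGL_of_flag_eq {A : GL (Fin n) ℂ} (h : flag 1 = flag A)
    (h' : flag (q₁ n) = flag (A * q₁ n)) : A ∈ diagGL n := by
  have h1 := mem_upperGL.1 (mem_upperGL_of_flag_eq h)
  have h2 := mem_upperGL.1 (flag_eq_iff.1 h')
  rw [mem_diagGL]
  intro i j hij
  rcases lt_or_gt_of_ne hij with hlt | hlt
  · have := h2 i.rev j.rev (Fin.rev_lt_rev.2 hlt)
    rw [show (q₁ n)⁻¹ = q₁ n from rfl, q₁_mul_val_apply, mul_q₁_val_apply] at this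
    simpa using this
  · exact h1 i j hlt

/-- Normal forms are unique: a diagonal matrix transforming one normalized `m` into another, up to
`B`, is scalar, as one sees in the first column. -/
lemma IsNormalization.unique (hn : 0 < n) {f₀ f₁ f₂ : PGL(n, ℂ) ⧸ B n} {τ τ' : PGL(n, ℂ)}
    {m m' : GL (Fin n) ℂ} (h : IsNormalization f₀ f₁ f₂ τ m)
    (h' : IsNormalization f₀ f₁ f₂ τ' m') : τ = τ' := by
  obtain ⟨A, rfl⟩ := ProjGenLinGroup.mk_surjective τ
  obtain ⟨A', rfl⟩ := ProjGenLinGroup.mk_surjective τ'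
  obtain ⟨hm, h0, h1, h2⟩ := h
  obtain ⟨hm', h0', h1', h2'⟩ := h'
  subst h0 h1 h2
  simp only [mk_smul_flag, mul_one] at h0' h1' h2'
  set P := A⁻¹ * A' with hP
  have hA' : A' = A * P := by simp [hP]
  have e0 : flag 1 = flag P := by rw [flag_eq_iff] at h0' ⊢; simpa using h0'
  have e1 : flag (q₁ n) = flag (P * q₁ n) := by
    rw [flag_eq_iff] at h1' ⊢; simpa [hP, mul_assoc] using h1'
  have e2 : m⁻¹ * (P * m') ∈ upperGL n := by
    rw [flag_eq_iff] at h2'; simpa [hP, mul_assoc] using h2'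
  obtain ⟨d, hd⟩ := exists_diagUnits_eq (mem_diagGL_of_flag_eq e0 e1)
  -- the upper triangular matrix `b` with `P * m' = m * b` is also lower triangular
  set b := m⁻¹ * (P * m') with hb
  have hPb : P * m' = m * b := by simp [hb]
  have entry : ∀ i j, (d i : ℂ) * m'.1 i j = ∑ k, m.1 i k * b.1 k j := fun i j => by
    have : (P * m').1 i j = (m * b).1 i j := by rw [hPb]
    rw [hd, Units.val_mul, diagUnits_val, diagonal_mul, Units.val_mul, Matrix.mul_apply] at this
    exact this
  have hb0 : ∀ i, (d i : ℂ) = b.1 ⟨0, hn⟩ ⟨0, hn⟩ := fun i => by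
    have := entry i ⟨0, hn⟩
    rw [hm'.2.2 i ⟨0, hn⟩ rfl, Finset.sum_eq_single ⟨0, hn⟩, hm.2.2 i ⟨0, hn⟩ rfl] at this
    · simpa using this
    · intro k _ hk
      rw [mem_upperGL.1 e2 k ⟨0, hn⟩ (Nat.pos_of_ne_zero fun h => hk (Fin.ext h)), mul_zero]
    · simp
  rw [ProjGenLinGroup.mk_eq_mk_iff]
  refine ⟨d ⟨0, hn⟩, ?_⟩
  rw [hA', hd]
  congr 1
  ext i j
  by_cases hij : i = j
  · subst hij
    simp [GeneralLinearGroup.coe_scalar, Matrix.scalar_apply, hb0]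
  · simp [GeneralLinearGroup.coe_scalar, Matrix.scalar_apply, hij]

lemma ptolemy_eq_three (g : Fin 4 → GL (Fin n) ℂ) {a b c : ℕ} (h : a + b + c = n) :
    ptolemy g ![a, b, c, 0] =
      volForm n (blade (cols (g 0).1) a * blade (cols (g 1).1) b * blade (cols (g 2).1) c) := by
  rw [ptolemy_eq_mixedVol _ _ (by simpa [Fin.sum_univ_four] using h), mixedVol]
  simp

/-- Generic triples of flags have normal forms: the intersections of the first two flags give a basis
in which these two are the standard opposite flags and the third is lower triangular; rescaling the
basis makes the first column constant. -/
lemma exists_isNormalization (g : Fin 4 → GL (Fin n) ℂ)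
    (hg : ∀ a b c, a + b + c = n → ptolemy g ![a, b, c, 0] ≠ 0) :
    ∃ τ m, IsNormalization (flag (g 0)) (flag (g 1)) (flag (g 2)) τ m := by
  -- the columns of `g₁` are a basis adapted to the first two flags
  obtain ⟨b₁, hb₁, h₁⟩ := exists_flag_eq_mem_span (g 1) (cols (g 0).1) fun k hk => by
    have := hg (n - k) k 0 (by omega)
    rwa [ptolemy_eq_three _ (by omega), blade_zero, mul_one] at this
  set g₁ := g 1 * b₁ with hg₁
  obtain ⟨r, hr0, hr⟩ := exists_blade_cols_mul_upper (g 1).1 hb₁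
  obtain ⟨b₂, hb₂, h₂⟩ := exists_flag_eq_mem_span (g 2) (cols g₁.1) fun k hk => by
    have := hg 0 (n - k) k (by omega)
    rw [ptolemy_eq_three _ (by omega), blade_zero, one_mul] at this
    rw [hg₁, Units.val_mul, hr _ (by omega), smul_mul_assoc, map_smul]
    exact mul_ne_zero (hr0 _) this
  set A := g₁ * q₁ n with hA
  have hAq : A * q₁ n = g₁ := by rw [hA, mul_assoc, q₁_mul_q₁, mul_one]
  have hf₁ : flag (g 1) = flag (A * q₁ n) := by rw [hAq, hg₁, flag_mul_of_mem _ hb₁]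
  have hf₀ : flag (g 0) = flag A := by
    rw [flag_eq_iff, mem_upperGL]
    intro i j hij
    have hj := h₁ j.rev
    rw [← cols_mul_q₁ g₁ j, ← hA] at hj
    have e : ((g 0)⁻¹ * A).1 i j = ((g 0)⁻¹.1 *ᵥ cols A.1 j) i := by
      rw [Units.val_mul, Matrix.mul_apply]; simp [mulVec, dotProduct]
    rw [e]
    generalize cols A.1 j = y at hj
    induction hj using Submodule.span_induction with
    | mem x hx =>
      obtain ⟨k, hk, rfl⟩ := hx
      rw [Set.mem_Iio, Fin.val_rev] at hk
      rw [inv_mulVec_cols, cols_one_apply, if_neg (by have := Fin.lt_def.1 hij; omega)]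
    | zero => simp
    | add x y _ _ hx hy => rw [mulVec_add, Pi.add_apply, hx, hy, add_zero]
    | smul c x _ hx => rw [mulVec_smul, Pi.smul_apply, hx, smul_zero]
  set m₀ := A⁻¹ * (g 2 * b₂) with hm₀
  have hAm : A * m₀ = g 2 * b₂ := by simp [hm₀]
  have hf₂ : flag (g 2) = flag (A * m₀) := by rw [hAm, flag_mul_of_mem _ hb₂]
  have hlow : ∀ i j, i < j → m₀.1 i j = 0 := by
    intro i j hij
    have hj := h₂ j
    have e : m₀.1 i j = (A⁻¹.1 *ᵥ cols (g 2 * b₂).1 j) i := by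
      rw [hm₀, Units.val_mul, Matrix.mul_apply]; simp [mulVec, dotProduct]
    rw [e]
    generalize cols (g 2 * b₂).1 j = y at hj
    induction hj using Submodule.span_induction with
    | mem x hx =>
      obtain ⟨k, hk, rfl⟩ := hx
      rw [Set.mem_Iio] at hk
      obtain ⟨k, rfl⟩ : ∃ k' : Fin n, (k' : ℕ) = k := ⟨⟨k, by omega⟩, rfl⟩
      rw [← hAq, cols_mul_q₁, inv_mulVec_cols, cols_one_apply,
        if_neg (by have := Fin.lt_def.1 hij; rw [Fin.val_rev]; omega)]
    | zero => simp
    | add x y _ _ hx hy => rw [mulVec_add, Pi.add_apply, hx, hy, add_zero]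
    | smul c x _ hx => rw [mulVec_smul, Pi.smul_apply, hx, smul_zero]
  have hdiag : ∀ i, m₀.1 i i ≠ 0 := fun i hi => by
    have hdet : m₀.1.det ≠ 0 := (m₀.1.isUnit_iff_isUnit_det.1 m₀.isUnit).ne_zero
    refine hdet ?_
    rw [det_of_isLowerTriangular (M := m₀.1) fun i j hij => hlow _ _ hij]
    exact Finset.prod_eq_zero (Finset.mem_univ i) hi
  clear_value m₀ A
  rcases Nat.eq_zero_or_pos n with rfl | hn
  · exact ⟨ProjGenLinGroup.mk A, m₀, ⟨fun i => i.elim0, fun i => i.elim0, fun i => i.elim0⟩,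
      by simpa using hf₀, by simpa using hf₁, by simpa using hf₂⟩
  have hcol : ∀ i, m₀.1 i ⟨0, hn⟩ ≠ 0 := fun i hi => by
    let g' : Fin 4 → GL (Fin n) ℂ := ![1, q₁ n, m₀, A⁻¹ * g 3]
    have hgg' : ∀ i, flag (g i) = flag (A * g' i) := by
      intro i
      fin_cases i
      · simpa [g'] using hf₀
      · exact hf₁
      · exact hf₂
      · simp [g']
    obtain ⟨K, f, -, -, e⟩ := exists_ptolemy_eq_mul hgg'
    refine hg i (n - 1 - i) 1 (by omega) ?_
    rw [e _ (by simp [Fin.sum_univ_four]; omega), ptolemy_eq_three _ (by omega)]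
    have : blade (cols (g' 2).1) 1 = ι ℂ (cols m₀.1 0) := by simp [blade_succ, g']
    rw [this]
    change _ * volForm n (blade (cols 1) i * blade (cols (q₁ n).1) _ * _) = 0
    rw [volForm_std_eq_mul i _ (by omega)]
    have : cols m₀.1 0 i = 0 := by rw [← hi]; exact cols_val m₀.1 ⟨0, hn⟩ i
    rw [this, zero_mul, mul_zero]
  -- conjugation by a diagonal matrix makes the first column constant
  let d : Fin n → ℂˣ := fun i => Units.mk0 _ (hcol i)
  let d' : Fin n → ℂˣ := fun k => d k * (Units.mk0 _ (hdiag k))⁻¹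
  have hval : ∀ i j, (diagUnits d⁻¹ * m₀ * diagUnits d').1 i j =
      (m₀.1 i ⟨0, hn⟩)⁻¹ * m₀.1 i j * (m₀.1 j ⟨0, hn⟩ * (m₀.1 j j)⁻¹) := fun i j => by
    rw [Units.val_mul, Units.val_mul, diagUnits_val, diagUnits_val, mul_diagonal, diagonal_mul]
    simp [d, d']
  have hdd : diagUnits d * diagUnits d⁻¹ = 1 := by rw [← diagUnits_mul, mul_inv_cancel, diagUnits_one]
  refine ⟨ProjGenLinGroup.mk (A * diagUnits d), diagUnits d⁻¹ * m₀ * diagUnits d',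
    ⟨fun i j hij => ?_, fun i => ?_, fun i j hj => ?_⟩, ?_, ?_, ?_⟩
  · rw [hval, hlow _ _ hij]; ring
  · rw [hval]; field_simp [hcol i, hdiag i]
  · obtain rfl : j = ⟨0, hn⟩ := Fin.ext hj
    rw [hval]
    have := hcol ⟨0, hn⟩
    field_simp [hcol i]
  · rw [mk_smul_flag, mul_one, hf₀, flag_mul_of_mem _ (diagUnits_mem_upperGL _)]
  · rw [mk_smul_flag, hf₁, ← flag_mul_of_mem (A * q₁ n)
      (diagUnits_mem_upperGL fun i => d i.rev), mul_assoc A, q₁_mul_diagUnits, mul_assoc A]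
  · rw [mk_smul_flag, hf₂, ← flag_mul_of_mem (A * m₀) (diagUnits_mem_upperGL d')]
    refine congrArg flag ?_
    rw [mul_assoc A (diagUnits d), mul_assoc (diagUnits d⁻¹), ← mul_assoc (diagUnits d), hdd,
      one_mul, mul_assoc A]

end Flags

/-! ### Natural cocycles of a simplex -/

section Cocycles

/-- Permutations of the vertices are reached from the identity by adjacent transpositions. -/
lemma perm_induction {P : Perm (Fin 4) → Prop} (h1 : P 1)
    (hs : ∀ (w : Perm (Fin 4)) (i : Fin 3), P w → P (w * swap i.castSucc i.succ))
    (w : Perm (Fin 4)) : P w := by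
  have hw : w ∈ Submonoid.closure (Set.range fun i : Fin 3 => swap i.castSucc i.succ) := by
    rw [Perm.mclosure_swap_castSucc_succ]; trivial
  induction hw using Submonoid.closure_induction_right with
  | one => exact h1
  | mul_right x _ y hy ih =>
    obtain ⟨i, rfl⟩ := hy
    exact hs x i ih

variable {n : ℕ}

/-- All Ptolemy coordinates are non-zero. -/
def GenericTuple (g : Fin 4 → GL (Fin n) ℂ) : Prop := ∀ t : Fin 4 → ℕ, ∑ i, t i = n → ptolemy g t ≠ 0

lemma genericTuple_iff {g : Fin 4 → GL (Fin n) ℂ} : GenericTuple g ↔ IsGeneric (decoOf g) := by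
  rw [isGeneric_decoOf]
  exact ⟨fun h t => h t.1 t.2, fun h t ht => h ⟨t, ht⟩⟩

lemma GenericTuple.comp {g : Fin 4 → GL (Fin n) ℂ} (hg : GenericTuple g) (w : Perm (Fin 4)) :
    GenericTuple (g ∘ w) := by
  induction w using perm_induction with
  | h1 => exact hg
  | hs w i ih =>
    intro t ht
    have e := ptolemy_comp_swap (g ∘ w) i (t ∘ swap i.castSucc i.succ)
      (by rw [← ht]; exact Equiv.sum_comp _ t)
    rw [Function.comp_assoc, ← Perm.coe_mul, Function.comp_assoc, ← Perm.coe_mul,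
      Equiv.swap_mul_self, Perm.coe_one, Function.comp_id] at e
    rw [e]
    exact mul_ne_zero (by simp) (ih _ (by rw [← ht]; exact Equiv.sum_comp _ t))

lemma GenericTuple.exists_isNormalization {g : Fin 4 → GL (Fin n) ℂ} (hg : GenericTuple g)
    (w : Perm (Fin 4)) :
    ∃ τ m, IsNormalization (flag (g (w 0))) (flag (g (w 1))) (flag (g (w 2))) τ m :=
  GluingEq.exists_isNormalization (g ∘ w) fun a b c h =>
    hg.comp w _ (by simpa [Fin.sum_univ_four] using h)

lemma isNaturalCochain_iff {F : Fin 4 → PGL(n, ℂ) ⧸ B n} {τ : Perm (Fin 4) → PGL(n, ℂ)} :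
    IsNaturalCochain F τ ↔ ∀ w, ∃ m, IsNormalization (F (w 0)) (F (w 1)) (F (w 2)) (τ w) m :=
  Iff.rfl

lemma existsUnique_isNaturalCochain (hn : 0 < n) {F : Fin 4 → PGL(n, ℂ) ⧸ B n}
    (hF : IsGeneric (SimplexDecoration.of F)) : ∃! τ, IsNaturalCochain F τ := by
  obtain ⟨g, rfl⟩ := exists_forall_flag_eq F
  have hg : GenericTuple g := genericTuple_iff.2 hF
  choose τ m h using hg.exists_isNormalization
  refine ⟨τ, fun w => ⟨m w, h w⟩, fun τ' h' => funext fun w => ?_⟩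
  obtain ⟨m', hm'⟩ := h' w
  exact IsNormalization.unique hn hm' (h w)

lemma IsNaturalCochain.smul {F : Fin 4 → PGL(n, ℂ) ⧸ B n} {τ : Perm (Fin 4) → PGL(n, ℂ)}
    (h : IsNaturalCochain F τ) (p : PGL(n, ℂ)) :
    IsNaturalCochain (fun i => p • F i) (fun w => p * τ w) := fun w => by
  obtain ⟨m, hm⟩ := h w
  exact ⟨m, IsNormalization.smul hm p⟩

lemma smul_flag_one_eq_iff {p : PGL(n, ℂ)} : p • flag (1 : GL (Fin n) ℂ) = flag 1 ↔ p ∈ B n := by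
  obtain ⟨A, rfl⟩ := ProjGenLinGroup.mk_surjective p
  rw [mk_smul_flag, mk_mem_B, mul_one, eq_comm, flag_eq_iff, inv_one, one_mul]

lemma mem_H_of_smul_eq {p : PGL(n, ℂ)} (h : p • flag (1 : GL (Fin n) ℂ) = flag 1)
    (h' : p • flag (q₁ n) = flag (q₁ n)) : p ∈ H n := by
  obtain ⟨A, rfl⟩ := ProjGenLinGroup.mk_surjective p
  rw [mk_smul_flag] at h h'
  exact ⟨A, mem_diagGL_of_flag_eq (by rw [← h, mul_one]) h'.symm, rfl⟩

lemma Labeling.isCocycle_coboundary {G : Type*} [Group G] (τ : Perm (Fin 4) → G) :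
    (Labeling.coboundary τ).IsCocycle := by
  have h6 : (swap 0 1 * (swap 1 2 * (swap 0 1 * (swap 1 2 * (swap 0 1 * swap 1 2)))) :
    Perm (Fin 4)) = 1 := by decide
  have h6' : (swap 1 2 * (swap 2 3 * (swap 1 2 * (swap 2 3 * (swap 1 2 * swap 2 3)))) :
    Perm (Fin 4)) = 1 := by decide
  have h4 : (swap 0 1 * (swap 2 3 * (swap 0 1 * swap 2 3)) : Perm (Fin 4)) = 1 := by decide
  constructor <;> intro w <;> simp [Labeling.coboundary, mul_assoc, h6, h6', h4]

lemma IsNaturalCochain.isGHKCocycle {F : Fin 4 → PGL(n, ℂ) ⧸ B n} {τ : Perm (Fin 4) → PGL(n, ℂ)}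
    (h : IsNaturalCochain F τ) : (Labeling.coboundary τ).IsGHKCocycle (B n) (H n) where
  toIsCocycle := Labeling.isCocycle_coboundary τ
  middle_mem w := by
    obtain ⟨m, -, h0, -⟩ := h w
    obtain ⟨m', -, h0', -⟩ := h (w * swap 1 2)
    rw [← smul_flag_one_eq_iff]
    change ((τ w)⁻¹ * τ (w * swap 1 2)) • _ = _
    rw [mul_smul, ← h0', inv_smul_eq_iff, ← h0]
    rfl
  short_mem w := by
    obtain ⟨m, -, h0, h1, -⟩ := h w
    obtain ⟨m', -, h0', h1', -⟩ := h (w * swap 2 3)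
    refine mem_H_of_smul_eq ?_ ?_
    · change ((τ w)⁻¹ * τ (w * swap 2 3)) • _ = _
      rw [mul_smul, ← h0', inv_smul_eq_iff, ← h0]
      rfl
    · change ((τ w)⁻¹ * τ (w * swap 2 3)) • _ = _
      rw [mul_smul, ← h1', inv_smul_eq_iff, ← h1]
      rfl

lemma Labeling.coboundary_mul_left {G : Type*} [Group G] (p : G) (τ : Perm (Fin 4) → G) :
    Labeling.coboundary (fun w => p * τ w) = Labeling.coboundary τ := by
  simp [Labeling.coboundary, mul_assoc]

lemma IsNaturalCochain.isNaturalCocycleOf (hn : 0 < n) {F : Fin 4 → PGL(n, ℂ) ⧸ B n}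
    {τ : Perm (Fin 4) → PGL(n, ℂ)} (h : IsNaturalCochain F τ)
    (hF : IsGeneric (SimplexDecoration.of F)) :
    IsNaturalCocycleOf (SimplexDecoration.of F) (Labeling.coboundary τ) := by
  intro F' hF'
  have hu := existsUnique_isNaturalCochain hn (F := F') (by rwa [hF'])
  refine ⟨hu, fun τ' hτ' => ?_⟩
  obtain ⟨p, hp⟩ := simplexDecoration_of_eq_iff.1 hF'.symm
  rw [hu.unique hτ' ((funext hp : F' = _) ▸ h.smul p), Labeling.coboundary_mul_left]

lemma exists_of_eq (D : Deco n) : ∃ F, SimplexDecoration.of F = D := by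
  obtain ⟨g, rfl⟩ := exists_decoOf_eq D
  exact ⟨_, rfl⟩

lemma exists_isNaturalCocycleOf (hn : 0 < n) {D : Deco n} (hD : IsGeneric D) :
    ∃ c, IsNatural c ∧ IsNaturalCocycleOf D c := by
  obtain ⟨F, rfl⟩ := exists_of_eq D
  obtain ⟨τ, hτ, -⟩ := existsUnique_isNaturalCochain hn hD
  have h := hτ.isNaturalCocycleOf hn hD
  exact ⟨_, ⟨hτ.isGHKCocycle, _, hD, h⟩, h⟩

lemma IsNaturalCocycleOf.unique {D : Deco n} {c c' : Labeling PGL(n, ℂ)}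
    (h : IsNaturalCocycleOf D c) (h' : IsNaturalCocycleOf D c') : c = c' := by
  obtain ⟨F, hF⟩ := exists_of_eq D
  obtain ⟨⟨τ, hτ, -⟩, hc⟩ := h F hF
  rw [hc τ hτ, (h' F hF).2 τ hτ]

/-- The natural cocycle determines the decoration: the cochain can be recovered up to left
multiplication, since the doubly truncated simplex is connected. -/
lemma IsNaturalCocycleOf.injective {D D' : Deco n} {c : Labeling PGL(n, ℂ)}
    (h : IsNaturalCocycleOf D c) (h' : IsNaturalCocycleOf D' c) : D = D' := by
  obtain ⟨F, rfl⟩ := exists_of_eq D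
  obtain ⟨F', rfl⟩ := exists_of_eq D'
  obtain ⟨⟨τ, hτ, -⟩, hc⟩ := h F rfl
  obtain ⟨⟨τ', hτ', -⟩, hc'⟩ := h' F' rfl
  have e : Labeling.coboundary τ = Labeling.coboundary τ' := by rw [← hc τ hτ, ← hc' τ' hτ']
  have step : ∀ (w : Perm (Fin 4)) (i : Fin 3),
      (τ w)⁻¹ * τ (w * swap i.castSucc i.succ) = (τ' w)⁻¹ * τ' (w * swap i.castSucc i.succ) := by
    intro w i
    fin_cases i
    · exact congrFun (congrArg Labeling.long e) w
    · exact congrFun (congrArg Labeling.middle e) w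
    · exact congrFun (congrArg Labeling.short e) w
  have const : ∀ w, τ' w * (τ w)⁻¹ = τ' 1 * (τ 1)⁻¹ := by
    intro w
    induction w using perm_induction with
    | h1 => rfl
    | hs w i ih =>
      have := step w i
      rw [inv_mul_eq_iff_eq_mul] at this
      rw [← ih, this]
      group
  refine simplexDecoration_of_eq_iff.2 ⟨τ' 1 * (τ 1)⁻¹, fun i => ?_⟩
  obtain ⟨m, -, h0, -⟩ := hτ (swap 0 i)
  obtain ⟨m', -, h0', -⟩ := hτ' (swap 0 i)
  rw [swap_apply_left] at h0 h0'
  rw [h0, h0', ← const (swap 0 i), ← mul_smul]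
  simp

end Cocycles

/-! ### Shapes and Ptolemy coordinates -/

section Shapes

variable {n : ℕ}

lemma vec4_eta {α : Type*} (s : Fin 4 → α) : ![s 0, s 1, s 2, s 3] = s := by
  ext i; fin_cases i <;> rfl

/-- The coordinates of an integral point. -/
def Pt.coord {m : ℕ} (t : Pt m) : Fin 4 → ℕ := t.1

/-- The integral point with given coordinates. -/
def Pt.of {m : ℕ} (t : Fin 4 → ℕ) (h : ∑ i, t i = m) : Pt m := ⟨t, h⟩

@[simp] lemma Pt.coord_of {m : ℕ} (t : Fin 4 → ℕ) (h : ∑ i, t i = m) : (Pt.of t h).coord = t := rfl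

@[ext] lemma Pt.ext {m : ℕ} {t t' : Pt m} (h : t.coord = t'.coord) : t = t' := Subtype.ext h

lemma Pt.sum_coord {m : ℕ} (t : Pt m) : ∑ i, t.coord i = m := t.2

/-- The coordinates of an edge midpoint. -/
def Edge.coord (e : Edge) : Fin 4 → ℕ := e.1.1

lemma Edge.ext {e e' : Edge} (h : e.coord = e'.coord) : e = e' := Subtype.ext (Subtype.ext h)

lemma Edge.sum_coord (e : Edge) : ∑ i, e.coord i = 2 := e.1.2

lemma Edge.coord_le (e : Edge) (i : Fin 4) : e.coord i ≤ 1 := e.2 i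

@[simp] lemma coord_e1100 : e1100.coord = ![1, 1, 0, 0] := rfl
@[simp] lemma coord_e0011 : e0011.coord = ![0, 0, 1, 1] := rfl
@[simp] lemma coord_e0110 : e0110.coord = ![0, 1, 1, 0] := rfl
@[simp] lemma coord_e1001 : e1001.coord = ![1, 0, 0, 1] := rfl
@[simp] lemma coord_e1010 : e1010.coord = ![1, 0, 1, 0] := rfl
@[simp] lemma coord_e0101 : e0101.coord = ![0, 1, 0, 1] := rfl

instance : DecidableEq Edge := fun e e' =>
  decidable_of_iff (e.coord = e'.coord) ⟨Edge.ext, congrArg _⟩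

lemma edge_cases (e : Edge) : e = e1100 ∨ e = e0011 ∨ e = e0110 ∨ e = e1001 ∨ e = e1010 ∨
    e = e0101 := by
  have hf := e.sum_coord
  rw [Fin.sum_univ_four] at hf
  have h0 := e.coord_le 0
  have h1 := e.coord_le 1
  have h2 := e.coord_le 2
  have h3 := e.coord_le 3
  have key : ∀ (e' : Edge), e.coord 0 = e'.coord 0 → e.coord 1 = e'.coord 1 →
      e.coord 2 = e'.coord 2 → e.coord 3 = e'.coord 3 → e = e' := fun e' h0 h1 h2 h3 =>
    Edge.ext (funext fun i => by fin_cases i <;> assumption)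
  rcases Nat.le_one_iff_eq_zero_or_eq_one.1 h0 with h0 | h0 <;>
  rcases Nat.le_one_iff_eq_zero_or_eq_one.1 h1 with h1 | h1 <;>
  rcases Nat.le_one_iff_eq_zero_or_eq_one.1 h2 with h2 | h2 <;>
  rcases Nat.le_one_iff_eq_zero_or_eq_one.1 h3 with h3 | h3 <;>
  first
  | omega
  | exact Or.inl (key e1100 h0 h1 h2 h3)
  | exact Or.inr (Or.inl (key e0011 h0 h1 h2 h3))
  | exact Or.inr (Or.inr (Or.inl (key e0110 h0 h1 h2 h3)))
  | exact Or.inr (Or.inr (Or.inr (Or.inl (key e1001 h0 h1 h2 h3))))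
  | exact Or.inr (Or.inr (Or.inr (Or.inr (Or.inl (key e1010 h0 h1 h2 h3)))))
  | exact Or.inr (Or.inr (Or.inr (Or.inr (Or.inr (key e0101 h0 h1 h2 h3)))))

lemma prod_edge (f : Edge → ℂ) :
    ∏ e, f e = f e1100 * f e0011 * f e0110 * f e1001 * f e1010 * f e0101 := by
  have h : (Finset.univ : Finset Edge) = {e1100, e0011, e0110, e1001, e1010, e0101} := by
    ext e
    simpa using edge_cases e
  rw [h, Finset.prod_insert (by decide), Finset.prod_insert (by decide),
    Finset.prod_insert (by decide), Finset.prod_insert (by decide),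
    Finset.prod_insert (by decide), Finset.prod_singleton]
  ring

/-- The shape parameter `z_s^e` at `s = (a, b, k, l)`, extended to all `s` by the
value `1`, which does not contribute to products. -/
noncomputable def SimplexShape.val (z : SimplexShape n) (a b k l : ℕ) (e : Edge) : ℂ :=
  if h : ∑ i, ![a, b, k, l] i = n - 2 then z.toFun (Pt.of ![a, b, k, l] h) e else 1

lemma SimplexShape.val_of_eq (z : SimplexShape n) {a b k l : ℕ} (h : ∑ i, ![a, b, k, l] i = n - 2)
    (e : Edge) : z.val a b k l e = z.toFun (Pt.of ![a, b, k, l] h) e := dif_pos h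

lemma SimplexShape.val_apply (z : SimplexShape n) (s : Pt (n - 2)) (e : Edge) :
    z.val (s.coord 0) (s.coord 1) (s.coord 2) (s.coord 3) e = z.toFun s e := by
  rw [z.val_of_eq (by rw [vec4_eta]; exact s.2)]
  congr 1
  exact Pt.ext (vec4_eta s.coord)

lemma SimplexShape.val_ne_zero (z : SimplexShape n) (a b k l : ℕ) (e : Edge) :
    z.val a b k l e ≠ 0 := by
  unfold SimplexShape.val
  split_ifs
  exacts [z.ne_zero _ _, one_ne_zero]

/-- The product of the shape parameters around the integral point `(a, b, k, l)`, factor by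
factor. -/
noncomputable def SimplexShape.around (z : SimplexShape n) (a b k l : ℕ) : ℂ :=
  (if 1 ≤ a ∧ 1 ≤ b then z.val (a - 1) (b - 1) k l e1100 else 1) *
  (if 1 ≤ k ∧ 1 ≤ l then z.val a b (k - 1) (l - 1) e0011 else 1) *
  (if 1 ≤ b ∧ 1 ≤ k then z.val a (b - 1) (k - 1) l e0110 else 1) *
  (if 1 ≤ a ∧ 1 ≤ l then z.val (a - 1) b k (l - 1) e1001 else 1) *
  (if 1 ≤ a ∧ 1 ≤ k then z.val (a - 1) b (k - 1) l e1010 else 1) *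
  (if 1 ≤ b ∧ 1 ≤ l then z.val a (b - 1) k (l - 1) e0101 else 1)

open scoped Classical in
lemma SimplexShape.prodAt_eq_prod_edge (z : SimplexShape n) (t : Pt n) :
    z.prodAt t = ∏ e : Edge, if ∀ i, e.coord i ≤ t.coord i then
      z.val (t.coord 0 - e.coord 0) (t.coord 1 - e.coord 1) (t.coord 2 - e.coord 2)
        (t.coord 3 - e.coord 3) e else 1 := by
  have h0 : z.prodAt t = ∏ p : Pt (n - 2) × Edge with p.1.coord + p.2.coord = t.coord,
    z.toFun p.1 p.2 := rfl
  rw [h0, Finset.prod_filter, Fintype.prod_prod_type_right]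
  refine Finset.prod_congr rfl fun e _ => ?_
  split_ifs with h
  · have hs : ∑ i, (t.coord - e.coord) i = n - 2 := by
      have h1 := t.sum_coord
      have h2 := e.sum_coord
      rw [Fin.sum_univ_four] at *
      have := h 0; have := h 1; have := h 2; have := h 3
      simp only [Pi.sub_apply]
      omega
    rw [Finset.prod_eq_single (Pt.of (t.coord - e.coord) hs)]
    · rw [if_pos]
      · exact (z.val_apply (Pt.of (t.coord - e.coord) hs) e).symm
      · ext i
        exact Nat.sub_add_cancel (h i)
    · intro s _ hne
      rw [if_neg]
      intro hst
      refine hne (Pt.ext (funext fun i => ?_))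
      have := congrFun hst i
      simp only [Pi.add_apply] at this
      simp only [Pt.coord_of, Pi.sub_apply]
      omega
    · simp
  · refine Finset.prod_eq_one fun s _ => if_neg fun hst => h fun i => ?_
    have := congrFun hst i
    simp only [Pi.add_apply] at this
    omega

lemma SimplexShape.prodAt_eq_around (z : SimplexShape n) (t : Pt n) :
    z.prodAt t = z.around (t.coord 0) (t.coord 1) (t.coord 2) (t.coord 3) := by
  rw [z.prodAt_eq_prod_edge, prod_edge, SimplexShape.around]
  simp [Fin.forall_fin_succ]

lemma SimplexShape.around_interior (z : SimplexShape n) (a b k l : ℕ) :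
    z.around (a + 1) (b + 1) (k + 1) (l + 1) =
      z.val a b (k + 1) (l + 1) e1100 * z.val (a + 1) (b + 1) k l e0011 *
      z.val (a + 1) b k (l + 1) e0110 * z.val a (b + 1) (k + 1) l e1001 *
      z.val a (b + 1) k (l + 1) e1010 * z.val (a + 1) b (k + 1) l e0101 := by
  simp [SimplexShape.around]

lemma SimplexShape.around_face₃ (z : SimplexShape n) (a b k : ℕ) :
    z.around (a + 1) (b + 1) (k + 1) 0 =
      z.val a b (k + 1) 0 e1100 * z.val (a + 1) b k 0 e0110 * z.val a (b + 1) k 0 e1010 := by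
  simp [SimplexShape.around]

lemma SimplexShape.around_face₂ (z : SimplexShape n) (a b l : ℕ) :
    z.around (a + 1) (b + 1) 0 (l + 1) =
      z.val a b 0 (l + 1) e1100 * z.val a (b + 1) 0 l e1001 * z.val (a + 1) b 0 l e0101 := by
  simp [SimplexShape.around]

lemma SimplexShape.around_edge (z : SimplexShape n) (a b : ℕ) :
    z.around (a + 1) (b + 1) 0 0 = z.val a b 0 0 e1100 := by
  simp [SimplexShape.around]

/-- The value `z_s^{1100} = z_s^{0011}` of the monomial map. -/
noncomputable def shapeA (c : (Fin 4 → ℕ) → ℂ) (a b k l : ℕ) : ℂ :=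
  c ![a + 1, b, k, l + 1] * c ![a, b + 1, k + 1, l] /
    (c ![a + 1, b, k + 1, l] * c ![a, b + 1, k, l + 1])

/-- The value `z_s^{0110} = z_s^{1001}` of the monomial map. -/
noncomputable def shapeB (c : (Fin 4 → ℕ) → ℂ) (a b k l : ℕ) : ℂ :=
  c ![a, b + 1, k, l + 1] * c ![a + 1, b, k + 1, l] /
    (c ![a + 1, b + 1, k, l] * c ![a, b, k + 1, l + 1])

/-- The value `z_s^{1010} = z_s^{0101}` of the monomial map. -/
noncomputable def shapeC (c : (Fin 4 → ℕ) → ℂ) (a b k l : ℕ) : ℂ :=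
  -(c ![a + 1, b + 1, k, l] * c ![a, b, k + 1, l + 1] /
    (c ![a + 1, b, k, l + 1] * c ![a, b + 1, k + 1, l]))

lemma isMonomialShape_iff {c : (Fin 4 → ℕ) → ℂ} {z : SimplexShape n} :
    IsMonomialShape c z ↔ ∀ a b k l, a + b + k + l = n - 2 →
      (z.val a b k l e1100 = shapeA c a b k l ∧ z.val a b k l e0011 = shapeA c a b k l) ∧
      (z.val a b k l e0110 = shapeB c a b k l ∧ z.val a b k l e1001 = shapeB c a b k l) ∧
      (z.val a b k l e1010 = shapeC c a b k l ∧ z.val a b k l e0101 = shapeC c a b k l) := by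
  have hadd : ∀ a b k l a' b' k' l' : ℕ, (![a, b, k, l] + ![a', b', k', l'] : Fin 4 → ℕ) =
      ![a + a', b + b', k + k', l + l'] := fun _ _ _ _ _ _ _ _ => by simp
  constructor
  · intro h a b k l hs
    have hs' : ∑ i, ![a, b, k, l] i = n - 2 := by simpa [Fin.sum_univ_four] using hs
    obtain ⟨⟨h1, h2⟩, ⟨h3, h4⟩, h5, h6⟩ := h (Pt.of _ hs')
    change z.toFun _ _ = c (![a, b, k, l] + _) * c (![a, b, k, l] + _) /
      (c (![a, b, k, l] + _) * c (![a, b, k, l] + _)) at h1 h3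
    change z.toFun _ _ = -(c (![a, b, k, l] + _) * c (![a, b, k, l] + _) /
      (c (![a, b, k, l] + _) * c (![a, b, k, l] + _))) at h5
    simp only [hadd, add_zero] at h1 h3 h5
    simp only [z.val_of_eq hs', shapeA, shapeB, shapeC]
    exact ⟨⟨h1, h2.trans h1⟩, ⟨h3, h4.trans h3⟩, h5, h6.trans h5⟩
  · intro h s
    obtain ⟨⟨h1, h2⟩, ⟨h3, h4⟩, h5, h6⟩ := h (s.coord 0) (s.coord 1) (s.coord 2)
      (s.coord 3) (by rw [← Fin.sum_univ_four]; exact s.2)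
    simp only [z.val_apply, shapeA, shapeB, shapeC] at h1 h2 h3 h4 h5 h6
    rw [show s.1 = ![s.coord 0, s.coord 1, s.coord 2, s.coord 3] from (vec4_eta s.coord).symm]
    simp only [hadd, add_zero]
    exact ⟨⟨h1, h2.trans h1.symm⟩, ⟨h3, h4.trans h3.symm⟩, h5, h6.trans h5.symm⟩

lemma IsMonomialShape.unique {c : (Fin 4 → ℕ) → ℂ} {z z' : SimplexShape n}
    (h : IsMonomialShape c z) (h' : IsMonomialShape c z') : z = z' := by
  ext s e
  obtain ⟨⟨h1, h2⟩, ⟨h3, h4⟩, h5, h6⟩ := h s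
  obtain ⟨⟨h1', h2'⟩, ⟨h3', h4'⟩, h5', h6'⟩ := h' s
  rcases edge_cases e with rfl | rfl | rfl | rfl | rfl | rfl
  · rw [h1, h1']
  · rw [h2, h2', h1, h1']
  · rw [h3, h3']
  · rw [h4, h4', h3, h3']
  · rw [h5, h5']
  · rw [h6, h6', h5, h5']

lemma GenericTuple.ne_zero {g : Fin 4 → GL (Fin n) ℂ} (hg : GenericTuple g) {a b k l : ℕ}
    (h : a + b + k + l = n) : ptolemy g ![a, b, k, l] ≠ 0 :=
  hg _ (by simpa [Fin.sum_univ_four] using h)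

lemma ptolemy_relation' (g : Fin 4 → GL (Fin n) ℂ) {a b k l : ℕ} (h : a + b + k + l + 2 = n) :
    ptolemy g ![a + 1, b + 1, k, l] * ptolemy g ![a, b, k + 1, l + 1] +
      ptolemy g ![a + 1, b, k, l + 1] * ptolemy g ![a, b + 1, k + 1, l] =
    ptolemy g ![a + 1, b, k + 1, l] * ptolemy g ![a, b + 1, k, l + 1] := by
  simpa using ptolemy_relation g ![a, b, k, l] (by simpa [Fin.sum_univ_four] using h)

/-- Generic decorations have shapes: the shape parameter relations are the Ptolemy relations. -/
lemma GenericTuple.exists_isMonomialShape (hn : 2 ≤ n) {g : Fin 4 → GL (Fin n) ℂ}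
    (hg : GenericTuple g) : ∃ z : SimplexShape n, IsMonomialShape (ptolemy g) z := by
  set c := ptolemy g with hc
  have hrel : ∀ a b k l, a + b + k + l = n - 2 →
      (shapeA c a b k l ≠ 0 ∧ shapeA c a b k l ≠ 1) ∧
      (shapeB c a b k l ≠ 0 ∧ shapeB c a b k l ≠ 1) ∧
      (shapeC c a b k l ≠ 0 ∧ shapeC c a b k l ≠ 1) ∧
      shapeA c a b k l = 1 / (1 - shapeC c a b k l) ∧
      shapeB c a b k l = 1 / (1 - shapeA c a b k l) ∧
      shapeC c a b k l = 1 / (1 - shapeB c a b k l) := by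
    intro a b k l h
    have e := ptolemy_relation' g (show a + b + k + l + 2 = n by omega)
    have h1 := hg.ne_zero (show (a + 1) + (b + 1) + k + l = n by omega)
    have h2 := hg.ne_zero (show a + b + (k + 1) + (l + 1) = n by omega)
    have h3 := hg.ne_zero (show (a + 1) + b + k + (l + 1) = n by omega)
    have h4 := hg.ne_zero (show a + (b + 1) + (k + 1) + l = n by omega)
    have h5 := hg.ne_zero (show (a + 1) + b + (k + 1) + l = n by omega)
    have h6 := hg.ne_zero (show a + (b + 1) + k + (l + 1) = n by omega)
    rw [← hc] at e h1 h2 h3 h4 h5 h6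
    unfold shapeA shapeB shapeC
    generalize c ![a + 1, b + 1, k, l] = p at *
    generalize c ![a, b, k + 1, l + 1] = p' at *
    generalize c ![a + 1, b, k, l + 1] = q at *
    generalize c ![a, b + 1, k + 1, l] = q' at *
    generalize c ![a + 1, b, k + 1, l] = r at *
    generalize c ![a, b + 1, k, l + 1] = r' at *
    have hp : p * p' ≠ 0 := mul_ne_zero h1 h2
    have hq : q * q' ≠ 0 := mul_ne_zero h3 h4
    have hr : r * r' ≠ 0 := mul_ne_zero h5 h6
    rw [mul_comm r' r]
    generalize p * p' = P at *
    generalize q * q' = Q at *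
    generalize r * r' = R at *
    subst e
    have hP : (P + Q) - Q ≠ 0 := by simpa using hp
    have hQ : P - (P + Q) ≠ 0 := by simpa using hq
    refine ⟨⟨div_ne_zero hq hr, fun h => ?_⟩, ⟨div_ne_zero hr hp, fun h => ?_⟩,
      ⟨neg_ne_zero.2 (div_ne_zero hp hq), fun h => ?_⟩, ?_, ?_, ?_⟩
    · rw [div_eq_one_iff_eq hr] at h; exact hp (by linear_combination -h)
    · rw [div_eq_one_iff_eq hp] at h; exact hq (by linear_combination h)
    · rw [neg_eq_iff_eq_neg, div_eq_iff hq] at h; exact hr (by linear_combination h)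
    · rw [sub_neg_eq_add, one_add_div hq, one_div_div, add_comm Q]
    · rw [one_sub_div hr, one_div_div, add_sub_cancel_right]
    · rw [one_sub_div hp, one_div_div, sub_add_cancel_left, div_neg]
  have hs : ∀ s : Pt (n - 2), s.coord 0 + s.coord 1 + s.coord 2 + s.coord 3 = n - 2 := fun s => by
    rw [← Fin.sum_univ_four]; exact s.sum_coord
  let f : Pt (n - 2) → Edge → ℂ := fun s e =>
    if e.coord 0 = e.coord 1 then shapeA c (s.coord 0) (s.coord 1) (s.coord 2) (s.coord 3) else
    if e.coord 1 = e.coord 2 then shapeB c (s.coord 0) (s.coord 1) (s.coord 2) (s.coord 3) else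
    shapeC c (s.coord 0) (s.coord 1) (s.coord 2) (s.coord 3)
  refine ⟨⟨f, fun s e => ?_, fun s e => ?_, fun s => ?_, fun s => ?_, fun s => ?_⟩, ?_⟩
  · obtain ⟨h1, h2, h3, -⟩ := hrel _ _ _ _ (hs s)
    simp only [f]
    split_ifs
    exacts [h1.1, h2.1, h3.1]
  · obtain ⟨h1, h2, h3, -⟩ := hrel _ _ _ _ (hs s)
    simp only [f]
    split_ifs
    exacts [h1.2, h2.2, h3.2]
  · simpa [f] using (hrel _ _ _ _ (hs s)).2.2.2.1
  · simpa [f] using (hrel _ _ _ _ (hs s)).2.2.2.2.1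
  · simpa [f] using (hrel _ _ _ _ (hs s)).2.2.2.2.2
  · rw [isMonomialShape_iff]
    intro a b k l h
    have h' : ∑ i, ![a, b, k, l] i = n - 2 := by simpa [Fin.sum_univ_four] using h
    simp [SimplexShape.val_of_eq _ h', f]

end Shapes

/-! ### Products of shapes around integral points -/

section Products

variable {n : ℕ}

/-- The triple ratio of a function on the integral points of a triangle, at the interior point
`(a + 1, b + 1, k + 1)`. -/
noncomputable def tripleRatio (f : ℕ → ℕ → ℕ → ℂ) (a b k : ℕ) : ℂ :=
  -(f a (b + 1) (k + 2) * f (a + 2) b (k + 1) * f (a + 1) (b + 2) k) /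
    (f (a + 1) b (k + 2) * f (a + 2) (b + 1) k * f a (b + 2) (k + 1))

/-- The interior equations hold for monomial shapes. Only Ptolemy coordinates up to one level above
the given point are involved. -/
lemma shape_prod_interior {c : (Fin 4 → ℕ) → ℂ} {a b k l : ℕ}
    (h : ∀ a' b' k' l', a' + b' + k' + l' = a + b + k + l + 4 → k' + l' ≤ k + l + 3 →
      c ![a', b', k', l'] ≠ 0) :
    shapeA c a b (k + 1) (l + 1) * shapeA c (a + 1) (b + 1) k l * shapeB c (a + 1) b k (l + 1) *
      shapeB c a (b + 1) (k + 1) l * shapeC c a (b + 1) k (l + 1) *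
      shapeC c (a + 1) b (k + 1) l = 1 := by
  have h1 := h (a + 2) (b + 1) (k + 1) l (by omega) (by omega)
  have h2 := h (a + 2) (b + 1) k (l + 1) (by omega) (by omega)
  have h3 := h (a + 2) b (k + 1) (l + 1) (by omega) (by omega)
  have h4 := h (a + 1) (b + 2) (k + 1) l (by omega) (by omega)
  have h5 := h (a + 1) (b + 2) k (l + 1) (by omega) (by omega)
  have h6 := h a (b + 2) (k + 1) (l + 1) (by omega) (by omega)
  have h7 := h (a + 1) (b + 1) (k + 2) l (by omega) (by omega)
  have h8 := h (a + 1) b (k + 2) (l + 1) (by omega) (by omega)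
  have h9 := h a (b + 1) (k + 2) (l + 1) (by omega) (by omega)
  have h10 := h (a + 1) (b + 1) k (l + 2) (by omega) (by omega)
  have h11 := h (a + 1) b (k + 1) (l + 2) (by omega) (by omega)
  have h12 := h a (b + 1) (k + 1) (l + 2) (by omega) (by omega)
  simp only [shapeA, shapeB, shapeC, add_assoc, Nat.reduceAdd]
  field_simp

lemma shape_prod_face₃ {c : (Fin 4 → ℕ) → ℂ} {a b k : ℕ}
    (h : ∀ a' b' k' l', a' + b' + k' + l' = a + b + k + 3 → k' + l' ≤ k + 2 →
      c ![a', b', k', l'] ≠ 0) :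
    shapeA c a b (k + 1) 0 * shapeB c (a + 1) b k 0 * shapeC c a (b + 1) k 0 =
      tripleRatio (fun a b k => c ![a, b, k, 0]) a b k := by
  have h1 := h (a + 2) (b + 1) k 0 (by omega) (by omega)
  have h2 := h (a + 2) b (k + 1) 0 (by omega) (by omega)
  have h3 := h (a + 1) (b + 2) k 0 (by omega) (by omega)
  have h4 := h a (b + 2) (k + 1) 0 (by omega) (by omega)
  have h5 := h (a + 1) b (k + 2) 0 (by omega) (by omega)
  have h6 := h a (b + 1) (k + 2) 0 (by omega) (by omega)
  have h7 := h (a + 1) (b + 1) k 1 (by omega) (by omega)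
  have h8 := h (a + 1) b (k + 1) 1 (by omega) (by omega)
  have h9 := h a (b + 1) (k + 1) 1 (by omega) (by omega)
  simp only [shapeA, shapeB, shapeC, tripleRatio, add_assoc, Nat.reduceAdd, zero_add]
  field_simp

lemma shape_prod_face₂ {c : (Fin 4 → ℕ) → ℂ} {a b l : ℕ}
    (h : ∀ a' b' k' l', a' + b' + k' + l' = a + b + l + 3 → k' + l' ≤ l + 2 →
      c ![a', b', k', l'] ≠ 0) :
    shapeA c a b 0 (l + 1) * shapeB c a (b + 1) 0 l * shapeC c (a + 1) b 0 l =
      (tripleRatio (fun a b l => c ![a, b, 0, l]) a b l)⁻¹ := by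
  have h1 := h (a + 2) (b + 1) 0 l (by omega) (by omega)
  have h2 := h (a + 2) b 0 (l + 1) (by omega) (by omega)
  have h3 := h (a + 1) (b + 2) 0 l (by omega) (by omega)
  have h4 := h a (b + 2) 0 (l + 1) (by omega) (by omega)
  have h5 := h (a + 1) b 0 (l + 2) (by omega) (by omega)
  have h6 := h a (b + 1) 0 (l + 2) (by omega) (by omega)
  have h7 := h (a + 1) (b + 1) 1 l (by omega) (by omega)
  have h8 := h (a + 1) b 1 (l + 1) (by omega) (by omega)
  have h9 := h a (b + 1) 1 (l + 1) (by omega) (by omega)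
  simp only [shapeA, shapeB, shapeC, tripleRatio, add_assoc, Nat.reduceAdd, zero_add]
  rw [neg_div, inv_neg, inv_div]
  field_simp

lemma IsMonomialShape.interiorEqs {g : Fin 4 → GL (Fin n) ℂ} (hg : GenericTuple g)
    {z : SimplexShape n} (hz : IsMonomialShape (ptolemy g) z) : z.InteriorEqs := by
  rw [isMonomialShape_iff] at hz
  intro t ht
  have h0 : ∀ i, 1 ≤ t.coord i := by
    intro i
    by_contra hi
    have : (Finset.univ.filter fun i => t.coord i = 0) = ∅ := Finset.card_eq_zero.1 ht
    exact Finset.notMem_empty i (this ▸ by simpa using hi)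
  have hs := t.sum_coord
  rw [Fin.sum_univ_four] at hs
  rw [z.prodAt_eq_around]
  obtain ⟨a, ha⟩ := Nat.exists_eq_add_of_le' (h0 0)
  obtain ⟨b, hb⟩ := Nat.exists_eq_add_of_le' (h0 1)
  obtain ⟨k, hk⟩ := Nat.exists_eq_add_of_le' (h0 2)
  obtain ⟨l, hl⟩ := Nat.exists_eq_add_of_le' (h0 3)
  rw [ha, hb, hk, hl] at hs ⊢
  rw [z.around_interior, (hz a b (k + 1) (l + 1) (by omega)).1.1,
    (hz (a + 1) (b + 1) k l (by omega)).1.2, (hz (a + 1) b k (l + 1) (by omega)).2.1.1,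
    (hz a (b + 1) (k + 1) l (by omega)).2.1.2, (hz a (b + 1) k (l + 1) (by omega)).2.2.1,
    (hz (a + 1) b (k + 1) l (by omega)).2.2.2]
  exact shape_prod_interior fun a' b' k' l' h _ => hg.ne_zero (by omega)

/-! ### Symmetries of the simplex -/

lemma ptolemy_swap01 (g : Fin 4 → GL (Fin n) ℂ) {a b k l : ℕ} (h : a + b + k + l = n) :
    ptolemy (g ∘ swap 0 1) ![b, a, k, l] = (-1) ^ (a * b) * ptolemy g ![a, b, k, l] := by
  have := ptolemy_comp_swap g 0 ![a, b, k, l] (by simpa [Fin.sum_univ_four] using h)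
  rw [show ![a, b, k, l] ∘ swap (Fin.castSucc 0) (Fin.succ 0) = ![b, a, k, l] by
    ext i; fin_cases i <;> rfl] at this
  exact this

lemma ptolemy_swap12 (g : Fin 4 → GL (Fin n) ℂ) {a b k l : ℕ} (h : a + b + k + l = n) :
    ptolemy (g ∘ swap 1 2) ![a, k, b, l] = (-1) ^ (b * k) * ptolemy g ![a, b, k, l] := by
  have := ptolemy_comp_swap g 1 ![a, b, k, l] (by simpa [Fin.sum_univ_four] using h)
  rw [show ![a, b, k, l] ∘ swap (Fin.castSucc 1) (Fin.succ 1) = ![a, k, b, l] by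
    ext i; fin_cases i <;> rfl] at this
  exact this

lemma ptolemy_swap23 (g : Fin 4 → GL (Fin n) ℂ) {a b k l : ℕ} (h : a + b + k + l = n) :
    ptolemy (g ∘ swap 2 3) ![a, b, l, k] = (-1) ^ (k * l) * ptolemy g ![a, b, k, l] := by
  have := ptolemy_comp_swap g 2 ![a, b, k, l] (by simpa [Fin.sum_univ_four] using h)
  rw [show ![a, b, k, l] ∘ swap (Fin.castSucc 2) (Fin.succ 2) = ![a, b, l, k] by
    ext i; fin_cases i <;> rfl] at this
  exact this

lemma shape_swap01 {g : Fin 4 → GL (Fin n) ℂ} (hg : GenericTuple g) {a b k l : ℕ}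
    (h : a + b + k + l + 2 = n) :
    shapeA (ptolemy (g ∘ swap 0 1)) b a k l = (shapeA (ptolemy g) a b k l)⁻¹ ∧
    shapeB (ptolemy (g ∘ swap 0 1)) b a k l = (shapeC (ptolemy g) a b k l)⁻¹ ∧
    shapeC (ptolemy (g ∘ swap 0 1)) b a k l = (shapeB (ptolemy g) a b k l)⁻¹ := by
  have h1 := hg.ne_zero (show (a + 1) + (b + 1) + k + l = n by omega)
  have h2 := hg.ne_zero (show a + b + (k + 1) + (l + 1) = n by omega)
  have h3 := hg.ne_zero (show (a + 1) + b + k + (l + 1) = n by omega)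
  have h4 := hg.ne_zero (show a + (b + 1) + (k + 1) + l = n by omega)
  have h5 := hg.ne_zero (show (a + 1) + b + (k + 1) + l = n by omega)
  have h6 := hg.ne_zero (show a + (b + 1) + k + (l + 1) = n by omega)
  unfold shapeA shapeB shapeC
  rw [ptolemy_swap01 g (show (a + 1) + (b + 1) + k + l = n by omega),
    ptolemy_swap01 g (show a + b + (k + 1) + (l + 1) = n by omega),
    ptolemy_swap01 g (show (a + 1) + b + k + (l + 1) = n by omega),
    ptolemy_swap01 g (show a + (b + 1) + (k + 1) + l = n by omega),
    ptolemy_swap01 g (show (a + 1) + b + (k + 1) + l = n by omega),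
    ptolemy_swap01 g (show a + (b + 1) + k + (l + 1) = n by omega)]
  refine ⟨?_, ?_, ?_⟩ <;>
  · simp only [add_mul, mul_add, one_mul, mul_one, pow_add, pow_one]
    field_simp

lemma shape_swap12 {g : Fin 4 → GL (Fin n) ℂ} (hg : GenericTuple g) {a b k l : ℕ}
    (h : a + b + k + l + 2 = n) :
    shapeA (ptolemy (g ∘ swap 1 2)) a k b l = (shapeC (ptolemy g) a b k l)⁻¹ ∧
    shapeB (ptolemy (g ∘ swap 1 2)) a k b l = (shapeB (ptolemy g) a b k l)⁻¹ ∧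
    shapeC (ptolemy (g ∘ swap 1 2)) a k b l = (shapeA (ptolemy g) a b k l)⁻¹ := by
  have h1 := hg.ne_zero (show (a + 1) + (b + 1) + k + l = n by omega)
  have h2 := hg.ne_zero (show a + b + (k + 1) + (l + 1) = n by omega)
  have h3 := hg.ne_zero (show (a + 1) + b + k + (l + 1) = n by omega)
  have h4 := hg.ne_zero (show a + (b + 1) + (k + 1) + l = n by omega)
  have h5 := hg.ne_zero (show (a + 1) + b + (k + 1) + l = n by omega)
  have h6 := hg.ne_zero (show a + (b + 1) + k + (l + 1) = n by omega)
  unfold shapeA shapeB shapeC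
  rw [ptolemy_swap12 g (show (a + 1) + (b + 1) + k + l = n by omega),
    ptolemy_swap12 g (show a + b + (k + 1) + (l + 1) = n by omega),
    ptolemy_swap12 g (show (a + 1) + b + k + (l + 1) = n by omega),
    ptolemy_swap12 g (show a + (b + 1) + (k + 1) + l = n by omega),
    ptolemy_swap12 g (show (a + 1) + b + (k + 1) + l = n by omega),
    ptolemy_swap12 g (show a + (b + 1) + k + (l + 1) = n by omega)]
  refine ⟨?_, ?_, ?_⟩ <;>
  · simp only [add_mul, mul_add, one_mul, mul_one, pow_add, pow_one]
    field_simp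

lemma shape_swap23 {g : Fin 4 → GL (Fin n) ℂ} (hg : GenericTuple g) {a b k l : ℕ}
    (h : a + b + k + l + 2 = n) :
    shapeA (ptolemy (g ∘ swap 2 3)) a b l k = (shapeA (ptolemy g) a b k l)⁻¹ ∧
    shapeB (ptolemy (g ∘ swap 2 3)) a b l k = (shapeC (ptolemy g) a b k l)⁻¹ ∧
    shapeC (ptolemy (g ∘ swap 2 3)) a b l k = (shapeB (ptolemy g) a b k l)⁻¹ := by
  have h1 := hg.ne_zero (show (a + 1) + (b + 1) + k + l = n by omega)
  have h2 := hg.ne_zero (show a + b + (k + 1) + (l + 1) = n by omega)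
  have h3 := hg.ne_zero (show (a + 1) + b + k + (l + 1) = n by omega)
  have h4 := hg.ne_zero (show a + (b + 1) + (k + 1) + l = n by omega)
  have h5 := hg.ne_zero (show (a + 1) + b + (k + 1) + l = n by omega)
  have h6 := hg.ne_zero (show a + (b + 1) + k + (l + 1) = n by omega)
  unfold shapeA shapeB shapeC
  rw [ptolemy_swap23 g (show (a + 1) + (b + 1) + k + l = n by omega),
    ptolemy_swap23 g (show a + b + (k + 1) + (l + 1) = n by omega),
    ptolemy_swap23 g (show (a + 1) + b + k + (l + 1) = n by omega),
    ptolemy_swap23 g (show a + (b + 1) + (k + 1) + l = n by omega),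
    ptolemy_swap23 g (show (a + 1) + b + (k + 1) + l = n by omega),
    ptolemy_swap23 g (show a + (b + 1) + k + (l + 1) = n by omega)]
  refine ⟨?_, ?_, ?_⟩ <;>
  · simp only [add_mul, mul_add, one_mul, mul_one, pow_add, pow_one]
    field_simp

end Products

section Symmetry

variable {n : ℕ}

variable (hn : 2 ≤ n) {g : Fin 4 → GL (Fin n) ℂ} {z z' : SimplexShape n}

include hn

lemma val_swap01 (hg : GenericTuple g) (hz : IsMonomialShape (ptolemy g) z)
    (hz' : IsMonomialShape (ptolemy (g ∘ swap 0 1)) z') (a b k l : ℕ) :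
    z'.val b a k l e1100 = (z.val a b k l e1100)⁻¹ ∧
    z'.val b a k l e0011 = (z.val a b k l e0011)⁻¹ ∧
    z'.val b a k l e0110 = (z.val a b k l e1010)⁻¹ ∧
    z'.val b a k l e1001 = (z.val a b k l e0101)⁻¹ ∧
    z'.val b a k l e1010 = (z.val a b k l e0110)⁻¹ ∧
    z'.val b a k l e0101 = (z.val a b k l e1001)⁻¹ := by
  by_cases h : a + b + k + l = n - 2
  · have H := isMonomialShape_iff.1 hz a b k l h
    have H' := isMonomialShape_iff.1 hz' b a k l (by omega)
    have S := shape_swap01 hg (show a + b + k + l + 2 = n by omega)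
    refine ⟨?_, ?_, ?_, ?_, ?_, ?_⟩
    · rw [H'.1.1, H.1.1, S.1]
    · rw [H'.1.2, H.1.2, S.1]
    · rw [H'.2.1.1, H.2.2.1, S.2.1]
    · rw [H'.2.1.2, H.2.2.2, S.2.1]
    · rw [H'.2.2.1, H.2.1.1, S.2.2]
    · rw [H'.2.2.2, H.2.1.2, S.2.2]
  · have h1 : ∀ e, z.val a b k l e = 1 := fun e =>
      dif_neg (by simpa [Fin.sum_univ_four] using h)
    have h2 : ∀ e, z'.val b a k l e = 1 := fun e =>
      dif_neg (by simp only [Fin.sum_univ_four, cons_val]; omega)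
    simp [h1, h2]

lemma around_swap01 (hg : GenericTuple g) (hz : IsMonomialShape (ptolemy g) z)
    (hz' : IsMonomialShape (ptolemy (g ∘ swap 0 1)) z') (a b k l : ℕ) :
    z'.around b a k l = (z.around a b k l)⁻¹ := by
  have hw := val_swap01 hn hg hz hz'
  simp only [SimplexShape.around, (hw _ _ _ _).1, (hw _ _ _ _).2.1, (hw _ _ _ _).2.2.1,
    (hw _ _ _ _).2.2.2.1, (hw _ _ _ _).2.2.2.2.1, (hw _ _ _ _).2.2.2.2.2, mul_inv,
    apply_ite Inv.inv, inv_one, and_comm]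
  ring

lemma val_swap12 (hg : GenericTuple g) (hz : IsMonomialShape (ptolemy g) z)
    (hz' : IsMonomialShape (ptolemy (g ∘ swap 1 2)) z') (a b k l : ℕ) :
    z'.val a k b l e1100 = (z.val a b k l e1010)⁻¹ ∧
    z'.val a k b l e0011 = (z.val a b k l e0101)⁻¹ ∧
    z'.val a k b l e0110 = (z.val a b k l e0110)⁻¹ ∧
    z'.val a k b l e1001 = (z.val a b k l e1001)⁻¹ ∧
    z'.val a k b l e1010 = (z.val a b k l e1100)⁻¹ ∧
    z'.val a k b l e0101 = (z.val a b k l e0011)⁻¹ := by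
  by_cases h : a + b + k + l = n - 2
  · have H := isMonomialShape_iff.1 hz a b k l h
    have H' := isMonomialShape_iff.1 hz' a k b l (by omega)
    have S := shape_swap12 hg (show a + b + k + l + 2 = n by omega)
    refine ⟨?_, ?_, ?_, ?_, ?_, ?_⟩
    · rw [H'.1.1, H.2.2.1, S.1]
    · rw [H'.1.2, H.2.2.2, S.1]
    · rw [H'.2.1.1, H.2.1.1, S.2.1]
    · rw [H'.2.1.2, H.2.1.2, S.2.1]
    · rw [H'.2.2.1, H.1.1, S.2.2]
    · rw [H'.2.2.2, H.1.2, S.2.2]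
  · have h1 : ∀ e, z.val a b k l e = 1 := fun e =>
      dif_neg (by simpa [Fin.sum_univ_four] using h)
    have h2 : ∀ e, z'.val a k b l e = 1 := fun e =>
      dif_neg (by simp only [Fin.sum_univ_four, cons_val]; omega)
    simp [h1, h2]

lemma around_swap12 (hg : GenericTuple g) (hz : IsMonomialShape (ptolemy g) z)
    (hz' : IsMonomialShape (ptolemy (g ∘ swap 1 2)) z') (a b k l : ℕ) :
    z'.around a k b l = (z.around a b k l)⁻¹ := by
  have hw := val_swap12 hn hg hz hz'
  simp only [SimplexShape.around, (hw _ _ _ _).1, (hw _ _ _ _).2.1, (hw _ _ _ _).2.2.1,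
    (hw _ _ _ _).2.2.2.1, (hw _ _ _ _).2.2.2.2.1, (hw _ _ _ _).2.2.2.2.2, mul_inv,
    apply_ite Inv.inv, inv_one, and_comm]
  ring

lemma val_swap23 (hg : GenericTuple g) (hz : IsMonomialShape (ptolemy g) z)
    (hz' : IsMonomialShape (ptolemy (g ∘ swap 2 3)) z') (a b k l : ℕ) :
    z'.val a b l k e1100 = (z.val a b k l e1100)⁻¹ ∧
    z'.val a b l k e0011 = (z.val a b k l e0011)⁻¹ ∧
    z'.val a b l k e0110 = (z.val a b k l e0101)⁻¹ ∧
    z'.val a b l k e1001 = (z.val a b k l e1010)⁻¹ ∧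
    z'.val a b l k e1010 = (z.val a b k l e1001)⁻¹ ∧
    z'.val a b l k e0101 = (z.val a b k l e0110)⁻¹ := by
  by_cases h : a + b + k + l = n - 2
  · have H := isMonomialShape_iff.1 hz a b k l h
    have H' := isMonomialShape_iff.1 hz' a b l k (by omega)
    have S := shape_swap23 hg (show a + b + k + l + 2 = n by omega)
    refine ⟨?_, ?_, ?_, ?_, ?_, ?_⟩
    · rw [H'.1.1, H.1.1, S.1]
    · rw [H'.1.2, H.1.2, S.1]
    · rw [H'.2.1.1, H.2.2.2, S.2.1]
    · rw [H'.2.1.2, H.2.2.1, S.2.1]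
    · rw [H'.2.2.1, H.2.1.2, S.2.2]
    · rw [H'.2.2.2, H.2.1.1, S.2.2]
  · have h1 : ∀ e, z.val a b k l e = 1 := fun e =>
      dif_neg (by simpa [Fin.sum_univ_four] using h)
    have h2 : ∀ e, z'.val a b l k e = 1 := fun e =>
      dif_neg (by simp only [Fin.sum_univ_four, cons_val]; omega)
    simp [h1, h2]

lemma around_swap23 (hg : GenericTuple g) (hz : IsMonomialShape (ptolemy g) z)
    (hz' : IsMonomialShape (ptolemy (g ∘ swap 2 3)) z') (a b k l : ℕ) :
    z'.around a b l k = (z.around a b k l)⁻¹ := by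
  have hw := val_swap23 hn hg hz hz'
  simp only [SimplexShape.around, (hw _ _ _ _).1, (hw _ _ _ _).2.1, (hw _ _ _ _).2.2.1,
    (hw _ _ _ _).2.2.2.1, (hw _ _ _ _).2.2.2.2.1, (hw _ _ _ _).2.2.2.2.2, mul_inv,
    apply_ite Inv.inv, inv_one, and_comm]
  ring

/-- Reordering the vertices of a simplex permutes the products of shapes around the integral points,
and inverts them if the orientation is reversed. -/
lemma around_comp (hg : GenericTuple g) (w : Perm (Fin 4)) (hz : IsMonomialShape (ptolemy g) z)
    (hz' : IsMonomialShape (ptolemy (g ∘ w)) z') (t : Fin 4 → ℕ) :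
    z'.around (t (w 0)) (t (w 1)) (t (w 2)) (t (w 3)) =
      z.around (t 0) (t 1) (t 2) (t 3) ^ ((Perm.sign w : ℤˣ) : ℤ) := by
  induction w using perm_induction generalizing z' with
  | h1 =>
    rw [hz'.unique hz]
    simp
  | hs w i ih =>
    obtain ⟨z'', hz''⟩ := (hg.comp w).exists_isMonomialShape hn
    have key := ih hz''
    rw [Perm.sign_mul, Perm.sign_swap (Fin.castSucc_lt_succ).ne, mul_neg_one, Units.val_neg,
      _root_.zpow_neg, ← key]
    rw [Perm.coe_mul, ← Function.comp_assoc] at hz'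
    fin_cases i
    · exact around_swap01 hn (hg.comp w) hz'' hz' (t (w 0)) (t (w 1)) (t (w 2)) (t (w 3))
    · exact around_swap12 hn (hg.comp w) hz'' hz' (t (w 0)) (t (w 1)) (t (w 2)) (t (w 3))
    · exact around_swap23 hn (hg.comp w) hz'' hz' (t (w 0)) (t (w 1)) (t (w 2)) (t (w 3))

end Symmetry

/-! ### Independence of the representing matrices -/

section Gauge

variable {n : ℕ}

lemma ptolemy_eq_mul_of_flag {g g' : Fin 4 → GL (Fin n) ℂ} {A : GL (Fin n) ℂ}
    (h : ∀ i, flag (g' i) = flag (A * g i)) :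
    ∃ (K : ℂ) (f : Fin 4 → ℕ → ℂ), K ≠ 0 ∧ (∀ i k, f i k ≠ 0) ∧
      ∀ a b k l, a + b + k + l = n → ptolemy g' ![a, b, k, l] =
        K * (f 0 a * f 1 b * f 2 k * f 3 l) * ptolemy g ![a, b, k, l] := by
  obtain ⟨K, f, hK, hf, e⟩ := exists_ptolemy_eq_mul h
  exact ⟨K, f, hK, hf, fun a b k l hs => e _ (by simpa [Fin.sum_univ_four] using hs)⟩

lemma shape_eq_of_flag {g g' : Fin 4 → GL (Fin n) ℂ} {A : GL (Fin n) ℂ}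
    (h : ∀ i, flag (g' i) = flag (A * g i)) (hg : GenericTuple g) {a b k l : ℕ}
    (hs : a + b + k + l + 2 = n) :
    shapeA (ptolemy g') a b k l = shapeA (ptolemy g) a b k l ∧
    shapeB (ptolemy g') a b k l = shapeB (ptolemy g) a b k l ∧
    shapeC (ptolemy g') a b k l = shapeC (ptolemy g) a b k l := by
  obtain ⟨K, f, hK, hf, e⟩ := ptolemy_eq_mul_of_flag h
  have h1 := hg.ne_zero (show (a + 1) + (b + 1) + k + l = n by omega)
  have h2 := hg.ne_zero (show a + b + (k + 1) + (l + 1) = n by omega)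
  have h3 := hg.ne_zero (show (a + 1) + b + k + (l + 1) = n by omega)
  have h4 := hg.ne_zero (show a + (b + 1) + (k + 1) + l = n by omega)
  have h5 := hg.ne_zero (show (a + 1) + b + (k + 1) + l = n by omega)
  have h6 := hg.ne_zero (show a + (b + 1) + k + (l + 1) = n by omega)
  have f0 := hf 0 a
  have f0' := hf 0 (a + 1)
  have f1 := hf 1 b
  have f1' := hf 1 (b + 1)
  have f2 := hf 2 k
  have f2' := hf 2 (k + 1)
  have f3 := hf 3 l
  have f3' := hf 3 (l + 1)
  unfold shapeA shapeB shapeC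
  rw [e _ _ _ _ (show (a + 1) + (b + 1) + k + l = n by omega),
    e _ _ _ _ (show a + b + (k + 1) + (l + 1) = n by omega),
    e _ _ _ _ (show (a + 1) + b + k + (l + 1) = n by omega),
    e _ _ _ _ (show a + (b + 1) + (k + 1) + l = n by omega),
    e _ _ _ _ (show (a + 1) + b + (k + 1) + l = n by omega),
    e _ _ _ _ (show a + (b + 1) + k + (l + 1) = n by omega)]
  refine ⟨?_, ?_, ?_⟩ <;> field_simp

lemma IsMonomialShape.isShapeOf (hn : 2 ≤ n) {g : Fin 4 → GL (Fin n) ℂ} (hg : GenericTuple g)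
    {z : SimplexShape n} (hz : IsMonomialShape (ptolemy g) z) : IsShapeOf (decoOf g) z := by
  intro g' hg'
  obtain ⟨A, hA⟩ := decoOf_eq_iff.1 hg'.symm
  rw [isMonomialShape_iff] at hz ⊢
  intro a b k l h
  obtain ⟨h1, h2, h3⟩ := shape_eq_of_flag hA hg (show a + b + k + l + 2 = n by omega)
  rw [h1, h2, h3]
  exact hz a b k l h

/-- The triple ratios of the first three flags only depend on these flags up to the group action. -/
lemma tripleRatio_eq_of_flag {g g' : Fin 4 → GL (Fin n) ℂ} {A : GL (Fin n) ℂ}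
    (h : ∀ i, i ≠ 3 → flag (g' i) = flag (A * g i))
    (hg : ∀ a b k, a + b + k = n → ptolemy g ![a, b, k, 0] ≠ 0) {a b k : ℕ}
    (hs : a + b + k + 3 = n) :
    tripleRatio (fun a b k => ptolemy g' ![a, b, k, 0]) a b k =
      tripleRatio (fun a b k => ptolemy g ![a, b, k, 0]) a b k := by
  -- replace the last flag, which does not matter
  let g'' : Fin 4 → GL (Fin n) ℂ := Function.update g' 3 (A * g 3)
  have h' : ∀ i, flag (g'' i) = flag (A * g i) := by
    intro i
    by_cases hi : i = 3
    · subst hi; simp [g'']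
    · simp [g'', hi, h i hi]
  obtain ⟨K, f, hK, hf, e⟩ := ptolemy_eq_mul_of_flag h'
  have e' : ∀ a b k, a + b + k = n → ptolemy g' ![a, b, k, 0] =
      K * (f 0 a * f 1 b * f 2 k * f 3 0) * ptolemy g ![a, b, k, 0] := by
    intro a b k hs
    rw [← e a b k 0 hs]
    refine ptolemy_congr_of_eq_zero (fun i hi => ?_) (by simpa [Fin.sum_univ_four] using hs) rfl
    simp [g'', hi]
  have h1 := hg a (b + 1) (k + 2) (by omega)
  have h2 := hg (a + 2) b (k + 1) (by omega)
  have h3 := hg (a + 1) (b + 2) k (by omega)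
  have h4 := hg (a + 1) b (k + 2) (by omega)
  have h5 := hg (a + 2) (b + 1) k (by omega)
  have h6 := hg a (b + 2) (k + 1) (by omega)
  have f0 := hf 0 a
  have f0' := hf 0 (a + 1)
  have f0'' := hf 0 (a + 2)
  have f1 := hf 1 b
  have f1' := hf 1 (b + 1)
  have f1'' := hf 1 (b + 2)
  have f2 := hf 2 k
  have f2' := hf 2 (k + 1)
  have f2'' := hf 2 (k + 2)
  have f3 := hf 3 0
  simp only [tripleRatio]
  rw [e' _ _ _ (show a + (b + 1) + (k + 2) = n by omega),
    e' _ _ _ (show (a + 2) + b + (k + 1) = n by omega),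
    e' _ _ _ (show (a + 1) + (b + 2) + k = n by omega),
    e' _ _ _ (show (a + 1) + b + (k + 2) = n by omega),
    e' _ _ _ (show (a + 2) + (b + 1) + k = n by omega),
    e' _ _ _ (show a + (b + 2) + (k + 1) = n by omega)]
  field_simp

end Gauge

/-! ### Classification of generic triples of flags by triple ratios -/

section Triples

variable {n : ℕ}

open ExteriorAlgebra (ι)

lemma volForm_blade_mul_ι (u v w : ℕ → Fin n → ℂ) (a b k : ℕ) :
    volForm n (blade u a * blade v b * blade w k * ι ℂ (v b)) =
      (-1) ^ k * volForm n (blade u a * blade v (b + 1) * blade w k) := by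
  rw [blade_succ, ← mul_assoc (blade u a) (blade v b), mul_assoc _ (ι ℂ (v b)), ι_mul_blade,
    mul_smul_comm, map_smul, smul_eq_mul, ← mul_assoc, neg_one_pow_mul_self, one_mul, mul_assoc,
    mul_assoc]

lemma volForm_blade_mul_ι_of_lt (u v w : ℕ → Fin n → ℂ) (a k : ℕ) {b b' : ℕ} (h : b' < b) :
    volForm n (blade u a * blade v b * blade w k * ι ℂ (v b')) = 0 := by
  have e : blade v b * (blade w k * ι ℂ (v b')) = 0 := by
    have : blade w k * ι ℂ (v b') = (-1 : ℂ) ^ k • (ι ℂ (v b') * blade w k) := by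
      rw [ι_mul_blade, smul_smul, neg_one_pow_mul_self, one_smul]
    rw [this, mul_smul_comm, ← mul_assoc, blade_mul_ι_of_lt v h, zero_mul, smul_zero]
  rw [mul_assoc, mul_assoc, e, mul_zero, map_zero]

/-- Four matrices starting with a normalized triple of flags. -/
def stdTuple (m : GL (Fin n) ℂ) : Fin 4 → GL (Fin n) ℂ := ![1, q₁ n, m, 1]

lemma ptolemy_stdTuple (m : GL (Fin n) ℂ) {a b k : ℕ} (h : a + b + k = n) :
    ptolemy (stdTuple m) ![a, b, k, 0] =
      volForm n (blade (cols 1) a * blade (cols (q₁ n).1) b * blade (cols m.1) k) :=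
  ptolemy_eq_three _ h

/-- A normalized triple of flags is determined by its triple ratios. If the first `k` columns of `m`
and `m'` agree, then so do the Ptolemy coordinates up to level `k`. On level `k + 1` they agree at
one end, since the columns are lower triangular with diagonal `1`, and hence everywhere, because
the triple ratios relate neighbouring coordinates. These coordinates determine the next column by a
triangular system of linear equations. -/
lemma eq_of_tripleRatio_eq {m m' : GL (Fin n) ℂ} (hm : IsNormalizedLower m)
    (hm' : IsNormalizedLower m')
    (h0 : ∀ a b k, a + b + k = n → ptolemy (stdTuple m) ![a, b, k, 0] ≠ 0)
    (h0' : ∀ a b k, a + b + k = n → ptolemy (stdTuple m') ![a, b, k, 0] ≠ 0)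
    (hX : ∀ a b k, a + b + k + 3 = n →
      tripleRatio (fun a b k => ptolemy (stdTuple m) ![a, b, k, 0]) a b k =
      tripleRatio (fun a b k => ptolemy (stdTuple m') ![a, b, k, 0]) a b k) : m = m' := by
  have key : ∀ k ≤ n, ∀ j < k, cols m.1 j = cols m'.1 j := by
    intro k
    induction k with
    | zero => intro _ j hj; omega
    | succ k ih =>
      intro hk j hj
      have ihk := ih (by omega)
      rcases Nat.lt_succ_iff_lt_or_eq.1 hj with hj | rfl
      · exact ihk j hj
      have hjn : j < n := hk
      -- the difference of the two columns in question
      set y := cols m.1 j - cols m'.1 j with hy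
      have hylow : ∀ r : Fin n, (r : ℕ) ≤ j → y r = 0 := by
        intro r hr
        have e : ∀ m : GL (Fin n) ℂ, cols m.1 j r = m.1 r ⟨j, hjn⟩ := fun m =>
          cols_val m.1 ⟨j, hjn⟩ r
        rw [hy, Pi.sub_apply, e, e]
        rcases hr.lt_or_eq with hr | hr
        · rw [hm.1 r ⟨j, hjn⟩ hr, hm'.1 r ⟨j, hjn⟩ hr, sub_zero]
        · obtain rfl : r = ⟨j, hjn⟩ := Fin.ext hr
          rw [hm.2.1, hm'.2.1, sub_self]
      rcases j with _ | i
      · ext r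
        exact (cols_val m.1 ⟨0, hjn⟩ r).trans (((hm.2.2 r ⟨0, hjn⟩ rfl).trans
          (hm'.2.2 r ⟨0, hjn⟩ rfl).symm).trans (cols_val m'.1 ⟨0, hjn⟩ r).symm)
      have hprev : ∀ a b k, a + b + k = n → k ≤ i + 1 →
          ptolemy (stdTuple m) ![a, b, k, 0] = ptolemy (stdTuple m') ![a, b, k, 0] := by
        intro a b k h hk
        rw [ptolemy_stdTuple m h, ptolemy_stdTuple m' h,
          blade_congr fun j hj => ihk j (by omega)]
      have hdiff : ∀ a b, a + b + (i + 2) = n →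
          ptolemy (stdTuple m) ![a, b, i + 2, 0] - ptolemy (stdTuple m') ![a, b, i + 2, 0] =
          volForm n (blade (cols 1) a * blade (cols (q₁ n).1) b * blade (cols m.1) (i + 1) *
            ι ℂ y) := by
        intro a b h
        rw [ptolemy_stdTuple m h, ptolemy_stdTuple m' h, blade_succ _ (i + 1),
          blade_succ (cols m'.1) (i + 1), ← blade_congr ihk, ← mul_assoc, ← mul_assoc, ← map_sub,
          ← mul_sub, ← map_sub]
      -- the triple ratios propagate the equality from `a = 0`
      have hnext : ∀ a b, a + b + (i + 2) = n →
          ptolemy (stdTuple m) ![a, b, i + 2, 0] = ptolemy (stdTuple m') ![a, b, i + 2, 0] := by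
        intro a
        induction a with
        | zero =>
          intro b h
          rw [← sub_eq_zero, hdiff 0 b h]
          exact volForm_std_eq_zero 0 b _ _ _ fun r _ hr => hylow r (by omega)
        | succ a iha =>
          intro b h
          have hx := hX a b i (by omega)
          simp only [tripleRatio] at hx
          rw [iha (b + 1) (by omega), hprev (a + 2) b (i + 1) (by omega) (by omega),
            hprev (a + 1) (b + 2) i (by omega) (by omega),
            hprev (a + 2) (b + 1) i (by omega) (by omega),
            hprev a (b + 2) (i + 1) (by omega) (by omega)] at hx
          have h1 := h0' a (b + 1) (i + 2) (by omega)
          have h2 := h0' (a + 2) b (i + 1) (by omega)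
          have h3 := h0' (a + 1) (b + 2) i (by omega)
          have h4 := h0' (a + 2) (b + 1) i (by omega)
          have h5 := h0' a (b + 2) (i + 1) (by omega)
          have h6 := h0 (a + 1) b (i + 2) (by omega)
          have h7 := h0' (a + 1) b (i + 2) (by omega)
          generalize ptolemy (stdTuple m) ![a + 1, b, i + 2, 0] = p at *
          generalize ptolemy (stdTuple m') ![a + 1, b, i + 2, 0] = p' at *
          rw [div_eq_div_iff (by simp [h4, h5, h6]) (by simp [h4, h5, h7])] at hx
          have hx' := mul_left_cancel₀ (by simp [h1, h2, h3]) hx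
          exact (mul_right_cancel₀ h4 (mul_right_cancel₀ h5 hx')).symm
      -- the equations `hdiff` with right hand side zero form a triangular system for `y`
      have hy0 : ∀ r : ℕ, ∀ hr : r < n, y ⟨r, hr⟩ = 0 := by
        intro r
        induction r using Nat.strong_induction_on with
        | _ r ihr =>
          intro hr
          rcases le_or_gt r (i + 1) with hri | hri
          · exact hylow _ hri
          have hd := hdiff (r - (i + 1)) (n - 1 - r) (by omega)
          rw [hnext _ _ (by omega), sub_self] at hd
          have hz := volForm_std_eq_zero (r - (i + 1)) (n - 1 - r) (cols m.1) (i + 1)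
            (y - y ⟨r, hr⟩ • Pi.single ⟨r, hr⟩ 1) (by
              intro r' h1 h2
              rcases (show (r' : ℕ) ≤ r by omega).lt_or_eq with h | h
              · have hne : r' ≠ ⟨r, hr⟩ := fun h' => by simp [h'] at h
                simp [hne, ihr r' h r'.2]
              · obtain rfl : r' = ⟨r, hr⟩ := Fin.ext h
                simp)
          rw [map_sub, mul_sub, map_sub, ← hd, zero_sub, neg_eq_zero, map_smul, mul_smul_comm,
            map_smul, smul_eq_mul] at hz
          have hq := cols_q₁ (⟨r, hr⟩ : Fin n).rev
          rw [Fin.rev_rev, Fin.val_rev] at hq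
          rw [show n - ((⟨r, hr⟩ : Fin n) + 1) = n - 1 - r by simp only; omega] at hq
          rw [← hq, volForm_blade_mul_ι, ← ptolemy_stdTuple m (by omega)] at hz
          refine (mul_eq_zero.1 hz).resolve_right (mul_ne_zero (by simp) (h0 _ _ _ (by omega)))
      refine sub_eq_zero.1 (funext fun r => ?_)
      exact hy0 r r.2
  ext r j
  have := congrFun (key n le_rfl j j.2) r
  rwa [cols_val, cols_val] at this

lemma IsNormalization.ptolemy_ne_zero_and_tripleRatio_eq {g : Fin 4 → GL (Fin n) ℂ} {τ : PGL(n, ℂ)}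
    {m : GL (Fin n) ℂ} (h : IsNormalization (flag (g 0)) (flag (g 1)) (flag (g 2)) τ m)
    (hg : ∀ a b k, a + b + k = n → ptolemy g ![a, b, k, 0] ≠ 0) :
    (∀ a b k, a + b + k = n → ptolemy (stdTuple m) ![a, b, k, 0] ≠ 0) ∧
    ∀ a b k, a + b + k + 3 = n →
      tripleRatio (fun a b k => ptolemy (stdTuple m) ![a, b, k, 0]) a b k =
      tripleRatio (fun a b k => ptolemy g ![a, b, k, 0]) a b k := by
  obtain ⟨A, rfl⟩ := ProjGenLinGroup.mk_surjective τ
  obtain ⟨-, h0, h1, h2⟩ := h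
  rw [mk_smul_flag] at h0 h1 h2
  have hA : ∀ i, i ≠ 3 → flag (stdTuple m i) = flag (A⁻¹ * g i) := by
    intro i hi
    rw [← mk_smul_flag, map_inv, eq_inv_smul_iff, mk_smul_flag]
    fin_cases i
    · exact h0.symm
    · exact h1.symm
    · exact h2.symm
    · exact absurd rfl hi
  refine ⟨fun a b k hs => ?_, fun a b k hs => tripleRatio_eq_of_flag hA hg hs⟩
  let g' : Fin 4 → GL (Fin n) ℂ := Function.update (stdTuple m) 3 (A⁻¹ * g 3)
  have h' : ∀ i, flag (g' i) = flag (A⁻¹ * g i) := by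
    intro i
    by_cases hi : i = 3
    · subst hi; simp [g']
    · simp [g', hi, hA i hi]
  obtain ⟨K, f, hK, hf, e⟩ := ptolemy_eq_mul_of_flag h'
  have : ptolemy (stdTuple m) ![a, b, k, 0] = ptolemy g' ![a, b, k, 0] :=
    ptolemy_congr_of_eq_zero (fun i hi => by simp [g', hi])
      (by simpa [Fin.sum_univ_four] using hs) rfl
  rw [this, e _ _ _ _ hs]
  exact mul_ne_zero (mul_ne_zero hK (by simp [hf])) (hg a b k hs)

/-- Generic triples of flags with equal triple ratios have equal normal forms. -/
lemma IsNormalization.eq_of_tripleRatio_eq {g g' : Fin 4 → GL (Fin n) ℂ} {τ τ' : PGL(n, ℂ)}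
    {m m' : GL (Fin n) ℂ} (h : IsNormalization (flag (g 0)) (flag (g 1)) (flag (g 2)) τ m)
    (h' : IsNormalization (flag (g' 0)) (flag (g' 1)) (flag (g' 2)) τ' m')
    (hg : GenericTuple g) (hg' : GenericTuple g')
    (hX : ∀ a b k, a + b + k + 3 = n →
      tripleRatio (fun a b k => ptolemy g ![a, b, k, 0]) a b k =
      tripleRatio (fun a b k => ptolemy g' ![a, b, k, 0]) a b k) : m = m' := by
  obtain ⟨h1, h2⟩ := h.ptolemy_ne_zero_and_tripleRatio_eq fun a b k hs => hg.ne_zero (by omega)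
  obtain ⟨h1', h2'⟩ := h'.ptolemy_ne_zero_and_tripleRatio_eq fun a b k hs => hg'.ne_zero (by omega)
  exact GluingEq.eq_of_tripleRatio_eq h.1 h'.1 h1 h1' fun a b k hs => by
    rw [h2 a b k hs, h2' a b k hs, hX a b k hs]

end Triples

/-! ### Realization of prescribed Ptolemy coordinates -/

section Realization

variable {n : ℕ}

open ExteriorAlgebra (ι)

/-- Triangular systems of linear equations `φ a x = d a` are solvable. -/
lemma exists_of_triangular {V : Type*} [AddCommGroup V] [Module ℂ V] (φ : ℕ → V →ₗ[ℂ] ℂ)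
    (e : ℕ → V) (N : ℕ) (h0 : ∀ a < N, φ a (e a) ≠ 0) (h1 : ∀ a a', a < a' → a' < N → φ a (e a') = 0)
    (d : ℕ → ℂ) : ∃ x, ∀ a < N, φ a x = d a := by
  induction N with
  | zero => exact ⟨0, fun a ha => absurd ha (by omega)⟩
  | succ N ih =>
    obtain ⟨x, hx⟩ := ih (fun a ha => h0 a (by omega)) (fun a a' h h' => h1 a a' h (by omega))
    refine ⟨x + ((d N - φ N x) / φ N (e N)) • e N, fun a ha => ?_⟩
    rw [map_add, map_smul, smul_eq_mul]
    rcases Nat.lt_succ_iff_lt_or_eq.1 ha with ha | rfl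
    · rw [h1 a N ha (by omega), mul_zero, add_zero, hx a ha]
    · rw [div_mul_cancel₀ _ (h0 _ (by omega))]; ring

/-- Any system of non-zero numbers extending the Ptolemy coordinates of two flags is the system of
Ptolemy coordinates of a triple of flags. -/
lemma exists_blade_eq (u v : ℕ → Fin n → ℂ) (f : ℕ → ℕ → ℕ → ℂ)
    (hf : ∀ a b k, a + b + k = n → f a b k ≠ 0)
    (h0 : ∀ a b, a + b = n → volForm n (blade u a * blade v b) = f a b 0) :
    ∃ w : ℕ → Fin n → ℂ, ∀ a b k, a + b + k = n →
      volForm n (blade u a * blade v b * blade w k) = f a b k := by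
  have key : ∀ K ≤ n, ∃ w : ℕ → Fin n → ℂ, ∀ a b k, k ≤ K → a + b + k = n →
      volForm n (blade u a * blade v b * blade w k) = f a b k := by
    intro K
    induction K with
    | zero =>
      intro _
      refine ⟨0, fun a b k hk h => ?_⟩
      obtain rfl : k = 0 := by omega
      rw [blade_zero, mul_one, h0 a b (by omega)]
    | succ K ih =>
      intro hK
      obtain ⟨w, hw⟩ := ih (by omega)
      -- the conditions on the next vector form a triangular system in the span of the `v b`
      let φ : ℕ → (Fin n → ℂ) →ₗ[ℂ] ℂ := fun a => volForm n ∘ₗ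
        LinearMap.mulLeft ℂ (blade u a * blade v (n - 1 - K - a) * blade w K) ∘ₗ ι ℂ
      have hφ : ∀ a x, φ a x = volForm n (blade u a * blade v (n - 1 - K - a) * blade w K * ι ℂ x) :=
        fun _ _ => rfl
      obtain ⟨x, hx⟩ := exists_of_triangular φ (fun a => v (n - 1 - K - a)) (n - K)
        (fun a ha => by
          rw [hφ, volForm_blade_mul_ι, hw _ _ _ le_rfl (by omega)]
          exact mul_ne_zero (by simp) (hf _ _ _ (by omega)))
        (fun a a' h h' => by rw [hφ]; exact volForm_blade_mul_ι_of_lt u v w a K (by omega))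
        (fun a => f a (n - 1 - K - a) (K + 1))
      have hold : ∀ k ≤ K, blade (Function.update w K x) k = blade w k := fun k hk =>
        blade_congr fun j hj => Function.update_of_ne (by omega) _ _
      refine ⟨Function.update w K x, fun a b k hk h => ?_⟩
      rcases Nat.le_succ_iff.1 hk with hk | rfl
      · rw [hold k hk, hw a b k hk h]
      · rw [blade_succ, hold K le_rfl, Function.update_self, ← mul_assoc]
        obtain rfl : b = n - 1 - K - a := by omega
        rw [← hφ, hx a (by omega)]
  obtain ⟨w, hw⟩ := key n le_rfl
  exact ⟨w, fun a b k h => hw a b k (by omega) h⟩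

/-- The function on the integral points of a triangle with given values on the first two levels,
the value `1` on one edge, and given triple ratios `X`. -/
noncomputable def triangleFun (p d : ℕ → ℂ) (X : ℕ → ℕ → ℕ → ℂ) : ℕ → ℕ → ℕ → ℂ
  | 0, a, _ => p a
  | 1, a, _ => d a
  | _ + 2, 0, _ => 1
  | k + 2, a + 1, b =>
    -(triangleFun p d X (k + 2) a (b + 1) * triangleFun p d X (k + 1) (a + 2) b *
      triangleFun p d X k (a + 1) (b + 2)) /
    (X a b k * triangleFun p d X k (a + 2) (b + 1) * triangleFun p d X (k + 1) a (b + 2))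
  termination_by k a => (k, a)

lemma triangleFun_ne_zero {p d : ℕ → ℂ} {X : ℕ → ℕ → ℕ → ℂ} (hp : ∀ a, p a ≠ 0)
    (hd : ∀ a, d a ≠ 0) (hX : ∀ a b k, X a b k ≠ 0) (k a b : ℕ) : triangleFun p d X k a b ≠ 0 := by
  fun_induction triangleFun p d X k a b with
  | case1 => exact hp _
  | case2 => exact hd _
  | case3 => exact one_ne_zero
  | case4 k a b ih1 ih2 ih3 ih4 ih5 =>
    exact div_ne_zero (by simp [*]) (by simp [*])

/-- Triples of flags with given first two flags and arbitrary triple ratios exist. -/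
lemma exists_blade_tripleRatio (u v : ℕ → Fin n → ℂ)
    (h0 : ∀ a b, a + b = n → volForm n (blade u a * blade v b) ≠ 0) {d : ℕ → ℂ} (hd : ∀ a, d a ≠ 0)
    {X : ℕ → ℕ → ℕ → ℂ} (hX : ∀ a b k, X a b k ≠ 0) :
    ∃ w : ℕ → Fin n → ℂ,
      (∀ a b k, a + b + k = n → volForm n (blade u a * blade v b * blade w k) ≠ 0) ∧
      (∀ a b, a + b + 1 = n → volForm n (blade u a * blade v b * blade w 1) = d a) ∧
      ∀ a b k, a + b + k + 3 = n →
        tripleRatio (fun a b k => volForm n (blade u a * blade v b * blade w k)) a b k = X a b k := by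
  let p : ℕ → ℂ := fun a => if a ≤ n then volForm n (blade u a * blade v (n - a)) else 1
  have hp : ∀ a, p a ≠ 0 := fun a => by
    simp only [p]
    split_ifs with h
    exacts [h0 _ _ (by omega), one_ne_zero]
  have hne := triangleFun_ne_zero hp hd hX
  obtain ⟨w, hw⟩ := exists_blade_eq u v (fun a b k => triangleFun p d X k a b)
    (fun a b k _ => hne k a b) fun a b h => by
      obtain rfl : b = n - a := by omega
      rw [triangleFun]
      simp [p, show a ≤ n by omega]
  refine ⟨w, fun a b k h => by rw [hw a b k h]; exact hne k a b, fun a b h => ?_,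
    fun a b k h => ?_⟩
  · rw [hw a b 1 h, triangleFun]
  · simp only [tripleRatio]
    rw [hw _ _ _ (show a + (b + 1) + (k + 2) = n by omega),
      hw _ _ _ (show (a + 2) + b + (k + 1) = n by omega),
      hw _ _ _ (show (a + 1) + (b + 2) + k = n by omega),
      hw _ _ _ (show (a + 1) + b + (k + 2) = n by omega),
      hw _ _ _ (show (a + 2) + (b + 1) + k = n by omega),
      hw _ _ _ (show a + (b + 2) + (k + 1) = n by omega)]
    have h1 := hne (k + 2) a (b + 1)
    have h2 := hne (k + 1) (a + 2) b
    have h3 := hne k (a + 1) (b + 2)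
    have h5 := hne k (a + 2) (b + 1)
    have h6 := hne (k + 1) a (b + 2)
    have h7 := hX a b k
    rw [triangleFun.eq_4 p d X b k a]
    field_simp

lemma volForm_std_ne_zero (b : ℕ) : ∀ a, a + b = n →
    volForm n (blade (cols 1) a * blade (cols (q₁ n).1) b) ≠ 0 := by
  induction b with
  | zero =>
    intro a h
    obtain rfl : a = n := h
    rw [blade_zero, mul_one, volForm_blade_cols, det_one]
    exact one_ne_zero
  | succ b ih =>
    intro a h
    have hq := cols_q₁ (⟨a, by omega⟩ : Fin n).rev
    rw [Fin.rev_rev, Fin.val_rev, ← cols_one,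
      show n - ((⟨a, by omega⟩ : Fin n) + 1) = b by simp only; omega] at hq
    have e := volForm_blade_mul_ι (cols 1) (cols 1) (cols (q₁ n).1) 0 a b
    rw [blade_zero, one_mul, one_mul] at e
    rw [blade_succ, hq, ← mul_assoc, e]
    exact mul_ne_zero (by simp) (ih _ (by omega))

lemma exists_cols_eq (w : ℕ → Fin n → ℂ) (h : volForm n (blade w n) ≠ 0) :
    ∃ g : GL (Fin n) ℂ, ∀ k ≤ n, blade (cols g.1) k = blade w k := by
  let X : Matrix (Fin n) (Fin n) ℂ := Matrix.of fun r k => w k r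
  have hX : ∀ k < n, cols X k = w k := fun k hk => by ext r; simp [cols, hk, X]
  have hdet : X.det ≠ 0 := by
    rw [← volForm_blade_cols, blade_congr hX]
    exact h
  exact ⟨GeneralLinearGroup.mkOfDetNeZero X hdet, fun k hk =>
    blade_congr fun j hj => hX j (by omega)⟩

end Realization

/-! ### Shapes determine decorations, and exist -/

section Bijection

variable {n : ℕ}

open ExteriorAlgebra (ι)

/-- The product of shapes around the integral point `t`. -/
noncomputable def SimplexShape.aroundVec (z : SimplexShape n) (t : Fin 4 → ℕ) : ℂ :=
  z.around (t 0) (t 1) (t 2) (t 3)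

lemma SimplexShape.prodAt_eq_aroundVec (z : SimplexShape n) (t : Pt n) :
    z.prodAt t = z.aroundVec t.coord := z.prodAt_eq_around t

lemma aroundVec_comp (hn : 2 ≤ n) {g : Fin 4 → GL (Fin n) ℂ} {z z' : SimplexShape n}
    (hg : GenericTuple g) (w : Perm (Fin 4)) (hz : IsMonomialShape (ptolemy g) z)
    (hz' : IsMonomialShape (ptolemy (g ∘ w)) z') (t : Fin 4 → ℕ) :
    z'.aroundVec t = z.aroundVec (t ∘ w.symm) ^ ((Perm.sign w : ℤˣ) : ℤ) := by
  have := around_comp hn hg w hz hz' (t ∘ w.symm)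
  simpa [SimplexShape.aroundVec] using this

lemma IsMonomialShape.aroundVec_face {g : Fin 4 → GL (Fin n) ℂ} {z : SimplexShape n}
    (hg : GenericTuple g) (hz : IsMonomialShape (ptolemy g) z) {a b k : ℕ}
    (hs : a + b + k + 3 = n) : z.aroundVec ![a + 1, b + 1, k + 1, 0] =
      tripleRatio (fun a b k => ptolemy g ![a, b, k, 0]) a b k := by
  rw [isMonomialShape_iff] at hz
  rw [← shape_prod_face₃ fun a' b' k' l' h _ => hg.ne_zero (by omega),
    ← (hz a b (k + 1) 0 (by omega)).1.1, ← (hz (a + 1) b k 0 (by omega)).2.1.1,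
    ← (hz a (b + 1) k 0 (by omega)).2.2.1]
  exact z.around_face₃ a b k

lemma IsMonomialShape.aroundVec_edge {g : Fin 4 → GL (Fin n) ℂ} {z : SimplexShape n}
    (hz : IsMonomialShape (ptolemy g) z) {a b : ℕ}
    (hs : a + b + 2 = n) : z.aroundVec ![a + 1, b + 1, 0, 0] = shapeA (ptolemy g) a b 0 0 := by
  rw [isMonomialShape_iff] at hz
  rw [← (hz a b 0 0 (by omega)).1.1]
  exact z.around_edge a b

/-- The products of shapes around the integral points of a face are triple ratios of flags. -/
lemma tripleRatio_comp_eq (hn : 2 ≤ n) {g : Fin 4 → GL (Fin n) ℂ} {z : SimplexShape n}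
    (hg : GenericTuple g) (hz : IsMonomialShape (ptolemy g) z) (w : Perm (Fin 4)) {a b k : ℕ}
    (hs : a + b + k + 3 = n) :
    tripleRatio (fun a b k => ptolemy (g ∘ w) ![a, b, k, 0]) a b k =
      z.aroundVec (![a + 1, b + 1, k + 1, 0] ∘ w.symm) ^ ((Perm.sign w : ℤˣ) : ℤ) := by
  obtain ⟨z', hz'⟩ := (hg.comp w).exists_isMonomialShape hn
  rw [← hz'.aroundVec_face (hg.comp w) hs, aroundVec_comp hn hg w hz hz']

lemma shapeA_comp_eq (hn : 2 ≤ n) {g : Fin 4 → GL (Fin n) ℂ} {z : SimplexShape n}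
    (hg : GenericTuple g) (hz : IsMonomialShape (ptolemy g) z) (w : Perm (Fin 4)) {a b : ℕ}
    (hs : a + b + 2 = n) :
    shapeA (ptolemy (g ∘ w)) a b 0 0 =
      z.aroundVec (![a + 1, b + 1, 0, 0] ∘ w.symm) ^ ((Perm.sign w : ℤˣ) : ℤ) := by
  obtain ⟨z', hz'⟩ := (hg.comp w).exists_isMonomialShape hn
  rw [← hz'.aroundVec_edge hs, aroundVec_comp hn hg w hz hz']

/-- The label of a short edge is the class of a diagonal matrix whose consecutive entries have as
ratios the shapes along the long edge. -/
lemma shapeA_edge_eq {g : Fin 4 → GL (Fin n) ℂ} (hg : GenericTuple g) {τ τ' : PGL(n, ℂ)}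
    {m m' : GL (Fin n) ℂ} (h : IsNormalization (flag (g 0)) (flag (g 1)) (flag (g 2)) τ m)
    (h' : IsNormalization (flag (g 0)) (flag (g 1)) (flag (g 3)) τ' m') {d : Fin n → ℂˣ}
    (hd : τ⁻¹ * τ' = ProjGenLinGroup.mk (diagUnits d)) {a b : ℕ} (hs : a + b + 2 = n) :
    shapeA (ptolemy g) a b 0 0 = d ⟨a + 1, by omega⟩ / d ⟨a, by omega⟩ := by
  obtain ⟨A, rfl⟩ := ProjGenLinGroup.mk_surjective τ
  obtain ⟨hm, h0, h1, h2⟩ := h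
  obtain ⟨hm', -, -, h3⟩ := h'
  let g' : Fin 4 → GL (Fin n) ℂ := ![1, q₁ n, m, diagUnits d * m']
  have hA : ∀ i, flag (g' i) = flag (A⁻¹ * g i) := by
    intro i
    rw [← mk_smul_flag, map_inv, eq_inv_smul_iff]
    fin_cases i
    · exact h0.symm
    · exact h1.symm
    · exact h2.symm
    · refine (h3.trans ?_).symm
      rw [inv_mul_eq_iff_eq_mul.1 hd, mul_smul, mk_smul_flag (diagUnits d)]
      rfl
  rw [← (shape_eq_of_flag hA hg (show a + b + 0 + 0 + 2 = n by omega)).1]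
  obtain ⟨K, f, hK, hf, e⟩ := ptolemy_eq_mul_of_flag hA
  let κ : Fin n → ℂ := fun r =>
    volForm n (blade (cols 1) r * blade (cols (q₁ n).1) (n - 1 - r) * ι ℂ (Pi.single r 1))
  have hn : 0 < n := by omega
  have hb1 : ∀ v : ℕ → Fin n → ℂ, blade v 1 = ι ℂ (v 0) := fun v => by
    simpa [blade_zero] using blade_succ v 0
  have c2 : ∀ r : Fin n, ∀ b, r + b + 1 = n → ptolemy g' ![r, b, 1, 0] = κ r := by
    intro r b hrb
    rw [ptolemy_eq_three _ (by omega)]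
    change volForm n (blade (cols 1) r * blade (cols (q₁ n).1) b * blade (cols m.1) 1) = _
    rw [hb1, volForm_std_eq_mul r b hrb]
    have : cols m.1 0 r = 1 :=
      (cols_val m.1 ⟨0, hn⟩ r).trans (hm.2.2 r ⟨0, hn⟩ rfl)
    rw [this, one_mul]
    obtain rfl : b = n - 1 - r := by omega
    rfl
  have c3 : ∀ r : Fin n, ∀ b, r + b + 1 = n → ptolemy g' ![r, b, 0, 1] = d r * κ r := by
    intro r b hrb
    rw [ptolemy_eq_mixedVol _ _ (by simpa [Fin.sum_univ_four] using hrb)]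
    change volForm n (blade (cols 1) r * blade (cols (q₁ n).1) b * blade (cols m.1) 0 *
      blade (cols (diagUnits d * m').1) 1) = _
    rw [hb1, blade_zero, mul_one, volForm_std_eq_mul r b hrb]
    have : cols (diagUnits d * m').1 0 r = d r := by
      refine (cols_val (diagUnits d * m').1 ⟨0, hn⟩ r).trans ?_
      rw [Units.val_mul, diagUnits_val, diagonal_mul, hm'.2.2 r ⟨0, hn⟩ rfl, mul_one]
    rw [this]
    obtain rfl : b = n - 1 - r := by omega
    rfl
  have hκ : ∀ r, κ r ≠ 0 := fun r => by
    rw [← c2 r (n - 1 - r) (by omega), e _ _ _ _ (by omega)]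
    exact mul_ne_zero (mul_ne_zero hK (by simp [hf])) (hg.ne_zero (by omega))
  unfold shapeA
  have e1 := c3 ⟨a + 1, by omega⟩ b (by simp only; omega)
  have e2 := c2 ⟨a, by omega⟩ (b + 1) (by simp only; omega)
  have e3 := c2 ⟨a + 1, by omega⟩ b (by simp only; omega)
  have e4 := c3 ⟨a, by omega⟩ (b + 1) (by simp only; omega)
  simp only [zero_add] at e1 e2 e3 e4 ⊢
  rw [e1, e2, e3, e4]
  have k1 := hκ ⟨a, by omega⟩
  have k2 := hκ ⟨a + 1, by omega⟩
  field_simp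

lemma mem_H_iff {p : PGL(n, ℂ)} : p ∈ H n ↔ ∃ d, p = ProjGenLinGroup.mk (diagUnits d) := by
  constructor
  · rintro ⟨g, hg, rfl⟩
    obtain ⟨d, rfl⟩ := exists_diagUnits_eq hg
    exact ⟨d, rfl⟩
  · rintro ⟨d, rfl⟩
    exact ⟨_, diagUnits_mem_diagGL d, rfl⟩

lemma mk_diagUnits_eq_one_iff {d : Fin n → ℂˣ} :
    (ProjGenLinGroup.mk (diagUnits d) : PGL(n, ℂ)) = 1 ↔
      ∀ a, ∀ h : a + 1 < n, (d ⟨a + 1, h⟩ : ℂ) / d ⟨a, by omega⟩ = 1 := by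
  have h0 : ∀ a, ∀ h : a + 1 < n, ((d ⟨a + 1, h⟩ : ℂ) / d ⟨a, by omega⟩ = 1 ↔
      d ⟨a + 1, h⟩ = d ⟨a, by omega⟩) := fun a h => by
    rw [div_eq_one_iff_eq (Units.ne_zero _), Units.val_inj]
  simp only [h0]
  rw [← map_one ProjGenLinGroup.mk, eq_comm, ProjGenLinGroup.mk_eq_mk_iff]
  constructor
  · rintro ⟨u, hu⟩ a h
    have key : ∀ i, (d i : ℂ) = u := fun i => by
      have : (1 * GeneralLinearGroup.scalar (Fin n) u).1 i i = (diagUnits d).1 i i := by rw [hu]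
      simpa [GeneralLinearGroup.coe_scalar, Matrix.scalar_apply, eq_comm] using this
    rw [← Units.val_inj, key, key]
  · intro h
    rcases Nat.eq_zero_or_pos n with rfl | hn
    · exact ⟨1, Units.ext (by ext i; exact i.elim0)⟩
    have key : ∀ i, ∀ hi : i < n, d ⟨i, hi⟩ = d ⟨0, hn⟩ := by
      intro i
      induction i with
      | zero => intro _; rfl
      | succ i ih => intro hi; rw [h i hi, ih]
    refine ⟨d ⟨0, hn⟩, ?_⟩
    ext i j
    by_cases hij : i = j
    · subst hij
      simp [GeneralLinearGroup.coe_scalar, Matrix.scalar_apply, key i i.2]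
    · simp [GeneralLinearGroup.coe_scalar, Matrix.scalar_apply, hij]

lemma IsNormalization.inv_mul_mem_H {f₀ f₁ f₂ f₃ : PGL(n, ℂ) ⧸ B n} {τ τ' : PGL(n, ℂ)}
    {m m' : GL (Fin n) ℂ} (h : IsNormalization f₀ f₁ f₂ τ m) (h' : IsNormalization f₀ f₁ f₃ τ' m') :
    τ⁻¹ * τ' ∈ H n :=
  mem_H_of_smul_eq (by rw [mul_smul, ← h'.2.1, inv_smul_eq_iff, ← h.2.1])
    (by rw [mul_smul, ← h'.2.2.1, inv_smul_eq_iff, ← h.2.2.1])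

/-- A generic decoration is determined by its shapes: by its triple ratios on two faces, which
determine the normal forms of two triples of flags, and the shapes along their common edge, which
tell how these triples fit together. -/
lemma decoOf_eq_of_isMonomialShape (hn : 2 ≤ n) {g g' : Fin 4 → GL (Fin n) ℂ} (hg : GenericTuple g)
    (hg' : GenericTuple g') {z : SimplexShape n} (hz : IsMonomialShape (ptolemy g) z)
    (hz' : IsMonomialShape (ptolemy g') z) : decoOf g = decoOf g' := by
  obtain ⟨τ, m, h⟩ := hg.exists_isNormalization 1
  obtain ⟨σ, l, k⟩ := hg.exists_isNormalization (swap 2 3)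
  obtain ⟨τ', m', h'⟩ := hg'.exists_isNormalization 1
  obtain ⟨σ', l', k'⟩ := hg'.exists_isNormalization (swap 2 3)
  obtain rfl : m = m' := IsNormalization.eq_of_tripleRatio_eq (g := g ∘ (1 : Perm (Fin 4)))
    (g' := g' ∘ (1 : Perm (Fin 4))) h h' (hg.comp 1) (hg'.comp 1) fun a b k hs => by
      rw [tripleRatio_comp_eq hn hg hz 1 hs, tripleRatio_comp_eq hn hg' hz' 1 hs]
  obtain rfl : l = l' := IsNormalization.eq_of_tripleRatio_eq (g := g ∘ swap 2 3)
    (g' := g' ∘ swap 2 3) k k' (hg.comp _) (hg'.comp _) fun a b k hs => by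
      rw [tripleRatio_comp_eq hn hg hz _ hs, tripleRatio_comp_eq hn hg' hz' _ hs]
  have s0 : (swap 2 3 : Perm (Fin 4)) 0 = 0 := by decide
  have s1 : (swap 2 3 : Perm (Fin 4)) 1 = 1 := by decide
  have s2 : (swap 2 3 : Perm (Fin 4)) 2 = 3 := by decide
  rw [s0, s1, s2] at k k'
  simp only [Perm.one_apply] at h h'
  obtain ⟨d, hd⟩ := mem_H_iff.1 (h.inv_mul_mem_H k)
  obtain ⟨d', hd'⟩ := mem_H_iff.1 (h'.inv_mul_mem_H k')
  have hdd : τ⁻¹ * σ = τ'⁻¹ * σ' := by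
    rw [hd, hd', ← mul_inv_eq_one, ← map_inv, ← map_mul,
      show (diagUnits d')⁻¹ = diagUnits d'⁻¹ by
        rw [inv_eq_iff_mul_eq_one, ← diagUnits_mul, mul_inv_cancel, diagUnits_one],
      ← diagUnits_mul, mk_diagUnits_eq_one_iff]
    intro a ha
    have e1 := shapeA_edge_eq hg h k hd (show a + (n - 2 - a) + 2 = n by omega)
    have e2 := shapeA_edge_eq hg' h' k' hd' (show a + (n - 2 - a) + 2 = n by omega)
    rw [← hz.aroundVec_edge (by omega)] at e1
    rw [← hz'.aroundVec_edge (by omega), e1] at e2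
    have n1 : (d ⟨a, by omega⟩ : ℂ) ≠ 0 := Units.ne_zero _
    have n2 : (d' ⟨a, by omega⟩ : ℂ) ≠ 0 := Units.ne_zero _
    have n3 : (d' ⟨a + 1, ha⟩ : ℂ) ≠ 0 := Units.ne_zero _
    rw [div_eq_div_iff n1 n2] at e2
    simp only [Pi.mul_apply, Pi.inv_apply, Units.val_mul, Units.val_inv_eq_inv_val]
    field_simp
    linear_combination e2
  have hp : τ' * τ⁻¹ = σ' * σ⁻¹ := by
    rw [inv_mul_eq_iff_eq_mul] at hdd
    rw [hdd]; group
  refine simplexDecoration_of_eq_iff.2 ⟨τ' * τ⁻¹, fun i => ?_⟩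
  fin_cases i
  · rw [mul_smul]
    exact h'.2.1.trans (congrArg _ (inv_smul_eq_iff.2 h.2.1).symm)
  · rw [mul_smul]
    exact h'.2.2.1.trans (congrArg _ (inv_smul_eq_iff.2 h.2.2.1).symm)
  · rw [mul_smul]
    exact h'.2.2.2.trans (congrArg _ (inv_smul_eq_iff.2 h.2.2.2).symm)
  · rw [hp, mul_smul]
    exact k'.2.2.2.trans (congrArg _ (inv_smul_eq_iff.2 k.2.2.2).symm)

end Bijection

/-! ### Every solution of the interior equations comes from a decoration -/

section Existence

variable {n : ℕ}

lemma SimplexShape.around_ne_zero (z : SimplexShape n) (a b k l : ℕ) : z.around a b k l ≠ 0 := by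
  have h : ∀ (p : Prop) [Decidable p] (a b k l : ℕ) (e : Edge),
      (if p then z.val a b k l e else 1) ≠ 0 := fun p _ a b k l e => by
    split_ifs
    exacts [z.val_ne_zero _ _ _ _ _, one_ne_zero]
  simp only [SimplexShape.around, ne_eq, mul_eq_zero, not_or]
  exact ⟨⟨⟨⟨⟨h _ _ _ _ _ _, h _ _ _ _ _ _⟩, h _ _ _ _ _ _⟩, h _ _ _ _ _ _⟩, h _ _ _ _ _ _⟩,
    h _ _ _ _ _ _⟩

lemma SimplexShape.InteriorEqs.around_eq_one {z : SimplexShape n} (hz : z.InteriorEqs)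
    {a b k l : ℕ} (hs : a + b + k + l + 4 = n) : z.around (a + 1) (b + 1) (k + 1) (l + 1) = 1 := by
  have hsum : ∑ i, ![a + 1, b + 1, k + 1, l + 1] i = n := by
    simp [Fin.sum_univ_four]; omega
  have := hz (Pt.of ![a + 1, b + 1, k + 1, l + 1] hsum) (by
    change (Finset.univ.filter fun i => ![a + 1, b + 1, k + 1, l + 1] i = 0).card = 0
    rw [Finset.card_eq_zero, Finset.filter_eq_empty_iff]
    intro i _
    fin_cases i <;> simp)
  rw [z.prodAt_eq_around] at this
  exact this

/-- The first shape at a point determines the other ones. If it is given by Ptolemy coordinates, then,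
as it is not `1`, the Ptolemy relation shows that the remaining Ptolemy coordinate is non-zero and
that the other shapes are given by Ptolemy coordinates as well. -/
lemma SimplexShape.val_eq_of_val_eq (z : SimplexShape n) {g : Fin 4 → GL (Fin n) ℂ} {a b k l : ℕ}
    (hs : a + b + k + l + 2 = n)
    (h1 : ptolemy g ![a + 1, b + 1, k, l] ≠ 0) (h2 : ptolemy g ![a + 1, b, k, l + 1] ≠ 0)
    (h3 : ptolemy g ![a, b + 1, k + 1, l] ≠ 0) (h4 : ptolemy g ![a + 1, b, k + 1, l] ≠ 0)
    (h5 : ptolemy g ![a, b + 1, k, l + 1] ≠ 0)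
    (h : z.val a b k l e1100 = shapeA (ptolemy g) a b k l) :
    ptolemy g ![a, b, k + 1, l + 1] ≠ 0 ∧
      (z.val a b k l e1100 = shapeA (ptolemy g) a b k l ∧
        z.val a b k l e0011 = shapeA (ptolemy g) a b k l) ∧
      (z.val a b k l e0110 = shapeB (ptolemy g) a b k l ∧
        z.val a b k l e1001 = shapeB (ptolemy g) a b k l) ∧
      (z.val a b k l e1010 = shapeC (ptolemy g) a b k l ∧
        z.val a b k l e0101 = shapeC (ptolemy g) a b k l) := by
  have hsum : ∑ i, ![a, b, k, l] i = n - 2 := by simp [Fin.sum_univ_four]; omega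
  have rel := ptolemy_relation' g hs
  have hA1 : shapeA (ptolemy g) a b k l ≠ 1 := by
    rw [← h, z.val_of_eq hsum]
    exact z.ne_one _ _
  obtain ⟨-, r1⟩ := z.rel_0011 (Pt.of ![a, b, k, l] hsum)
  obtain ⟨r2, r3⟩ := z.rel_0110 (Pt.of ![a, b, k, l] hsum)
  obtain ⟨r4, r5⟩ := z.rel_0101 (Pt.of ![a, b, k, l] hsum)
  simp only [z.val_of_eq hsum] at h ⊢
  rw [r5, r4, r3, r2, ← r1, h]
  unfold shapeA shapeB shapeC at *
  have h6 : ptolemy g ![a, b, k + 1, l + 1] ≠ 0 := fun h0 => by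
    rw [h0, mul_zero, zero_add] at rel
    rw [rel, div_self (mul_ne_zero h4 h5)] at hA1
    exact hA1 rfl
  generalize ptolemy g ![a + 1, b + 1, k, l] = p at *
  generalize ptolemy g ![a + 1, b, k, l + 1] = q at *
  generalize ptolemy g ![a, b + 1, k + 1, l] = q' at *
  generalize ptolemy g ![a + 1, b, k + 1, l] = r at *
  generalize ptolemy g ![a, b + 1, k, l + 1] = r' at *
  generalize ptolemy g ![a, b, k + 1, l + 1] = p' at *
  have eB : 1 / (1 - q * q' / (r * r')) = r' * r / (p * p') := by
    rw [show 1 - q * q' / (r * r') = p * p' / (r * r') by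
      field_simp; linear_combination -rel]
    field_simp
  have eC : 1 / (1 - r' * r / (p * p')) = -(p * p' / (q * q')) := by
    rw [show 1 - r' * r / (p * p') = -(q * q' / (p * p')) by
      field_simp; linear_combination rel]
    field_simp
  exact ⟨h6, ⟨rfl, rfl⟩, ⟨eB, eB⟩, by rw [eB, eC], by rw [eB, eC]⟩

/-- Given a solution of the interior equations, choose the third and fourth flags such that the
triple ratios on two faces and the shapes along their common edge are the given ones. The gluing
equations then determine the shapes level by level, and the Ptolemy relations show that the
decoration is generic. -/
lemma SimplexShape.InteriorEqs.exists_isMonomialShape (hn : 2 ≤ n) {z : SimplexShape n}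
    (hz : z.InteriorEqs) :
    ∃ g : Fin 4 → GL (Fin n) ℂ, GenericTuple g ∧ IsMonomialShape (ptolemy g) z := by
  obtain ⟨w₂, u1, u2, u3⟩ := exists_blade_tripleRatio (n := n) (cols 1) (cols (q₁ n).1)
    (fun a b h => volForm_std_ne_zero b a h) (d := fun _ => 1) (fun _ => one_ne_zero)
    (X := fun a b k => z.around (a + 1) (b + 1) (k + 1) 0) (fun _ _ _ => z.around_ne_zero _ _ _ _)
  obtain ⟨w₃, v1, v2, v3⟩ := exists_blade_tripleRatio (n := n) (cols 1) (cols (q₁ n).1)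
    (fun a b h => volForm_std_ne_zero b a h)
    (d := fun a => ∏ i ∈ Finset.range a, z.val i (n - 2 - i) 0 0 e1100)
    (fun _ => Finset.prod_ne_zero_iff.2 fun _ _ => z.val_ne_zero _ _ _ _ _)
    (X := fun a b l => (z.around (a + 1) (b + 1) 0 (l + 1))⁻¹)
    (fun _ _ _ => inv_ne_zero (z.around_ne_zero _ _ _ _))
  obtain ⟨g₂, hg₂⟩ := exists_cols_eq w₂ (by
    have := u1 0 0 n (by omega)
    rwa [blade_zero, blade_zero, one_mul, one_mul] at this)
  obtain ⟨g₃, hg₃⟩ := exists_cols_eq w₃ (by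
    have := v1 0 0 n (by omega)
    rwa [blade_zero, blade_zero, one_mul, one_mul] at this)
  let g : Fin 4 → GL (Fin n) ℂ := ![1, q₁ n, g₂, g₃]
  have c2 : ∀ a b k, a + b + k = n → ptolemy g ![a, b, k, 0] =
      volForm n (blade (cols 1) a * blade (cols (q₁ n).1) b * blade w₂ k) := by
    intro a b k h
    rw [ptolemy_eq_mixedVol _ _ (by simpa [Fin.sum_univ_four] using h), ← hg₂ k (by omega)]
    change volForm n (blade (cols 1) a * blade (cols (q₁ n).1) b * blade (cols g₂.1) k *
      blade (cols g₃.1) 0) = _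
    rw [blade_zero, mul_one]
  have c3 : ∀ a b l, a + b + l = n → ptolemy g ![a, b, 0, l] =
      volForm n (blade (cols 1) a * blade (cols (q₁ n).1) b * blade w₃ l) := by
    intro a b l h
    rw [ptolemy_eq_mixedVol _ _ (by simpa [Fin.sum_univ_four] using h), ← hg₃ l (by omega)]
    change volForm n (blade (cols 1) a * blade (cols (q₁ n).1) b * blade (cols g₂.1) 0 *
      blade (cols g₃.1) l) = _
    rw [blade_zero, mul_one]
  -- induction on the level `k + l` of a point `(a, b, k, l)`
  have key : ∀ L, (∀ a b k l, a + b + k + l = n → k + l ≤ L + 1 → ptolemy g ![a, b, k, l] ≠ 0) ∧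
      ∀ a b k l, a + b + k + l + 2 = n → k + l < L →
        (z.val a b k l e1100 = shapeA (ptolemy g) a b k l ∧
          z.val a b k l e0011 = shapeA (ptolemy g) a b k l) ∧
        (z.val a b k l e0110 = shapeB (ptolemy g) a b k l ∧
          z.val a b k l e1001 = shapeB (ptolemy g) a b k l) ∧
        (z.val a b k l e1010 = shapeC (ptolemy g) a b k l ∧
          z.val a b k l e0101 = shapeC (ptolemy g) a b k l) := by
    intro L
    induction L with
    | zero =>
      refine ⟨fun a b k l h hk => ?_, fun a b k l _ h => absurd h (by omega)⟩
      rcases Nat.eq_zero_or_pos l with rfl | hl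
      · rw [c2 a b k (by omega)]
        exact u1 a b k (by omega)
      · obtain rfl : k = 0 := by omega
        rw [c3 a b l (by omega)]
        exact v1 a b l (by omega)
    | succ L ih =>
      obtain ⟨ih1, ih2⟩ := ih
      -- the equation at `(a + 1, b + 1, k, l)` relates the first shape to those of lower level
      have hA : ∀ a b k l, a + b + k + l + 2 = n → k + l = L →
          z.val a b k l e1100 = shapeA (ptolemy g) a b k l := by
        intro a b k l hs hL
        rcases k with _ | k <;> rcases l with _ | l
        · obtain rfl : b = n - 2 - a := by omega
          simp only [shapeA, zero_add]
          rw [c3 (a + 1) _ 1 (by omega), c2 a _ 1 (by omega), c2 (a + 1) _ 1 (by omega),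
            c3 a _ 1 (by omega), v2 _ _ (by omega), u2 _ _ (by omega), u2 _ _ (by omega),
            v2 _ _ (by omega), Finset.prod_range_succ]
          have : ∏ i ∈ Finset.range a, z.val i (n - 2 - i) 0 0 e1100 ≠ 0 :=
            Finset.prod_ne_zero_iff.2 fun _ _ => z.val_ne_zero _ _ _ _ _
          field_simp
        · have e := shape_prod_face₂ (c := ptolemy g) (a := a) (b := b) (l := l)
            fun a' b' k' l' h h' => ih1 _ _ _ _ (by omega) (by omega)
          have e2 := v3 a b l (by omega)
          simp only [tripleRatio] at e e2
          rw [← c3 _ _ _ (by omega), ← c3 _ _ _ (by omega), ← c3 _ _ _ (by omega),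
            ← c3 _ _ _ (by omega), ← c3 _ _ _ (by omega), ← c3 _ _ _ (by omega)] at e2
          rw [e2, inv_inv, z.around_face₂,
            ← (ih2 a (b + 1) 0 l (by omega) (by omega)).2.1.2,
            ← (ih2 (a + 1) b 0 l (by omega) (by omega)).2.2.2] at e
          exact (mul_right_cancel₀ (z.val_ne_zero _ _ _ _ _)
            (mul_right_cancel₀ (z.val_ne_zero _ _ _ _ _) e)).symm
        · have e := shape_prod_face₃ (c := ptolemy g) (a := a) (b := b) (k := k)
            fun a' b' k' l' h h' => ih1 _ _ _ _ (by omega) (by omega)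
          have e2 := u3 a b k (by omega)
          simp only [tripleRatio] at e e2
          rw [← c2 _ _ _ (by omega), ← c2 _ _ _ (by omega), ← c2 _ _ _ (by omega),
            ← c2 _ _ _ (by omega), ← c2 _ _ _ (by omega), ← c2 _ _ _ (by omega)] at e2
          rw [e2, z.around_face₃,
            ← (ih2 (a + 1) b k 0 (by omega) (by omega)).2.1.1,
            ← (ih2 a (b + 1) k 0 (by omega) (by omega)).2.2.1] at e
          exact (mul_right_cancel₀ (z.val_ne_zero _ _ _ _ _)
            (mul_right_cancel₀ (z.val_ne_zero _ _ _ _ _) e)).symm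
        · have e := shape_prod_interior (c := ptolemy g) (a := a) (b := b) (k := k) (l := l)
            fun a' b' k' l' h h' => ih1 _ _ _ _ (by omega) (by omega)
          have e2 := hz.around_eq_one (show a + b + k + l + 4 = n by omega)
          rw [← e2, z.around_interior,
            ← (ih2 (a + 1) (b + 1) k l (by omega) (by omega)).1.2,
            ← (ih2 (a + 1) b k (l + 1) (by omega) (by omega)).2.1.1,
            ← (ih2 a (b + 1) (k + 1) l (by omega) (by omega)).2.1.2,
            ← (ih2 a (b + 1) k (l + 1) (by omega) (by omega)).2.2.1,
            ← (ih2 (a + 1) b (k + 1) l (by omega) (by omega)).2.2.2] at e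
          exact (mul_right_cancel₀ (z.val_ne_zero _ _ _ _ _) <|
            mul_right_cancel₀ (z.val_ne_zero _ _ _ _ _) <|
            mul_right_cancel₀ (z.val_ne_zero _ _ _ _ _) <|
            mul_right_cancel₀ (z.val_ne_zero _ _ _ _ _) <|
            mul_right_cancel₀ (z.val_ne_zero _ _ _ _ _) e).symm
      have hall := fun a b k l (hs : a + b + k + l + 2 = n) (hL : k + l = L) =>
        z.val_eq_of_val_eq hs (ih1 _ _ _ _ (by omega) (by omega)) (ih1 _ _ _ _ (by omega) (by omega))
          (ih1 _ _ _ _ (by omega) (by omega)) (ih1 _ _ _ _ (by omega) (by omega))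
          (ih1 _ _ _ _ (by omega) (by omega)) (hA a b k l hs hL)
      refine ⟨fun a b k l h hk => ?_, fun a b k l h hk => ?_⟩
      · rcases Nat.lt_or_ge (k + l) (L + 2) with h' | h'
        · exact ih1 _ _ _ _ h (by omega)
        rcases l with _ | l
        · rw [c2 a b k (by omega)]
          exact u1 a b k (by omega)
        rcases k with _ | k
        · rw [c3 a b _ (by omega)]
          exact v1 a b _ (by omega)
        exact (hall a b k l (by omega) (by omega)).1
      · rcases Nat.lt_or_ge (k + l) L with h' | h'
        · exact ih2 _ _ _ _ h h'
        · exact (hall a b k l h (by omega)).2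
  refine ⟨g, fun t ht => ?_, isMonomialShape_iff.2 fun a b k l h =>
    (key n).2 a b k l (by omega) (by omega)⟩
  rw [← vec4_eta t]
  rw [Fin.sum_univ_four] at ht
  exact (key n).1 _ _ _ _ ht (by omega)

/-- The map from generic decorations to solutions of the interior equations is well defined. -/
theorem existsUnique_isShapeOf (hn : 2 ≤ n) {D : Deco n} (hD : IsGeneric D) :
    ∃! z : SimplexShape n, IsShapeOf D z ∧ z.InteriorEqs := by
  obtain ⟨g, rfl⟩ := exists_decoOf_eq D
  have hg := genericTuple_iff.2 hD
  obtain ⟨z, hz⟩ := hg.exists_isMonomialShape hn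
  exact ⟨z, ⟨hz.isShapeOf hn hg, hz.interiorEqs hg⟩, fun z' hz' => (hz'.1 g rfl).unique hz⟩

lemma IsShapeOf.injective (hn : 2 ≤ n) {D D' : Deco n} (hD : IsGeneric D) (hD' : IsGeneric D')
    {z : SimplexShape n} (h : IsShapeOf D z) (h' : IsShapeOf D' z) : D = D' := by
  obtain ⟨g, rfl⟩ := exists_decoOf_eq D
  obtain ⟨g', rfl⟩ := exists_decoOf_eq D'
  exact decoOf_eq_of_isMonomialShape hn (genericTuple_iff.2 hD) (genericTuple_iff.2 hD')
    (h g rfl) (h' g' rfl)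

lemma SimplexShape.InteriorEqs.exists_isShapeOf (hn : 2 ≤ n) {z : SimplexShape n}
    (hz : z.InteriorEqs) : ∃ D : Deco n, IsGeneric D ∧ IsShapeOf D z := by
  obtain ⟨g, hg, h⟩ := hz.exists_isMonomialShape hn
  exact ⟨decoOf g, genericTuple_iff.1 hg, h.isShapeOf hn hg⟩

end Existence

/-! ### Gluing natural cocycles and decorations -/

section Gluing

variable {n : ℕ} {T : Type*} (𝒯 : Triangulation T)

lemma perm_exists_eq {v i : Fin 4} (h : v ≠ i) : ∃ w : Perm (Fin 4), w 0 = v ∧ w 3 = i := by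
  revert v i
  decide

/-- Left multiplication glues the flags of a face if and only if it glues the natural cochains. -/
lemma glues_iff (hn : 0 < n) {F : T → Fin 4 → PGL(n, ℂ) ⧸ B n} {τ : T → Perm (Fin 4) → PGL(n, ℂ)}
    (hτ : ∀ Δ, IsNaturalCochain (F Δ) (τ Δ)) {Δ : T} {i : Fin 4} {h : PGL(n, ℂ)} :
    𝒯.Glues F Δ i h ↔ ∀ w : Perm (Fin 4), w 3 = i →
      τ (𝒯.adj Δ i) (𝒯.perm Δ i * w) = h * τ Δ w := by
  constructor
  · rintro hG w rfl
    obtain ⟨m, hm⟩ := isNaturalCochain_iff.1 (hτ Δ) w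
    obtain ⟨m', hm'⟩ := isNaturalCochain_iff.1 (hτ (𝒯.adj Δ (w 3))) (𝒯.perm Δ (w 3) * w)
    have := hm.smul h
    rw [hG _ (w.injective.ne (by decide)), hG _ (w.injective.ne (by decide)),
      hG _ (w.injective.ne (by decide))] at this
    exact IsNormalization.unique hn hm' this
  · intro hw v hv
    obtain ⟨w, rfl, rfl⟩ := perm_exists_eq hv
    obtain ⟨m, -, h0, -⟩ := hτ Δ w
    obtain ⟨m', -, h0', -⟩ := hτ (𝒯.adj Δ (w 3)) (𝒯.perm Δ (w 3) * w)
    rw [hw w rfl, mul_smul, ← h0] at h0'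
    exact h0'.symm

lemma perm_cases_of_apply_three {u : Perm (Fin 4)} (h : u 3 = 3) : u = 1 ∨ u = swap 0 1 ∨
    u = swap 1 2 ∨ u = swap 0 1 * swap 1 2 ∨ u = swap 1 2 * swap 0 1 ∨
    u = swap 0 1 * swap 1 2 * swap 0 1 := by
  revert u
  decide

/-- The labels on glued faces agree if and only if the cochains on them agree up to left
multiplication: the hexagon in a face is connected. -/
lemma facesMatch_coboundary_iff {G : Type*} [Group G] {τ : T → Perm (Fin 4) → G} :
    𝒯.FacesMatch (fun Δ => Labeling.coboundary (τ Δ)) ↔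
      ∀ Δ i, ∃ h : G, ∀ w : Perm (Fin 4), w 3 = i →
        τ (𝒯.adj Δ i) (𝒯.perm Δ i * w) = h * τ Δ w := by
  have s01 : (swap 0 1 : Perm (Fin 4)) 3 = 3 := by decide
  have s12 : (swap 1 2 : Perm (Fin 4)) 3 = 3 := by decide
  constructor
  · intro hF Δ i
    have step : ∀ w : Perm (Fin 4), w 3 = i → ∀ h, τ (𝒯.adj Δ i) (𝒯.perm Δ i * w) = h * τ Δ w →
        τ (𝒯.adj Δ i) (𝒯.perm Δ i * (w * swap 0 1)) = h * τ Δ (w * swap 0 1) ∧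
        τ (𝒯.adj Δ i) (𝒯.perm Δ i * (w * swap 1 2)) = h * τ Δ (w * swap 1 2) := by
      rintro w rfl h e
      obtain ⟨h1, h2⟩ := hF Δ w
      simp only [Labeling.coboundary, inv_mul_eq_iff_eq_mul] at h1 h2
      rw [← mul_assoc, ← mul_assoc, h1, h2, e]
      constructor <;> group
    have hw0 : swap 3 i 3 = i := swap_apply_left 3 i
    refine ⟨τ (𝒯.adj Δ i) (𝒯.perm Δ i * swap 3 i) * (τ Δ (swap 3 i))⁻¹, fun w hw => ?_⟩
    have e0 := (inv_mul_cancel_right (τ (𝒯.adj Δ i) (𝒯.perm Δ i * swap 3 i)) (τ Δ (swap 3 i))).symm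
    generalize τ (𝒯.adj Δ i) (𝒯.perm Δ i * swap 3 i) * (τ Δ (swap 3 i))⁻¹ = h at *
    have hu : ((swap 3 i)⁻¹ * w) 3 = 3 := by
      rw [Perm.mul_apply, hw, swap_inv, swap_apply_right]
    obtain ⟨u, rfl⟩ : ∃ u, w = swap 3 i * u := ⟨(swap 3 i)⁻¹ * w, by group⟩
    rw [inv_mul_cancel_left] at hu
    generalize swap 3 i = w₀ at *
    have a1 := step w₀ hw0 h e0
    have a2 := step (w₀ * swap 0 1) (by rw [Perm.mul_apply, s01, hw0]) h a1.1
    have a3 := step (w₀ * swap 1 2) (by rw [Perm.mul_apply, s12, hw0]) h a1.2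
    have a4 := step (w₀ * swap 0 1 * swap 1 2)
      (by rw [Perm.mul_apply, Perm.mul_apply, s12, s01, hw0]) h a2.2
    rcases perm_cases_of_apply_three hu with rfl | rfl | rfl | rfl | rfl | rfl
    · rwa [mul_one]
    · exact a1.1
    · exact a1.2
    · exact a2.2
    · exact a3.1
    · exact a4.1
  · intro hF Δ w
    obtain ⟨h, hh⟩ := hF Δ (w 3)
    simp only [Labeling.coboundary, mul_assoc]
    rw [hh w rfl, hh (w * swap 0 1) (by rw [Perm.mul_apply, s01]),
      hh (w * swap 1 2) (by rw [Perm.mul_apply, s12])]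
    constructor <;> group

/-- The product of short edges around a prism is conjugate to the product of the gluing elements
around the edge of the triangulation. -/
lemma prod_short_eq {G : Type*} [Group G] {τ : T → Perm (Fin 4) → G} {h : T → Fin 4 → G}
    (hh : ∀ Δ i, ∀ w : Perm (Fin 4), w 3 = i →
      τ (𝒯.adj Δ i) (𝒯.perm Δ i * w) = h Δ i * τ Δ w) (x : T × Perm (Fin 4)) (k : ℕ) :
    ((List.range k).map fun j =>
      (Labeling.coboundary (τ (𝒯.edgeStep^[j] x).1)).short (𝒯.edgeStep^[j] x).2).prod =
    (τ x.1 x.2)⁻¹ * ((List.range k).map fun j =>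
      (h (𝒯.edgeStep^[j] x).1 ((𝒯.edgeStep^[j] x).2 2))⁻¹).prod *
      τ (𝒯.edgeStep^[k] x).1 (𝒯.edgeStep^[k] x).2 := by
  induction k with
  | zero => simp
  | succ k ih =>
    rw [List.range_succ, List.map_append, List.map_append, List.prod_append, List.prod_append, ih,
      Function.iterate_succ_apply']
    simp only [List.map_cons, List.map_nil, List.prod_singleton, Labeling.coboundary]
    generalize 𝒯.edgeStep^[k] x = y
    have e := hh y.1 (y.2 2) (y.2 * swap 2 3) (by
      rw [Perm.mul_apply, swap_apply_right])
    rw [← mul_assoc] at e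
    simp only [Triangulation.edgeStep]
    rw [e]
    group

lemma prismsClose_coboundary_iff {G : Type*} [Group G] {τ : T → Perm (Fin 4) → G}
    {h : T → Fin 4 → G} (hh : ∀ Δ i, ∀ w : Perm (Fin 4), w 3 = i →
      τ (𝒯.adj Δ i) (𝒯.perm Δ i * w) = h Δ i * τ Δ w) :
    𝒯.PrismsClose (fun Δ => Labeling.coboundary (τ Δ)) ↔
      ∀ (x : T × Perm (Fin 4)) (k : ℕ), 𝒯.edgeStep^[k] x = x →
      ((List.range k).map fun j =>
        (h (𝒯.edgeStep^[j] x).1 ((𝒯.edgeStep^[j] x).2 2))⁻¹).prod = 1 := by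
  refine forall_congr' fun x => forall_congr' fun k => imp_congr_right fun hx => ?_
  rw [prod_short_eq 𝒯 hh, hx, mul_assoc, inv_mul_eq_one, eq_comm, mul_eq_right]

/-- Generic decorations of the simplices form a decoration of the triangulation if and only if the
natural cocycles form a cocycle. -/
lemma exists_decoration_iff (hn : 0 < n) {D : T → Deco n} {c : T → Labeling PGL(n, ℂ)}
    (hc : ∀ Δ, IsNaturalCocycleOf (D Δ) (c Δ)) :
    (∃ D' : 𝒯.Decoration PGL(n, ℂ) (B n), D'.toFun = D) ↔ 𝒯.FacesMatch c ∧ 𝒯.PrismsClose c := by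
  have key : ∀ F : T → Fin 4 → PGL(n, ℂ) ⧸ B n, (∀ Δ, SimplexDecoration.of (F Δ) = D Δ) →
      ∃ τ : T → Perm (Fin 4) → PGL(n, ℂ), (∀ Δ, IsNaturalCochain (F Δ) (τ Δ)) ∧
        c = fun Δ => Labeling.coboundary (τ Δ) := fun F hF => by
    choose τ hτ using fun Δ => (hc Δ (F Δ) (hF Δ)).1.exists
    exact ⟨τ, hτ, funext fun Δ => (hc Δ (F Δ) (hF Δ)).2 _ (hτ Δ)⟩
  constructor
  · rintro ⟨D', rfl⟩
    choose F hF using fun Δ => exists_of_eq (D'.toFun Δ)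
    obtain ⟨τ, hτ, rfl⟩ := key F hF
    choose h hh using fun Δ i => (D'.face F hF Δ i).exists
    have hh' := fun Δ i => (glues_iff 𝒯 hn hτ).1 (hh Δ i)
    exact ⟨(facesMatch_coboundary_iff 𝒯).2 fun Δ i => ⟨h Δ i, hh' Δ i⟩,
      (prismsClose_coboundary_iff 𝒯 hh').2 (D'.edge F hF h hh)⟩
  · rintro ⟨h1, h2⟩
    refine ⟨⟨D, fun F hF Δ i => ?_, fun F hF h hh => ?_⟩, rfl⟩
    · obtain ⟨τ, hτ, rfl⟩ := key F hF
      obtain ⟨h, hh⟩ := (facesMatch_coboundary_iff 𝒯).1 h1 Δ i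
      refine ⟨h, (glues_iff 𝒯 hn hτ).2 hh, fun h' hh' => ?_⟩
      have e := (glues_iff 𝒯 hn hτ).1 hh' (swap 3 i) (swap_apply_left 3 i)
      rw [hh (swap 3 i) (swap_apply_left 3 i)] at e
      exact (mul_right_cancel e).symm
    · obtain ⟨τ, hτ, rfl⟩ := key F hF
      exact (prismsClose_coboundary_iff 𝒯 fun Δ i => (glues_iff 𝒯 hn hτ).1 (hh Δ i)).1 h2

end Gluing

/-! ### Integral points of a triangulation -/

section Points

variable {n : ℕ} {T : Type*} (𝒯 : Triangulation T)

/-- The integral point of the simplex `x.1` whose `x.2 i`-th coordinate is `s i`. -/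
def vertexPt {s : Fin 4 → ℕ} (hs : ∑ i, s i = n) (x : T × Perm (Fin 4)) : T × Pt n :=
  (x.1, Pt.of (s ∘ x.2.symm) (by rw [← hs]; exact Equiv.sum_comp x.2.symm s))

lemma vertexPt_coord {s : Fin 4 → ℕ} (hs : ∑ i, s i = n) (x : T × Perm (Fin 4)) :
    (vertexPt hs x).2.coord = s ∘ x.2.symm := rfl

lemma exists_eq_vertexPt (p : T × Pt n) (w : Perm (Fin 4)) :
    ∃ hs : ∑ i, (p.2.coord ∘ w) i = n, p = vertexPt hs (p.1, w) := by
  refine ⟨(Equiv.sum_comp w p.2.coord).trans p.2.sum_coord, Prod.ext rfl (Pt.ext ?_)⟩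
  rw [vertexPt_coord, Function.comp_assoc, Equiv.self_comp_symm, Function.comp_id]

/-- Cross the face opposite to `i`. -/
def Triangulation.cross (x : T × Perm (Fin 4)) (i : Fin 4) : T × Perm (Fin 4) :=
  (𝒯.adj x.1 i, 𝒯.perm x.1 i * x.2)

lemma Triangulation.cross_cross (x : T × Perm (Fin 4)) (i : Fin 4) :
    𝒯.cross (𝒯.cross x i) (𝒯.perm x.1 i i) = x := by
  refine Prod.ext (𝒯.adj_adj _ _) ?_
  change 𝒯.perm (𝒯.adj x.1 i) (𝒯.perm x.1 i i) * (𝒯.perm x.1 i * x.2) = x.2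
  rw [𝒯.perm_adj, inv_mul_cancel_left]

lemma Triangulation.faceRel_vertexPt_iff {s : Fin 4 → ℕ} (hs : ∑ i, s i = n)
    (x : T × Perm (Fin 4)) (y : T × Pt n) :
    𝒯.FaceRel (vertexPt hs x) y ↔ ∃ i, s i = 0 ∧ y = vertexPt hs (𝒯.cross x (x.2 i)) := by
  constructor
  · rintro ⟨i, h0, h1, h2⟩
    refine ⟨x.2.symm i, h0, ?_⟩
    rw [apply_symm_apply]
    refine Prod.ext h1 (Pt.ext (funext fun v => ?_))
    have := h2 ((𝒯.perm x.1 i).symm v)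
    change y.2.coord (𝒯.perm x.1 i ((𝒯.perm x.1 i).symm v)) = _ at this
    rw [apply_symm_apply] at this
    rw [this]
    rfl
  · rintro ⟨i, h0, rfl⟩
    refine ⟨x.2 i, ?_, rfl, fun v => ?_⟩
    · change s (x.2.symm (x.2 i)) = 0
      rwa [symm_apply_apply]
    · change s (x.2.symm ((𝒯.perm x.1 (x.2 i)).symm (𝒯.perm x.1 (x.2 i) v))) = s (x.2.symm v)
      rw [symm_apply_apply]

lemma Triangulation.FaceRel.symm {p q : T × Pt n} (h : 𝒯.FaceRel p q) : 𝒯.FaceRel q p := by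
  obtain ⟨hs, hp⟩ := exists_eq_vertexPt p 1
  rw [hp] at h ⊢
  obtain ⟨i, h0, rfl⟩ := (𝒯.faceRel_vertexPt_iff hs _ _).1 h
  rw [𝒯.faceRel_vertexPt_iff]
  refine ⟨i, h0, ?_⟩
  have := 𝒯.cross_cross (p.1, 1) i
  conv_lhs => rw [← this]
  rfl

/-- Every property of integral points that is preserved by crossing faces is a property of
classes. -/
lemma Triangulation.SamePoint.of_forall {P : T × Pt n → Prop}
    (hP : ∀ p q, 𝒯.FaceRel p q → P p → P q) {p q : T × Pt n} (h : 𝒯.SamePoint p q) (hp : P p) :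
    P q := by
  have key : P p ↔ P q := by
    clear hp
    induction h with
    | rel x y h => exact ⟨hP x y h, hP y x (h.symm)⟩
    | refl x => rfl
    | symm x y _ ih => exact ih.symm
    | trans x y z _ _ ih1 ih2 => exact ih1.trans ih2
  exact key.1 hp

/-- The factor of an integral point of a simplex in a gluing equation. -/
noncomputable def Triangulation.factor (z : T → SimplexShape n) (p : T × Pt n) : ℂ :=
  (z p.1).prodAt p.2 ^ ((𝒯.orient p.1 : ℤˣ) : ℤ)

lemma Triangulation.factor_vertexPt (z : T → SimplexShape n) {s : Fin 4 → ℕ} (hs : ∑ i, s i = n)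
    (x : T × Perm (Fin 4)) : 𝒯.factor z (vertexPt hs x) =
      (z x.1).aroundVec (s ∘ x.2.symm) ^ ((𝒯.orient x.1 : ℤˣ) : ℤ) := by
  rw [Triangulation.factor, SimplexShape.prodAt_eq_aroundVec, vertexPt_coord]
  rfl

open scoped Classical in
lemma Triangulation.gluingEqAt_iff_of_forall [Fintype T] {z : T → SimplexShape n} {p : T × Pt n}
    {S : Finset (T × Pt n)} (hS : ∀ q, q ∈ S ↔ 𝒯.SamePoint p q) :
    𝒯.GluingEqAt z p ↔ ∏ q ∈ S, 𝒯.factor z q = 1 := by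
  rw [Triangulation.GluingEqAt]
  have : (Finset.univ.filter fun q => 𝒯.SamePoint p q) = S := by
    ext q
    rw [hS]
    simp
  rw [this]
  rfl

lemma zpow_unit_eq_one_iff {x : ℂ} (u : ℤˣ) : x ^ ((u : ℤˣ) : ℤ) = 1 ↔ x = 1 := by
  rcases Int.units_eq_one_or u with rfl | rfl <;> simp

/-! ### Interior equations -/

lemma Pt.zeros_eq {t : Pt n} : t.zeros = (Finset.univ.filter fun i => t.coord i = 0).card := rfl

lemma Triangulation.gluingEqAt_interior_iff [Fintype T] {z : T → SimplexShape n} {p : T × Pt n}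
    (hp : p.2.zeros = 0) : 𝒯.GluingEqAt z p ↔ (z p.1).prodAt p.2 = 1 := by
  classical
  rw [Pt.zeros_eq, Finset.card_eq_zero, Finset.filter_eq_empty_iff] at hp
  rw [𝒯.gluingEqAt_iff_of_forall (S := {p}), Finset.prod_singleton, Triangulation.factor,
    zpow_unit_eq_one_iff]
  intro q
  rw [Finset.mem_singleton]
  constructor
  · rintro rfl
    exact Relation.EqvGen.refl _
  · intro h
    refine h.of_forall (P := fun q => q = p) 𝒯 ?_ rfl
    rintro _ q ⟨i, h0, -⟩ rfl
    exact absurd h0 (hp (Finset.mem_univ i))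

/-! ### Face equations -/

lemma exists_of_zeros_eq_one {p : T × Pt n} (hp : p.2.zeros = 1) :
    ∃ (x : T × Perm (Fin 4)) (a b k : ℕ) (hs : ∑ i, ![a + 1, b + 1, k + 1, 0] i = n),
      p = vertexPt hs x := by
  rw [Pt.zeros_eq, Finset.card_eq_one] at hp
  obtain ⟨i, hi⟩ := hp
  have hz : ∀ v, p.2.coord v = 0 ↔ v = i := fun v => by
    simpa using Finset.ext_iff.1 hi v
  obtain ⟨hs, h⟩ := exists_eq_vertexPt p (swap 3 i)
  have h3 : (p.2.coord ∘ swap 3 i) 3 = 0 := by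
    rw [Function.comp_apply, swap_apply_left, hz]
  have hne : ∀ v, v ≠ 3 → (p.2.coord ∘ swap 3 i) v ≠ 0 := fun v hv h => by
    rw [Function.comp_apply, hz] at h
    exact hv ((swap 3 i).injective (by rw [h, swap_apply_left]))
  generalize p.2.coord ∘ swap 3 i = s at *
  obtain ⟨a, ha⟩ := Nat.exists_eq_succ_of_ne_zero (hne 0 (by decide))
  obtain ⟨b, hb⟩ := Nat.exists_eq_succ_of_ne_zero (hne 1 (by decide))
  obtain ⟨k, hk⟩ := Nat.exists_eq_succ_of_ne_zero (hne 2 (by decide))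
  obtain rfl : s = ![a + 1, b + 1, k + 1, 0] := by
    rw [← vec4_eta s, ha, hb, hk, h3]
  exact ⟨_, a, b, k, hs, h⟩

lemma vertexPt_face_ne {x y : T × Perm (Fin 4)} {a b k : ℕ}
    (hs : ∑ i, ![a + 1, b + 1, k + 1, 0] i = n) (h : vertexPt hs x = vertexPt hs y) :
    x.1 = y.1 ∧ x.2 3 = y.2 3 := by
  refine ⟨(Prod.ext_iff.1 h).1, ?_⟩
  have e := congrFun (congrArg Pt.coord (Prod.ext_iff.1 h).2) (x.2 3)
  rw [vertexPt_coord, vertexPt_coord, Function.comp_apply, Function.comp_apply,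
    symm_apply_apply] at e
  have hne : ∀ v : Fin 4, ![a + 1, b + 1, k + 1, 0] 3 = ![a + 1, b + 1, k + 1, 0] v → v = 3 := by
    intro v hv
    fin_cases v
    · exact absurd hv (Nat.succ_ne_zero _).symm
    · exact absurd hv (Nat.succ_ne_zero _).symm
    · exact absurd hv (Nat.succ_ne_zero _).symm
    · rfl
  exact (symm_apply_eq _).1 (hne _ e)

/-- An integral point inside a face lies in exactly two simplices. -/
lemma Triangulation.gluingEqAt_face_iff [Fintype T] {z : T → SimplexShape n}
    {x : T × Perm (Fin 4)} {a b k : ℕ} (hs : ∑ i, ![a + 1, b + 1, k + 1, 0] i = n) :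
    𝒯.GluingEqAt z (vertexPt hs x) ↔
      𝒯.factor z (vertexPt hs x) * 𝒯.factor z (vertexPt hs (𝒯.cross x (x.2 3))) = 1 := by
  classical
  have h3 : ∀ i : Fin 4, ![a + 1, b + 1, k + 1, 0] i = 0 ↔ i = 3 := fun i => by
    fin_cases i <;> simp
  have hrel : ∀ x q, 𝒯.FaceRel (vertexPt hs x) q ↔ q = vertexPt hs (𝒯.cross x (x.2 3)) := by
    intro x q
    rw [𝒯.faceRel_vertexPt_iff]
    simp only [h3, exists_eq_left]
  have hcc : 𝒯.cross (𝒯.cross x (x.2 3)) ((𝒯.cross x (x.2 3)).2 3) = x := 𝒯.cross_cross x (x.2 3)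
  rw [𝒯.gluingEqAt_iff_of_forall
    (S := {vertexPt hs x, vertexPt hs (𝒯.cross x (x.2 3))}), Finset.prod_pair]
  · intro h
    obtain ⟨h1, h2⟩ := vertexPt_face_ne hs h
    exact 𝒯.face_ne x.1 (x.2 3) (Prod.ext h1.symm h2.symm)
  · intro q
    rw [Finset.mem_insert, Finset.mem_singleton]
    constructor
    · rintro (rfl | rfl)
      · exact Relation.EqvGen.refl _
      · exact Relation.EqvGen.rel _ _ ((hrel _ _).2 rfl)
    · intro h
      refine h.of_forall (P := fun q => q = _ ∨ q = _) 𝒯 ?_ (Or.inl rfl)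
      rintro _ q hpq (rfl | rfl)
      · exact Or.inr ((hrel _ _).1 hpq)
      · rw [hrel, hcc] at hpq
        exact Or.inl hpq

lemma exists_glues_iff {g : T → Fin 4 → GL (Fin n) ℂ} (hg : ∀ Δ, GenericTuple (g Δ))
    (Δ : T) (w : Perm (Fin 4)) :
    (∃ h, 𝒯.Glues (fun Δ i => flag (g Δ i)) Δ (w 3) h) ↔ ∀ a b k, a + b + k + 3 = n →
      tripleRatio (fun a b k => ptolemy (g Δ ∘ w) ![a, b, k, 0]) a b k =
      tripleRatio (fun a b k =>
        ptolemy (g (𝒯.adj Δ (w 3)) ∘ (𝒯.perm Δ (w 3) * w : Perm (Fin 4))) ![a, b, k, 0]) a b k := by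
  constructor
  · rintro ⟨h, hh⟩ a b k hs
    obtain ⟨A, rfl⟩ := ProjGenLinGroup.mk_surjective h
    refine (tripleRatio_eq_of_flag (A := A) (fun i hi => ?_)
      (fun a b k hs => ((hg Δ).comp w).ne_zero (by omega)) hs).symm
    have := hh (w i) (w.injective.ne hi)
    rw [mk_smul_flag] at this
    exact this.symm
  · intro hX
    obtain ⟨τ, m, h⟩ := (hg Δ).exists_isNormalization w
    obtain ⟨τ', m', h'⟩ := (hg (𝒯.adj Δ (w 3))).exists_isNormalization (𝒯.perm Δ (w 3) * w)
    obtain rfl : m = m' := IsNormalization.eq_of_tripleRatio_eq (g := g Δ ∘ w)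
      (g' := g (𝒯.adj Δ (w 3)) ∘ (𝒯.perm Δ (w 3) * w : Perm (Fin 4))) h h' ((hg _).comp _)
      ((hg _).comp _) hX
    refine ⟨τ' * τ⁻¹, fun v hv => ?_⟩
    obtain ⟨j, rfl⟩ := w.surjective v
    have hj : j ≠ 3 := fun h => hv (by rw [h])
    change (τ' * τ⁻¹) • flag (g Δ (w j)) =
      flag (g (𝒯.adj Δ (w 3)) ((𝒯.perm Δ (w 3) * w : Perm (Fin 4)) j))
    rw [mul_smul]
    fin_cases j
    · exact (congrArg _ (inv_smul_eq_iff.2 h.2.1)).trans h'.2.1.symm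
    · exact (congrArg _ (inv_smul_eq_iff.2 h.2.2.1)).trans h'.2.2.1.symm
    · exact (congrArg _ (inv_smul_eq_iff.2 h.2.2.2)).trans h'.2.2.2.symm
    · exact absurd rfl hj

/-- The face equations compare the triple ratios of glued triples of flags. -/
lemma gluingEqAt_face_iff_tripleRatio [Fintype T] (hn : 2 ≤ n) {g : T → Fin 4 → GL (Fin n) ℂ}
    (hg : ∀ Δ, GenericTuple (g Δ)) {z : T → SimplexShape n}
    (hz : ∀ Δ, IsMonomialShape (ptolemy (g Δ)) (z Δ)) {x : T × Perm (Fin 4)} {a b k : ℕ}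
    (hs : ∑ i, ![a + 1, b + 1, k + 1, 0] i = n) :
    𝒯.GluingEqAt z (vertexPt hs x) ↔
      tripleRatio (fun a b k => ptolemy (g x.1 ∘ x.2) ![a, b, k, 0]) a b k =
      tripleRatio (fun a b k => ptolemy (g (𝒯.adj x.1 (x.2 3)) ∘
        (𝒯.perm x.1 (x.2 3) * x.2 : Perm (Fin 4))) ![a, b, k, 0]) a b k := by
  have hs' : a + b + k + 3 = n := by
    rw [← hs]; simp [Fin.sum_univ_four]; omega
  rw [𝒯.gluingEqAt_face_iff, 𝒯.factor_vertexPt, 𝒯.factor_vertexPt,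
    tripleRatio_comp_eq hn (hg _) (hz _) _ hs', tripleRatio_comp_eq hn (hg _) (hz _) _ hs', map_mul,
    𝒯.sign_perm]
  have n1 : (z x.1).aroundVec (![a + 1, b + 1, k + 1, 0] ∘ x.2.symm) ≠ 0 :=
    (z x.1).around_ne_zero _ _ _ _
  have n2 : (z (𝒯.adj x.1 (x.2 3))).aroundVec (![a + 1, b + 1, k + 1, 0] ∘
      (𝒯.perm x.1 (x.2 3) * x.2 : Perm (Fin 4)).symm) ≠ 0 := SimplexShape.around_ne_zero _ _ _ _ _
  change _ ^ _ * (z (𝒯.adj x.1 (x.2 3))).aroundVec (![a + 1, b + 1, k + 1, 0] ∘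
      (𝒯.perm x.1 (x.2 3) * x.2 : Perm (Fin 4)).symm) ^
        ((𝒯.orient (𝒯.adj x.1 (x.2 3)) : ℤˣ) : ℤ) = 1 ↔ _
  generalize (z x.1).aroundVec (![a + 1, b + 1, k + 1, 0] ∘ x.2.symm) = X at *
  generalize (z (𝒯.adj x.1 (x.2 3))).aroundVec (![a + 1, b + 1, k + 1, 0] ∘
      (𝒯.perm x.1 (x.2 3) * x.2 : Perm (Fin 4)).symm) = Y at *
  generalize 𝒯.orient x.1 = u
  generalize 𝒯.orient (𝒯.adj x.1 (x.2 3)) = u'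
  generalize Perm.sign x.2 = v
  rcases Int.units_eq_one_or u with rfl | rfl <;> rcases Int.units_eq_one_or u' with rfl | rfl <;>
    rcases Int.units_eq_one_or v with rfl | rfl <;> simp <;> field_simp <;> tauto

lemma faceEqs_iff [Fintype T] (hn : 2 ≤ n) {g : T → Fin 4 → GL (Fin n) ℂ}
    (hg : ∀ Δ, GenericTuple (g Δ)) {z : T → SimplexShape n}
    (hz : ∀ Δ, IsMonomialShape (ptolemy (g Δ)) (z Δ)) :
    𝒯.FaceEqs z ↔ ∀ Δ i, ∃ h, 𝒯.Glues (fun Δ i => flag (g Δ i)) Δ i h := by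
  constructor
  · intro h Δ i
    rw [← swap_apply_left 3 i, exists_glues_iff 𝒯 hg]
    intro a b k hs
    have hsum : ∑ i, ![a + 1, b + 1, k + 1, 0] i = n := by
      simp [Fin.sum_univ_four]; omega
    refine (gluingEqAt_face_iff_tripleRatio 𝒯 hn hg hz (x := (Δ, swap 3 i)) hsum).1 (h _ ?_)
    rw [Pt.zeros_eq, Finset.card_eq_one]
    refine ⟨i, ?_⟩
    ext v
    rw [Finset.mem_filter, Finset.mem_singleton, vertexPt_coord, Function.comp_apply]
    have h3 : ∀ i : Fin 4, ![a + 1, b + 1, k + 1, 0] i = 0 ↔ i = 3 := fun i => by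
      fin_cases i <;> simp
    rw [h3, symm_apply_eq, swap_apply_left]
    simp
  · intro h p hp
    obtain ⟨x, a, b, k, hs, rfl⟩ := exists_of_zeros_eq_one hp
    rw [gluingEqAt_face_iff_tripleRatio 𝒯 hn hg hz]
    exact (exists_glues_iff 𝒯 hg x.1 x.2).1 (h _ _) a b k
      (by rw [← hs]; simp [Fin.sum_univ_four]; omega)

end Points

/-! ### Walking around the edges of a triangulation -/

section Edges

variable {n : ℕ} {T : Type*} (𝒯 : Triangulation T)

/-- Change the ordering of the vertices of a simplex by a permutation of positions. -/
def turn (u : Perm (Fin 4)) (x : T × Perm (Fin 4)) : T × Perm (Fin 4) := (x.1, x.2 * u)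

lemma turn_turn (u v : Perm (Fin 4)) (x : T × Perm (Fin 4)) :
    turn u (turn v x) = turn (v * u) x := by
  simp only [turn, mul_assoc]

lemma turn_one (x : T × Perm (Fin 4)) : turn 1 x = x := by simp [turn]

lemma turn_injective (x : T × Perm (Fin 4)) : Function.Injective fun u => turn u x :=
  fun _ _ h => mul_left_cancel (Prod.ext_iff.1 h).2

lemma Triangulation.edgeStep_eq (x : T × Perm (Fin 4)) :
    𝒯.edgeStep x = turn (swap 2 3) (𝒯.cross x (x.2 2)) := rfl

/-- Walking around an edge is reversed by exchanging the roles of the two faces at the edge. -/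
lemma Triangulation.edgeStep_turn_edgeStep (x : T × Perm (Fin 4)) :
    𝒯.edgeStep (turn (swap 2 3) (𝒯.edgeStep x)) = turn (swap 2 3) x := by
  rw [𝒯.edgeStep_eq x, turn_turn, Equiv.swap_mul_self, turn_one, 𝒯.edgeStep_eq]
  exact congrArg _ (𝒯.cross_cross x (x.2 2))

/-- Walking around an edge near one end is the same as walking around it near the other end. -/
lemma Triangulation.edgeStep_turn_swap (x : T × Perm (Fin 4)) :
    𝒯.edgeStep (turn (swap 0 1) x) = turn (swap 0 1) (𝒯.edgeStep x) := by
  have h2 : (x.2 * swap 0 1 : Perm (Fin 4)) 2 = x.2 2 :=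
    congrArg x.2 (show swap 0 1 (2 : Fin 4) = 2 by decide)
  have h : (swap 2 3 * swap 0 1 : Perm (Fin 4)) = swap 0 1 * swap 2 3 := by decide
  simp only [Triangulation.edgeStep, turn, h2, mul_assoc, h]

lemma Triangulation.edgeStep_injective : Function.Injective 𝒯.edgeStep := by
  intro x y h
  have := congrArg (fun x => turn (swap 2 3) (𝒯.edgeStep (turn (swap 2 3) x))) h
  simpa only [𝒯.edgeStep_turn_edgeStep, turn_turn, Equiv.swap_mul_self, turn_one] using this

lemma Triangulation.sign_edgeStep (x : T × Perm (Fin 4)) :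
    Perm.sign (𝒯.edgeStep x).2 * 𝒯.orient (𝒯.edgeStep x).1 = Perm.sign x.2 * 𝒯.orient x.1 := by
  simp only [Triangulation.edgeStep, map_mul, 𝒯.sign_perm]
  rw [Perm.sign_swap (by decide)]
  rcases Int.units_eq_one_or (𝒯.orient (𝒯.adj x.1 (x.2 2))) with h | h <;> rw [h] <;> simp [mul_comm]

lemma Triangulation.sign_edgeStep_iterate (k : ℕ) (x : T × Perm (Fin 4)) :
    Perm.sign (𝒯.edgeStep^[k] x).2 * 𝒯.orient (𝒯.edgeStep^[k] x).1 =
      Perm.sign x.2 * 𝒯.orient x.1 := by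
  induction k with
  | zero => rfl
  | succ k ih => rw [Function.iterate_succ_apply', 𝒯.sign_edgeStep, ih]

/-- An edge is never identified with itself in reverse by walking around it: halfway, a face would
be glued to itself, or a simplex at the edge would coincide with its own reflection. -/
lemma Triangulation.edgeStep_iterate_ne (d : ℕ) (x : T × Perm (Fin 4)) :
    𝒯.edgeStep^[d] x ≠ turn (swap 0 1 * swap 2 3) x := by
  induction d using Nat.twoStepInduction generalizing x with
  | zero =>
    intro h
    rw [Function.iterate_zero_apply, ← turn_one x, turn_turn] at h
    exact absurd (turn_injective x h) (by decide)
  | one =>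
    intro h
    rw [Function.iterate_one, 𝒯.edgeStep_eq, ← turn_turn] at h
    have h' := congrArg (turn (swap 2 3)) h
    rw [turn_turn, turn_turn (swap 2 3) (swap 2 3), Equiv.swap_mul_self, turn_one, turn_one] at h'
    obtain ⟨h1, h2⟩ := Prod.ext_iff.1 h'
    refine 𝒯.face_ne x.1 (x.2 2) (Prod.ext h1 ?_)
    have := congrArg (fun w : Perm (Fin 4) => w 2) h2
    exact this.trans (congrArg x.2 (by decide))
  | more d ih _ =>
    intro h
    refine ih (𝒯.edgeStep x) (𝒯.edgeStep_injective ?_)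
    have e : 𝒯.edgeStep (turn (swap 0 1 * swap 2 3) (𝒯.edgeStep x)) =
        turn (swap 0 1 * swap 2 3) x := by
      rw [← turn_turn, ← 𝒯.edgeStep_turn_swap, 𝒯.edgeStep_turn_edgeStep, turn_turn]
    rw [e, ← h, ← Function.iterate_succ_apply 𝒯.edgeStep, ← Function.iterate_succ_apply' 𝒯.edgeStep]

/-! ### Edge equations -/

lemma edge_eq_zero_iff (a b : ℕ) (v : Fin 4) : ![a + 1, b + 1, 0, 0] v = 0 ↔ v = 2 ∨ v = 3 := by
  fin_cases v <;> simp

lemma exists_of_zeros_eq_two {p : T × Pt n} (hp : p.2.zeros = 2) :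
    ∃ (x : T × Perm (Fin 4)) (a b : ℕ) (hs : ∑ i, ![a + 1, b + 1, 0, 0] i = n),
      p = vertexPt hs x := by
  rw [Pt.zeros_eq, Finset.card_eq_two] at hp
  obtain ⟨i, j, hij, h⟩ := hp
  have hz : ∀ v, p.2.coord v = 0 ↔ v = i ∨ v = j := fun v => by
    simpa using Finset.ext_iff.1 h v
  obtain ⟨w, rfl, rfl⟩ : ∃ w : Perm (Fin 4), w 2 = i ∧ w 3 = j := by
    clear h hz
    revert i j
    decide
  obtain ⟨hs, h⟩ := exists_eq_vertexPt p w
  have h' : ∀ v, (p.2.coord ∘ w) v = 0 ↔ v = 2 ∨ v = 3 := fun v => by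
    rw [Function.comp_apply, hz, w.injective.eq_iff, w.injective.eq_iff]
  generalize p.2.coord ∘ w = s at *
  obtain ⟨a, ha⟩ := Nat.exists_eq_succ_of_ne_zero (mt (h' 0).1 (by decide))
  obtain ⟨b, hb⟩ := Nat.exists_eq_succ_of_ne_zero (mt (h' 1).1 (by decide))
  obtain rfl : s = ![a + 1, b + 1, 0, 0] := by
    rw [← vec4_eta s, ha, hb, (h' 2).2 (by decide), (h' 3).2 (by decide)]
  exact ⟨_, a, b, hs, h⟩

lemma zeros_vertexPt_edge {a b : ℕ} (hs : ∑ i, ![a + 1, b + 1, 0, 0] i = n)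
    (x : T × Perm (Fin 4)) : (vertexPt hs x).2.zeros = 2 := by
  rw [Pt.zeros_eq, Finset.card_eq_two]
  refine ⟨x.2 2, x.2 3, x.2.injective.ne (by decide), ?_⟩
  ext v
  rw [Finset.mem_filter, vertexPt_coord, Function.comp_apply, edge_eq_zero_iff, symm_apply_eq,
    symm_apply_eq]
  simp

lemma vertexPt_turn {a b : ℕ} (hs : ∑ i, ![a + 1, b + 1, 0, 0] i = n) (x : T × Perm (Fin 4)) :
    vertexPt hs (turn (swap 2 3) x) = vertexPt hs x := by
  refine Prod.ext rfl (Pt.ext (funext fun v => ?_))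
  change ![a + 1, b + 1, 0, 0] (swap 2 3 (x.2.symm v)) = ![a + 1, b + 1, 0, 0] (x.2.symm v)
  have h : ∀ u : Fin 4, swap 2 3 u = u ∨ (swap 2 3 u = 2 ∨ swap 2 3 u = 3) ∧ (u = 2 ∨ u = 3) := by
    decide
  rcases h (x.2.symm v) with h | ⟨h, h'⟩
  · rw [h]
  · rw [(edge_eq_zero_iff a b _).2 h, (edge_eq_zero_iff a b _).2 h']

lemma Triangulation.faceRel_edge_iff {a b : ℕ} (hs : ∑ i, ![a + 1, b + 1, 0, 0] i = n)
    (x : T × Perm (Fin 4)) (q : T × Pt n) : 𝒯.FaceRel (vertexPt hs x) q ↔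
      q = vertexPt hs (𝒯.edgeStep x) ∨ q = vertexPt hs (𝒯.edgeStep (turn (swap 2 3) x)) := by
  rw [𝒯.faceRel_vertexPt_iff]
  simp only [edge_eq_zero_iff, or_and_right, exists_or, exists_eq_left]
  have h : (turn (swap 2 3) x).2 2 = x.2 3 := congrArg x.2 (by decide)
  have e : 𝒯.edgeStep (turn (swap 2 3) x) = 𝒯.cross x (x.2 3) := by
    rw [𝒯.edgeStep_eq, h]
    refine Prod.ext rfl ?_
    change 𝒯.perm x.1 (x.2 3) * (x.2 * swap 2 3) * swap 2 3 = 𝒯.perm x.1 (x.2 3) * x.2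
    rw [mul_assoc, mul_assoc, Equiv.swap_mul_self, mul_one]
  rw [e, 𝒯.edgeStep_eq, vertexPt_turn]

lemma Triangulation.minimalPeriod_edgeStep_pos [Fintype T] (x : T × Perm (Fin 4)) :
    0 < Function.minimalPeriod 𝒯.edgeStep x :=
  Function.minimalPeriod_pos_of_mem_periodicPts (𝒯.edgeStep_injective.mem_periodicPts x)

/-- The integral points identified with a point inside an edge are met when walking once around
the edge. -/
lemma Triangulation.samePoint_edge_iff [Fintype T] {a b : ℕ}
    (hs : ∑ i, ![a + 1, b + 1, 0, 0] i = n) (x : T × Perm (Fin 4)) (q : T × Pt n) :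
    𝒯.SamePoint (vertexPt hs x) q ↔
      ∃ j < Function.minimalPeriod 𝒯.edgeStep x, q = vertexPt hs (𝒯.edgeStep^[j] x) := by
  have hN := 𝒯.minimalPeriod_edgeStep_pos x
  constructor
  · intro h
    obtain ⟨j, rfl⟩ := h.of_forall (P := fun q => ∃ j, q = vertexPt hs (𝒯.edgeStep^[j] x)) 𝒯 (by
      rintro _ q hpq ⟨j, rfl⟩
      rcases (𝒯.faceRel_edge_iff hs _ _).1 hpq with rfl | rfl
      · exact ⟨j + 1, by rw [Function.iterate_succ_apply']⟩
      · refine ⟨j + (Function.minimalPeriod 𝒯.edgeStep x - 1), ?_⟩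
        have e : 𝒯.edgeStep^[j] x =
            𝒯.edgeStep (𝒯.edgeStep^[j + (Function.minimalPeriod 𝒯.edgeStep x - 1)] x) := by
          rw [← Function.iterate_succ_apply' 𝒯.edgeStep, Nat.succ_eq_add_one, add_assoc,
            Nat.sub_add_cancel hN, Function.iterate_add_minimalPeriod_eq]
        rw [e, 𝒯.edgeStep_turn_edgeStep, vertexPt_turn]) ⟨0, rfl⟩
    exact ⟨j % Function.minimalPeriod 𝒯.edgeStep x, Nat.mod_lt _ hN, by
      rw [Function.iterate_mod_minimalPeriod_eq]⟩
  · rintro ⟨j, -, rfl⟩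
    induction j with
    | zero => exact Relation.EqvGen.refl _
    | succ j ih =>
      refine ih.trans _ _ _ (Relation.EqvGen.rel _ _ ?_)
      rw [Function.iterate_succ_apply', 𝒯.faceRel_edge_iff]
      exact Or.inl rfl

/-- Walking once around an edge, no integral point is met twice. -/
lemma Triangulation.vertexPt_edge_injOn {a b : ℕ}
    (hs : ∑ i, ![a + 1, b + 1, 0, 0] i = n) (x : T × Perm (Fin 4)) :
    Set.InjOn (fun j => vertexPt hs (𝒯.edgeStep^[j] x))
      (Finset.range (Function.minimalPeriod 𝒯.edgeStep x)) := by
  have key : ∀ i j, i ≤ j → vertexPt hs (𝒯.edgeStep^[i] x) = vertexPt hs (𝒯.edgeStep^[j] x) →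
      𝒯.edgeStep^[i] x = 𝒯.edgeStep^[j] x := by
    intro i j hij h
    obtain ⟨d, rfl⟩ := Nat.exists_eq_add_of_le' hij
    have hsgn := 𝒯.sign_edgeStep_iterate d (𝒯.edgeStep^[i] x)
    have hne := 𝒯.edgeStep_iterate_ne d (𝒯.edgeStep^[i] x)
    rw [Function.iterate_add_apply] at h ⊢
    generalize 𝒯.edgeStep^[i] x = y at *
    generalize 𝒯.edgeStep^[d] y = y' at *
    obtain ⟨u, rfl⟩ : ∃ u, y' = turn u y := ⟨y.2⁻¹ * y'.2, Prod.ext (Prod.ext_iff.1 h).1.symm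
      (by simp [turn])⟩
    have hu : ∀ v, ![a + 1, b + 1, 0, 0] (u v) = ![a + 1, b + 1, 0, 0] v := fun v => by
      have e := congrFun (congrArg Pt.coord (Prod.ext_iff.1 h).2) (y.2 (u v))
      rw [vertexPt_coord, vertexPt_coord, Function.comp_apply, Function.comp_apply,
        symm_apply_apply] at e
      rw [e]
      exact congrArg _ ((symm_apply_eq _).2 rfl)
    have hu2 := (edge_eq_zero_iff a b (u 2)).1 ((hu 2).trans rfl)
    have hu3 := (edge_eq_zero_iff a b (u 3)).1 ((hu 3).trans rfl)
    have hsu : Perm.sign u = 1 := by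
      change Perm.sign (y.2 * u) * _ = _ at hsgn
      rw [map_mul] at hsgn
      exact mul_eq_left.1 (mul_right_cancel hsgn)
    have : u = 1 ∨ u = swap 0 1 * swap 2 3 := by
      clear hu hsgn hne h
      revert u
      decide
    rcases this with rfl | rfl
    · rw [turn_one]
    · exact absurd rfl hne
  intro i hi j hj h
  rw [Finset.coe_range] at hi hj
  refine Function.iterate_injOn_Iio_minimalPeriod hi hj ?_
  rcases le_total i j with hij | hij
  · exact key i j hij h
  · exact (key j i hij h.symm).symm

lemma Triangulation.gluingEqAt_edge_iff [Fintype T] (hn : 2 ≤ n) {g : T → Fin 4 → GL (Fin n) ℂ}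
    (hg : ∀ Δ, GenericTuple (g Δ)) {z : T → SimplexShape n}
    (hz : ∀ Δ, IsMonomialShape (ptolemy (g Δ)) (z Δ)) {a b : ℕ}
    (hs : ∑ i, ![a + 1, b + 1, 0, 0] i = n) (x : T × Perm (Fin 4)) :
    𝒯.GluingEqAt z (vertexPt hs x) ↔
      ∏ j ∈ Finset.range (Function.minimalPeriod 𝒯.edgeStep x),
        shapeA (ptolemy (g (𝒯.edgeStep^[j] x).1 ∘ (𝒯.edgeStep^[j] x).2)) a b 0 0 = 1 := by
  classical
  have hs' : a + b + 2 = n := by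
    rw [← hs]; simp [Fin.sum_univ_four]; omega
  rw [𝒯.gluingEqAt_iff_of_forall (S := (Finset.range (Function.minimalPeriod 𝒯.edgeStep x)).image
    fun j => vertexPt hs (𝒯.edgeStep^[j] x)), Finset.prod_image (𝒯.vertexPt_edge_injOn hs x)]
  · rw [← zpow_unit_eq_one_iff (Perm.sign x.2 * 𝒯.orient x.1), ← Finset.prod_zpow]
    refine Eq.congr_left (Finset.prod_congr rfl fun j _ => ?_)
    rw [𝒯.factor_vertexPt, shapeA_comp_eq hn (hg _) (hz _) _ hs', ← 𝒯.sign_edgeStep_iterate j x,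
      ← _root_.zpow_mul, ← Units.val_mul, ← mul_assoc, mul_right_comm, Int.units_mul_self,
      one_mul]
  · intro q
    rw [𝒯.samePoint_edge_iff]
    simp [eq_comm]

lemma Triangulation.prod_range_mul_minimalPeriod {M : Type*} [CommMonoid M]
    (f : T × Perm (Fin 4) → M) (x : T × Perm (Fin 4)) (k : ℕ) :
    ∏ j ∈ Finset.range (Function.minimalPeriod 𝒯.edgeStep x * k), f (𝒯.edgeStep^[j] x) =
      (∏ j ∈ Finset.range (Function.minimalPeriod 𝒯.edgeStep x), f (𝒯.edgeStep^[j] x)) ^ k := by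
  induction k with
  | zero => simp
  | succ k ih =>
    rw [Nat.mul_succ, Finset.prod_range_add, ih, pow_succ]
    congr 1
    refine Finset.prod_congr rfl fun j _ => ?_
    rw [← Function.iterate_mod_minimalPeriod_eq, Nat.mul_add_mod,
      Function.iterate_mod_minimalPeriod_eq]

/-- The labels of short edges at a prism are diagonal matrices. -/
lemma prod_short_eq_mk {c : T → Labeling PGL(n, ℂ)} {d : T × Perm (Fin 4) → Fin n → ℂˣ}
    (hd : ∀ y, (c y.1).short y.2 = ProjGenLinGroup.mk (diagUnits (d y)))
    (x : T × Perm (Fin 4)) (k : ℕ) :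
    ((List.range k).map fun j =>
      (c (𝒯.edgeStep^[j] x).1).short (𝒯.edgeStep^[j] x).2).prod =
    ProjGenLinGroup.mk (diagUnits (∏ j ∈ Finset.range k, d (𝒯.edgeStep^[j] x))) := by
  induction k with
  | zero => simp [diagUnits_one]
  | succ k ih =>
    rw [List.range_succ, List.map_append, List.prod_append, ih, Finset.prod_range_succ,
      diagUnits_mul, map_mul, List.map_singleton, List.prod_singleton, hd]

/-- The edge equations say that the products of short edges around the prisms are trivial: they
compare consecutive diagonal entries of these products. -/
lemma edgeEqs_iff [Fintype T] (hn : 2 ≤ n) {g : T → Fin 4 → GL (Fin n) ℂ}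
    (hg : ∀ Δ, GenericTuple (g Δ)) {z : T → SimplexShape n}
    (hz : ∀ Δ, IsMonomialShape (ptolemy (g Δ)) (z Δ)) {τ : T → Perm (Fin 4) → PGL(n, ℂ)}
    (hτ : ∀ Δ, IsNaturalCochain (fun i => flag (g Δ i)) (τ Δ)) :
    𝒯.EdgeEqs z ↔ 𝒯.PrismsClose (fun Δ => Labeling.coboundary (τ Δ)) := by
  choose m hm using fun Δ => isNaturalCochain_iff.1 (hτ Δ)
  have hm' : ∀ Δ w, IsNormalization (flag (g Δ (w 0))) (flag (g Δ (w 1))) (flag (g Δ (w 3)))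
      (τ Δ (w * swap 2 3)) (m Δ (w * swap 2 3)) := fun Δ w => hm Δ (w * swap 2 3)
  have hex : ∀ y : T × Perm (Fin 4), ∃ d, (τ y.1 y.2)⁻¹ * τ y.1 (y.2 * swap 2 3) =
      ProjGenLinGroup.mk (diagUnits d) := fun y =>
    mem_H_iff.1 ((hm y.1 y.2).inv_mul_mem_H (hm' y.1 y.2))
  choose d hd using hex
  have hA : ∀ (y : T × Perm (Fin 4)) {a b : ℕ} (hs : a + b + 2 = n),
      shapeA (ptolemy (g y.1 ∘ y.2)) a b 0 0 = d y ⟨a + 1, by omega⟩ / d y ⟨a, by omega⟩ :=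
    fun y _ _ hs => shapeA_edge_eq ((hg y.1).comp y.2) (hm y.1 y.2) (hm' y.1 y.2) (hd y) hs
  have hP : 𝒯.PrismsClose (fun Δ => Labeling.coboundary (τ Δ)) ↔
      ∀ (x : T × Perm (Fin 4)) (k : ℕ), 𝒯.edgeStep^[k] x = x → ∀ a b, a + b + 2 = n →
        ∏ j ∈ Finset.range k,
          shapeA (ptolemy (g (𝒯.edgeStep^[j] x).1 ∘ (𝒯.edgeStep^[j] x).2)) a b 0 0 = 1 := by
    refine forall_congr' fun x => forall_congr' fun k => imp_congr_right fun _ => ?_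
    rw [prod_short_eq_mk 𝒯 (c := fun Δ => Labeling.coboundary (τ Δ)) hd, mk_diagUnits_eq_one_iff]
    have e : ∀ a (h : a + 1 < n), ∀ b, a + b + 2 = n → ∏ j ∈ Finset.range k,
          shapeA (ptolemy (g (𝒯.edgeStep^[j] x).1 ∘ (𝒯.edgeStep^[j] x).2)) a b 0 0 =
        ((∏ j ∈ Finset.range k, d (𝒯.edgeStep^[j] x)) ⟨a + 1, h⟩ : ℂ) /
          (∏ j ∈ Finset.range k, d (𝒯.edgeStep^[j] x)) ⟨a, by omega⟩ := by
      intro a h b hs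
      rw [Finset.prod_congr rfl fun j _ => hA (𝒯.edgeStep^[j] x) hs, Finset.prod_div_distrib,
        Finset.prod_apply, Finset.prod_apply, Units.coe_prod, Units.coe_prod]
    constructor
    · intro h a b hs
      rw [e a (by omega) b hs, h]
    · intro h a ha
      rw [← e a ha (n - 2 - a) (by omega), h a _ (by omega)]
  rw [hP]
  constructor
  · intro h x k hk a b hs
    obtain ⟨r, rfl⟩ := Function.IsPeriodicPt.minimalPeriod_dvd (f := 𝒯.edgeStep) (x := x) hk
    rw [𝒯.prod_range_mul_minimalPeriod
      (fun y => shapeA (ptolemy (g y.1 ∘ y.2)) a b 0 0) x r]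
    have hsum : ∑ i, ![a + 1, b + 1, 0, 0] i = n := by
      simp [Fin.sum_univ_four]; omega
    rw [(𝒯.gluingEqAt_edge_iff hn hg hz hsum x).1 (h _ (zeros_vertexPt_edge hsum x)), one_pow]
  · intro h p hp
    obtain ⟨x, a, b, hs, rfl⟩ := exists_of_zeros_eq_two hp
    rw [𝒯.gluingEqAt_edge_iff hn hg hz]
    exact h x _ (Function.isPeriodicPt_minimalPeriod _ _) a b
      (by rw [← hs]; simp [Fin.sum_univ_four]; omega)

end Edges

/-! ### Gluing equations and cocycles -/

section Correspondence

variable {n : ℕ} {T : Type*} (𝒯 : Triangulation T)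

lemma exists_tuples {D : T → Deco n} (hD : ∀ Δ, IsGeneric (D Δ))
    {z : T → SimplexShape n} (hz : ∀ Δ, IsShapeOf (D Δ) (z Δ)) {c : T → Labeling PGL(n, ℂ)}
    (hc : ∀ Δ, IsNaturalCocycleOf (D Δ) (c Δ)) :
    ∃ (g : T → Fin 4 → GL (Fin n) ℂ) (τ : T → Perm (Fin 4) → PGL(n, ℂ)),
      (∀ Δ, GenericTuple (g Δ)) ∧ (∀ Δ, IsMonomialShape (ptolemy (g Δ)) (z Δ)) ∧
      (∀ Δ, IsNaturalCochain (fun i => flag (g Δ i)) (τ Δ)) ∧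
      c = fun Δ => Labeling.coboundary (τ Δ) := by
  choose g hg using fun Δ => exists_decoOf_eq (D Δ)
  choose τ hτ using fun Δ => (hc Δ _ (hg Δ)).1.exists
  exact ⟨g, τ, fun Δ => genericTuple_iff.2 (by rw [hg]; exact hD Δ), fun Δ => hz Δ _ (hg Δ), hτ,
    funext fun Δ => (hc Δ _ (hg Δ)).2 _ (hτ Δ)⟩

theorem faceEqs_iff_facesMatch [Fintype T] (hn : 2 ≤ n) {D : T → Deco n}
    (hD : ∀ Δ, IsGeneric (D Δ)) {z : T → SimplexShape n} (hz : ∀ Δ, IsShapeOf (D Δ) (z Δ))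
    {c : T → Labeling PGL(n, ℂ)} (hc : ∀ Δ, IsNaturalCocycleOf (D Δ) (c Δ)) :
    𝒯.FaceEqs z ↔ 𝒯.FacesMatch c := by
  obtain ⟨g, τ, hg, hz, hτ, rfl⟩ := exists_tuples hD hz hc
  rw [faceEqs_iff 𝒯 hn hg hz, facesMatch_coboundary_iff]
  simp only [glues_iff 𝒯 (by omega : 0 < n) hτ]

theorem edgeEqs_iff_prismsClose [Fintype T] (hn : 2 ≤ n) {D : T → Deco n}
    (hD : ∀ Δ, IsGeneric (D Δ)) {z : T → SimplexShape n} (hz : ∀ Δ, IsShapeOf (D Δ) (z Δ))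
    {c : T → Labeling PGL(n, ℂ)} (hc : ∀ Δ, IsNaturalCocycleOf (D Δ) (c Δ)) :
    𝒯.EdgeEqs z ↔ 𝒯.PrismsClose c := by
  obtain ⟨g, τ, hg, hz, hτ, rfl⟩ := exists_tuples hD hz hc
  exact edgeEqs_iff 𝒯 hn hg hz hτ

lemma gluingEqs_iff [Fintype T] (hn : 0 < n) {z : T → SimplexShape n} :
    (∀ p : T × Pt n, p.2.zeros ≠ 3 → 𝒯.GluingEqAt z p) ↔
      (∀ Δ, (z Δ).InteriorEqs) ∧ 𝒯.FaceEqs z ∧ 𝒯.EdgeEqs z := by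
  constructor
  · intro h
    exact ⟨fun Δ t ht => (𝒯.gluingEqAt_interior_iff (p := (Δ, t)) ht).1 (h (Δ, t) (by simp [ht])),
      fun p hp => h p (by simp [hp]), fun p hp => h p (by simp [hp])⟩
  · rintro ⟨h0, h1, h2⟩ p hp
    have h4 : p.2.zeros ≠ 4 := fun h4 => by
      have h5 : (Finset.univ.filter fun i => p.2.coord i = 0).card =
          (Finset.univ : Finset (Fin 4)).card := h4
      rw [Finset.card_filter_eq_iff] at h5
      have := p.2.sum_coord
      rw [Finset.sum_eq_zero h5] at this
      omega
    have hle : p.2.zeros ≤ 4 := (Finset.card_filter_le _ _).trans (by simp)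
    have : p.2.zeros = 0 ∨ p.2.zeros = 1 ∨ p.2.zeros = 2 := by omega
    rcases this with h | h | h
    · exact (𝒯.gluingEqAt_interior_iff h).2 (h0 _ _ h)
    · exact h1 p h
    · exact h2 p h

lemma isCocycle_iff {c : T → Labeling PGL(n, ℂ)} (hc : ∀ Δ, IsNatural (c Δ)) :
    𝒯.IsCocycle c ↔ 𝒯.FacesMatch c ∧ 𝒯.PrismsClose c :=
  ⟨fun h => ⟨h.2, h.3⟩, fun h => ⟨fun Δ => (hc Δ).1.toIsCocycle, h.1, h.2⟩⟩

end Correspondence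

end GluingEq

open GluingEq

theorem mainTheorem5 (n : ℕ) (hn : 2 ≤ n) {T : Type*} [Fintype T]
    (𝒯 : GluingEq.Triangulation T) :
    ∃ (𝒵₀ : GluingEq.GenericDeco n → GluingEq.InteriorShape n)
      (ℒ₀ : GluingEq.GenericDeco n → GluingEq.NaturalCocycle n)
      (𝒵 : 𝒯.GenericDecoration n → 𝒯.ShapeAssignment n)
      (ℒ : 𝒯.GenericDecoration n → 𝒯.NaturalCocycles n),
      -- the maps are the ones of the diagram, on a simplex and on the triangulated manifold
      (∀ D, GluingEq.IsShapeOf D.1 (𝒵₀ D).1) ∧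
      (∀ D, GluingEq.IsNaturalCocycleOf D.1 (ℒ₀ D).1) ∧
      (∀ D Δ, GluingEq.IsShapeOf (D.1.toFun Δ) ((𝒵 D).1 Δ)) ∧
      (∀ D Δ, GluingEq.IsNaturalCocycleOf (D.1.toFun Δ) ((ℒ D).1 Δ)) ∧
      -- the correspondences on a simplex
      Function.Bijective 𝒵₀ ∧ Function.Bijective ℒ₀ ∧
      -- face and edge equations say exactly that the natural cocycles of the simplices glue
      (∀ D : T → GluingEq.GenericDeco n,
        (𝒯.FaceEqs (fun Δ => (𝒵₀ (D Δ)).1) ↔ 𝒯.FacesMatch (fun Δ => (ℒ₀ (D Δ)).1)) ∧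
        (𝒯.EdgeEqs (fun Δ => (𝒵₀ (D Δ)).1) ↔ 𝒯.PrismsClose (fun Δ => (ℒ₀ (D Δ)).1)) ∧
        (𝒯.FaceEqs (fun Δ => (𝒵₀ (D Δ)).1) ∧ 𝒯.EdgeEqs (fun Δ => (𝒵₀ (D Δ)).1) ↔
          𝒯.IsCocycle (fun Δ => (ℒ₀ (D Δ)).1))) ∧
      -- the correspondences on the triangulated manifold
      Function.Bijective 𝒵 ∧ Function.Bijective ℒ := by
  have hn' : 0 < n := by omega
  choose Z hZ hZi using fun D : GenericDeco n => (existsUnique_isShapeOf hn D.2).exists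
  choose C hCn hC using fun D : GenericDeco n => exists_isNaturalCocycleOf hn' D.2
  have hface : ∀ D : T → GenericDeco n,
      𝒯.FaceEqs (fun Δ => Z (D Δ)) ↔ 𝒯.FacesMatch (fun Δ => C (D Δ)) := fun D =>
    faceEqs_iff_facesMatch 𝒯 hn (D := fun Δ => (D Δ).1) (fun Δ => (D Δ).2) (fun Δ => hZ (D Δ))
      fun Δ => hC (D Δ)
  have hedge : ∀ D : T → GenericDeco n,
      𝒯.EdgeEqs (fun Δ => Z (D Δ)) ↔ 𝒯.PrismsClose (fun Δ => C (D Δ)) := fun D =>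
    edgeEqs_iff_prismsClose 𝒯 hn (D := fun Δ => (D Δ).1) (fun Δ => (D Δ).2) (fun Δ => hZ (D Δ))
      fun Δ => hC (D Δ)
  have hdec : ∀ D : T → GenericDeco n, (∃ D' : 𝒯.Decoration PGL(n, ℂ) (B n),
      D'.toFun = fun Δ => (D Δ).1) ↔
      𝒯.FacesMatch (fun Δ => C (D Δ)) ∧ 𝒯.PrismsClose (fun Δ => C (D Δ)) := fun D =>
    exists_decoration_iff 𝒯 hn' fun Δ => hC (D Δ)
  have hcoc : ∀ D : T → GenericDeco n, 𝒯.IsCocycle (fun Δ => C (D Δ)) ↔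
      𝒯.FacesMatch (fun Δ => C (D Δ)) ∧ 𝒯.PrismsClose (fun Δ => C (D Δ)) := fun D =>
    isCocycle_iff 𝒯 fun Δ => hCn (D Δ)
  -- the generic decorations of the simplices of a decorated triangulation
  let S : 𝒯.GenericDecoration n → T → GenericDeco n := fun D Δ => ⟨D.1.toFun Δ, D.2 Δ⟩
  have hS : ∀ D, 𝒯.FacesMatch (fun Δ => C (S D Δ)) ∧ 𝒯.PrismsClose (fun Δ => C (S D Δ)) :=
    fun D => (hdec (S D)).1 ⟨D.1, rfl⟩
  have hSinj : Function.Injective S := fun D D' h =>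
    Subtype.ext (Triangulation.Decoration.ext
      (funext fun Δ => congrArg Subtype.val (congrFun h Δ)))
  have hSsurj : ∀ D : T → GenericDeco n, 𝒯.FacesMatch (fun Δ => C (D Δ)) ∧
      𝒯.PrismsClose (fun Δ => C (D Δ)) → ∃ D', S D' = D := fun D h => by
    obtain ⟨D', hD'⟩ := (hdec D).2 h
    exact ⟨⟨D', fun Δ => by rw [hD']; exact (D Δ).2⟩,
      funext fun Δ => Subtype.ext (congrFun hD' Δ)⟩
  have hZinj : ∀ D D', Z D = Z D' → D = D' := fun D D' h =>
    Subtype.ext ((hZ D).injective hn D.2 D'.2 (h ▸ hZ D'))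
  have hCinj : ∀ D D', C D = C D' → D = D' := fun D D' h =>
    Subtype.ext ((hC D).injective (h ▸ hC D'))
  have hZsurj : ∀ z : SimplexShape n, z.InteriorEqs → ∃ D, Z D = z := fun z hz => by
    obtain ⟨D, hD, h⟩ := hz.exists_isShapeOf hn
    exact ⟨⟨D, hD⟩, (existsUnique_isShapeOf hn hD).unique ⟨hZ ⟨D, hD⟩, hZi _⟩ ⟨h, hz⟩⟩
  have hCsurj : ∀ c, IsNatural c → ∃ D, C D = c := fun c hc => by
    obtain ⟨-, D, hD, h⟩ := hc
    exact ⟨⟨D, hD⟩, (hC ⟨D, hD⟩).unique h⟩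
  refine ⟨fun D => ⟨Z D, hZi D⟩, fun D => ⟨C D, hCn D⟩,
    fun D => ⟨fun Δ => Z (S D Δ), (gluingEqs_iff 𝒯 hn').2
      ⟨fun Δ => hZi _, (hface _).2 (hS D).1, (hedge _).2 (hS D).2⟩⟩,
    fun D => ⟨fun Δ => C (S D Δ), (hcoc _).2 (hS D), fun Δ => hCn _⟩,
    hZ, hC, fun D Δ => hZ (S D Δ), fun D Δ => hC (S D Δ), ⟨?_, ?_⟩, ⟨?_, ?_⟩, ?_, ⟨?_, ?_⟩, ?_, ?_⟩
  · exact fun D D' h => hZinj D D' (congrArg Subtype.val h)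
  · rintro ⟨z, hz⟩
    obtain ⟨D, rfl⟩ := hZsurj z hz
    exact ⟨D, rfl⟩
  · exact fun D D' h => hCinj D D' (congrArg Subtype.val h)
  · rintro ⟨c, hc⟩
    obtain ⟨D, rfl⟩ := hCsurj c hc
    exact ⟨D, rfl⟩
  · exact fun D => ⟨hface D, hedge D, by rw [hcoc, ← hface, ← hedge]⟩
  · exact fun D D' h => hSinj (funext fun Δ => hZinj _ _ (congrFun (congrArg Subtype.val h) Δ))
  · rintro ⟨z, hz⟩
    have hz' := (gluingEqs_iff 𝒯 hn').1 hz
    choose D hD using fun Δ => hZsurj (z Δ) (hz'.1 Δ)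
    obtain rfl : (fun Δ => Z (D Δ)) = z := funext hD
    obtain ⟨D', rfl⟩ := hSsurj D ⟨(hface D).1 hz'.2.1, (hedge D).1 hz'.2.2⟩
    exact ⟨D', rfl⟩
  · exact fun D D' h => hSinj (funext fun Δ => hCinj _ _ (congrFun (congrArg Subtype.val h) Δ))
  · rintro ⟨c, hc, hcn⟩
    choose D hD using fun Δ => hCsurj (c Δ) (hcn Δ)
    obtain rfl : (fun Δ => C (D Δ)) = c := funext hD
    obtain ⟨D', rfl⟩ := hSsurj D ((hcoc D).1 hc)
    exact ⟨D', rfl⟩
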